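/- Let $\Gamma$ be a Polish space with its Borel $\sigma$-algebra, $T>0$, $\mu\in\mathcal P(\Gamma)$, and let $L(x,\mathrm dy)$ be a kernel of nonnegative measures on $\Gamma$ with $\sup_{x}L(x,\Gamma)<\infty$. Write $\overline\nabla\varphi(x,y)=\varphi(y)-\varphi(x)$ and $p\otimes L(\mathrm dx\,\mathrm dy)=L(x,\mathrm dy)\,p(\mathrm dx)$; let $B_b(\Gamma)$ be the bounded Borel functions, and let $\mathcal M_+$ denote finite nonnegative measures. Let $f:\Gamma\to[0,+\infty]$ be Borel measurable and proper ($f\not\equiv+\infty$), with $e^{-\infty}:=0$. Assume instantaneous positivity: every bounded classical solution $h$ on $[0,T]$ of the backward Kolmogorov equation $$\partial_t h_t(x)+\int_\Gamma\overline\nabla h_t(x,y)\,L(x,\mathrm dy)=0\quad\text{on }(0,T)\times\Gamma,\qquad h_T=e^{-f},\tag{BKE}$$ satisfies $h_t(x)>0$ for all $t\in[0,T)$ and $x\in\Gamma$. A density-flux pair $(p,q)$ consists of a curve $p:[0,T]\to\mathcal P(\Gamma)$ that is continuous for setwise convergence and a family $q\in L^1((0,T);\mathcal M_+(\Gamma\times\Gamma))$.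 It belongs to $\mathcal A_{[0,T]}(\mu)$ if $p_0=\mu$, $$\int\varphi\,\mathrm dp_t-\int\varphi\,\mathrm dp_s=\int_s^t\!\!\int\overline\nabla\varphi\,\mathrm dq_r\,\mathrm dr\qquad\text{for all }0\le s\le t\le T,\ \varphi\in B_b(\Gamma),$$ and $$\mathscr L_{[0,T]}(p,q):=\int_0^T\mathrm{Ent}(q_t\,|\,p_t\otimes L)\,\mathrm dt<\infty.$$ Here $\mathrm{Ent}(\alpha|\beta)=\int(s\log s-s+1)\,\mathrm d\beta$ with $s=\mathrm d\alpha/\mathrm d\beta$ if $\alpha\ll\beta$, and $\mathrm{Ent}(\alpha|\beta)=+\infty$ otherwise. Let $$\gamma_{\rm det}(\mu)=\inf\Bigl\{\int_\Gamma f\,\mathrm dp_T+\mathscr L_{[0,T]}(p,q):(p,q)\in\mathcal A_{[0,T]}(\mu)\Bigr\}\in[0,+\infty].\tag{OC$_T$}$$ Then: (i) There is a unique $\psi:[0,T)\times\Gamma\to\mathbb R$, Borel in $x$, continuous in $t\in[0,T)$ and $C^1$ in $t\in(0,T)$, with $\int_\Gamma e^{\overline\nabla\psi_t(x,y)}L(x,\mathrm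 dy)<\infty$ for $t\in(0,T)$, which solves the Hamilton–Jacobi equation $$\partial_t\psi_t(x)+\int_\Gamma\bigl(e^{\overline\nabla\psi_t(x,y)}-1\bigr)L(x,\mathrm dy)=0\quad\text{on }(0,T)\times\Gamma,\qquad \lim_{t\to T^-}\psi_t(x)=-f(x)\ \text{for every }x.$$ Moreover $\psi_t=\log h_t$ on $[0,T)$ for a bounded classical solution $h$ of (BKE). (ii) If $\psi_0\in L^1(\mu)$, then (OC$_T$) has a unique optimal pair $(p,q)\in\mathcal A_{[0,T]}(\mu)$, where $q$ is identified up to null sets of times. (iii) If $\psi_0\in L^1(\mu)$, the optimal pair satisfies $q_t=\exp(\overline\nabla\psi_t)\,p_t\otimes L$ for a.e. $t\in(0,T)$. Moreover $p_0=\mu$ and $p\in C^1([0,T);\mathcal P(\Gamma))$ for setwise convergence: for every $t\in[0,T)$ the measure $\exp(\overline\nabla\psi_t)\,p_t\otimes L$ is finite, and for every $\varphi\in B_b(\Gamma)$ the function $t\mapsto\int\varphi\,\mathrm dp_t$ has on $[0,T)$ the continuous derivative $$\frac{\mathrm d}{\mathrm dt}\int_\Gamma\varphi\,\mathrm dp_t=\int_{\Gamma\times\Gamma}\overline\nabla\varphi(x,y)\,e^{\overline\nabla\psi_t(x,y)}\,(p_t\otimes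 L)(\mathrm dx\,\mathrm dy).$$ (iv) $\psi_0\le0$ and $\gamma_{\rm det}(\mu)=-\int_\Gamma\psi_0\,\mathrm d\mu$, as an identity in $[0,+\infty]$. In particular the value is finite if and only if $\psi_0\in L^1(\mu)$. -/

import Mathlib

open MeasureTheory ProbabilityTheory Set Filter Topology
open scoped ENNReal

noncomputable section

namespace JumpControl

variable {Γ : Type*} [MeasurableSpace Γ]

/-- The discrete gradient of `φ` at the pair `z = (x, y)`, namely `φ y - φ x`. -/
def dgrad (φ : Γ → ℝ) (z : Γ × Γ) : ℝ := φ z.2 - φ z.1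

/-- `φ` belongs to the space of bounded Borel functions. -/
def IsBddMeas (φ : Γ → ℝ) : Prop := Measurable φ ∧ ∃ M : ℝ, ∀ x, |φ x| ≤ M

/-- Bounded classical solution on `[0, T]` of the backward Kolmogorov equation
`∂ₜ h_t(x) + ∫ (h_t(y) - h_t(x)) L(x, dy) = 0` with terminal datum `g`. -/
structure IsBKESolution (L : Kernel Γ Γ) (T : ℝ) (g : Γ → ℝ) (h : ℝ → Γ → ℝ) : Prop where
  measurable : ∀ t ∈ Icc 0 T, Measurable (h t)
  bounded : ∃ M : ℝ, ∀ t ∈ Icc 0 T, ∀ x, |h t x| ≤ M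
  continuousOn : ∀ x, ContinuousOn (fun t => h t x) (Icc 0 T)
  equation : ∀ t ∈ Ioo 0 T, ∀ x,
    HasDerivAt (fun s => h s x) (-∫ y, dgrad (h t) (x, y) ∂(L x)) t
  terminal : ∀ x, h T x = g x

/-- Instantaneous positivity of the backward Kolmogorov equation for the terminal datum `g`:
if `g` is not identically zero, the solution is positive everywhere at all times before `T`. -/
def InstantaneousPositivity (L : Kernel Γ Γ) (T : ℝ) (g : Γ → ℝ) : Prop :=
  (∃ x, g x ≠ 0) → ∀ h : ℝ → Γ → ℝ, IsBKESolution L T g h → ∀ t ∈ Ico 0 T, ∀ x, 0 < h t x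

/-- The terminal datum `exp (-f)`, with `exp (-∞) = 0`. -/
def expNeg (f : Γ → ℝ≥0∞) (x : Γ) : ℝ := (EReal.exp (-(f x : EReal))).toReal

/-- The local Hamiltonian `H(x, ξ) = ∫ (exp (ξ(x, y)) - 1) L(x, dy)`. -/
def hamiltonian (L : Kernel Γ Γ) (x : Γ) (ξ : Γ × Γ → ℝ) : ℝ :=
  ∫ y, (Real.exp (ξ (x, y)) - 1) ∂(L x)

/-- Classical solution `ψ : [0, T) × Γ → ℝ` of the Hamilton-Jacobi equation
`∂ₜ ψ_t(x) + H(x, ∇ψ_t) = 0` on `(0, T) × Γ`, with `ψ_t → -f` pointwise (in the extended reals)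
as `t ↑ T`. The integral that defines the Hamiltonian is required to converge; no bound on `ψ`
is imposed. -/
structure IsHJESolution (L : Kernel Γ Γ) (T : ℝ) (f : Γ → ℝ≥0∞) (ψ : ℝ → Γ → ℝ) : Prop where
  measurable : ∀ t ∈ Ico 0 T, Measurable (ψ t)
  continuousOn : ∀ x, ContinuousOn (fun t => ψ t x) (Ico 0 T)
  contDiffOn : ∀ x, ContDiffOn ℝ 1 (fun t => ψ t x) (Ioo 0 T)
  integrable : ∀ t ∈ Ioo 0 T, ∀ x, Integrable (fun y => Real.exp (dgrad (ψ t) (x, y))) (L x)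
  equation : ∀ t ∈ Ioo 0 T, ∀ x,
    HasDerivAt (fun s => ψ s x) (-hamiltonian L x (dgrad (ψ t))) t
  terminal : ∀ x, Tendsto (fun t => (ψ t x : EReal)) (𝓝[<] T) (𝓝 (-(f x : EReal)))

variable (Γ) in
/-- A curve `p` of probability measures on `Γ` and a measurable family `q` of finite measures on
`Γ × Γ`. Only the values `p t` for `t ∈ [0, T]` and `q t` for almost every `t ∈ (0, T)` matter. -/
structure DensityFlux where
  p : ℝ → ProbabilityMeasure Γ
  q : Kernel ℝ (Γ × Γ)
  finite_q : ∀ t, IsFiniteMeasure (q t)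

/-- The action `∫₀ᵀ Ent(q_t | p_t ⊗ L) dt`. For finite measures `α`, `β`,
`InformationTheory.klDiv α β` is `∫ (s log s - s + 1) dβ` with `s = dα/dβ` if `α ≪ β`, and `∞`
otherwise; `p_t ⊗ L` is the measure `L(x, dy) p_t(dx)`. -/
def action (L : Kernel Γ Γ) (T : ℝ) (P : DensityFlux Γ) : ℝ≥0∞ :=
  ∫⁻ t in Ioo 0 T, InformationTheory.klDiv (P.q t) ((P.p t : Measure Γ) ⊗ₘ L)

/-- The admissible density-flux pairs with initial density `μ`: `p` is setwise continuous on
`[0, T]`, `q` is integrable, the continuity equation holds, the action is finite, `p₀ = μ`. -/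
structure IsAdmissible (L : Kernel Γ Γ) (T : ℝ) (μ : Measure Γ) (P : DensityFlux Γ) : Prop where
  setwise_continuous : ∀ A : Set Γ, MeasurableSet A →
    ContinuousOn (fun t => (P.p t : Measure Γ).real A) (Icc 0 T)
  flux_integrable : ∫⁻ t in Ioo 0 T, P.q t univ < ⊤
  continuity_equation : ∀ s t : ℝ, 0 ≤ s → s ≤ t → t ≤ T → ∀ φ : Γ → ℝ, IsBddMeas φ →
    ∫ x, φ x ∂(P.p t : Measure Γ) - ∫ x, φ x ∂(P.p s : Measure Γ)
      = ∫ r in s..t, ∫ z, dgrad φ z ∂(P.q r)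
  finite_action : action L T P < ⊤
  initial : (P.p 0 : Measure Γ) = μ

/-- The cost of a density-flux pair: terminal cost plus action. -/
def cost (L : Kernel Γ Γ) (T : ℝ) (f : Γ → ℝ≥0∞) (P : DensityFlux Γ) : ℝ≥0∞ :=
  ∫⁻ x, f x ∂(P.p T : Measure Γ) + action L T P

/-- The value of the deterministic optimal control problem. -/
def gammaDet (L : Kernel Γ Γ) (T : ℝ) (f : Γ → ℝ≥0∞) (μ : Measure Γ) : ℝ≥0∞ :=
  ⨅ (P : DensityFlux Γ) (_ : IsAdmissible L T μ P), cost L T f P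

/-- An optimal pair: an admissible pair that attains the value. -/
def IsOptimal (L : Kernel Γ Γ) (T : ℝ) (f : Γ → ℝ≥0∞) (μ : Measure Γ) (P : DensityFlux Γ) :
    Prop :=
  IsAdmissible L T μ P ∧ cost L T f P = gammaDet L T f μ

/-- The flux `exp (∇ψ) p ⊗ L`, for a function `ψ` on `Γ`. -/
def expFlux (L : Kernel Γ Γ) (ψ : Γ → ℝ) (p : Measure Γ) : Measure (Γ × Γ) :=
  (p ⊗ₘ L).withDensity (fun z => ENNReal.ofReal (Real.exp (dgrad ψ z)))

/-- The curve `p` is `C¹` on `[0, T)` with respect to setwise convergence, and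
`∂ₜ p_t + div q_t = 0` for every `t ∈ [0, T)` with `q_t = exp (∇ψ_t) p_t ⊗ L`: for every bounded
Borel `φ`, `t ↦ ∫ φ dp_t` has the continuous derivative `t ↦ ∫ ∇φ dq_t` (one-sided at `0`). -/
structure SolvesControlledEquation (L : Kernel Γ Γ) (T : ℝ) (ψ : ℝ → Γ → ℝ)
    (p : ℝ → ProbabilityMeasure Γ) : Prop where
  finite_flux : ∀ t ∈ Ico 0 T, IsFiniteMeasure (expFlux L (ψ t) (p t : Measure Γ))
  hasDeriv : ∀ φ : Γ → ℝ, IsBddMeas φ → ∀ t ∈ Ico 0 T,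
    HasDerivWithinAt (fun s => ∫ x, φ x ∂(p s : Measure Γ))
      (∫ z, dgrad φ z ∂(expFlux L (ψ t) (p t : Measure Γ))) (Ico 0 T) t
  continuous_deriv : ∀ φ : Γ → ℝ, IsBddMeas φ →
    ContinuousOn (fun t => ∫ z, dgrad φ z ∂(expFlux L (ψ t) (p t : Measure Γ))) (Ico 0 T)

end JumpControl

end

/-! ### The Banach space of bounded measurable functions. -/

noncomputable section

namespace JumpControl

variable {Γ : Type*} [MeasurableSpace Γ]

/-! Let G be the generator u ↦ ∫ (u(y) - u(x)) L(x, dy), a bounded operator in the supremum norm,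
and R a bound for the jump rates. Then h_t = exp((T - t)G) e^{-f} solves the backward equation, 0 ≤
h ≤ 1, and h > 0 before T by hypothesis. Since exp(∇log h) - 1 is ∇h divided by h(x), ψ = log h
solves the Hamilton-Jacobi equation. Uniqueness needs no growth condition on ψ: in reversed time,
e^{Rs} exp ψ is a nonnegative solution of ∂U = AU with A = G + R positive. Positivity alone bounds
the iterates Aⁿ U by U at later times, and this forces two solutions with the same initial value to
coincide (`IsPosSolution.unique`).

Lower bound. Along an admissible pair, test with log((h + ε)/(1 + ε)), a C¹ curve in the supremum
norm. As h + ε again solves the backward equation, the product rule `integral_sub_integral` produces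
exactly the dual functional of the relative entropy at ∇log(h + ε). Young's inequality bounds it by
the action, and ε → 0 gives -∫ ψ₀ dμ ≤ cost.

Upper bound. The minimizer is the Doob transform: p_t is h_t times the law at time t of the jump
process started from μ/h₀, and q_t = exp(∇ψ_t) p_t ⊗ L. Its flux has finite mass, uniformly in time,
by the entropy inequality `exists_posOp_semi_le`: weighting by a factor in [0, 1] with mean h raises
the mean number of jumps to at most -log h plus a constant, which is integrable when ψ₀ ∈ L¹(μ). The
entropy balance for a regularized u log u, whose production is a Bregman divergence, yields cost ≤
-∫ ψ₀ dμ by Fatou (`cost_pair_le`).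

Uniqueness. A pair whose cost reaches the bound makes Young's inequality asymptotically tight. The
defect is explicit and vanishes only for the flux exp(∇ψ) p ⊗ L (`ae_eq_expFlux`). With this flux, ∫
(u_t/h_t) dp_t is constant in t for every backward solution u dominated by a multiple of h; choosing
u with u_s = h_s φ determines ∫ φ dp_s (`integral_eq_condLaw`). -/

variable (Γ) in
/-- The space of bounded measurable functions, as a subspace of all functions. -/
def bddSubmodule : Submodule ℝ (Γ → ℝ) where
  carrier := {φ | IsBddMeas φ}
  add_mem' {φ χ} hf hg := by
    obtain ⟨hm, M, hM⟩ := hf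
    obtain ⟨hm', M', hM'⟩ := hg
    exact ⟨hm.add hm', M + M', fun x => (abs_add_le _ _).trans (add_le_add (hM x) (hM' x))⟩
  zero_mem' := ⟨measurable_const, 0, fun _ => abs_zero.le⟩
  smul_mem' a φ hf := by
    obtain ⟨hm, M, hM⟩ := hf
    refine ⟨hm.const_smul a, |a| * M, fun x => ?_⟩
    rw [Pi.smul_apply, smul_eq_mul, abs_mul]
    exact mul_le_mul_of_nonneg_left (hM x) (abs_nonneg a)

variable (Γ) in
/-- The Banach space of bounded measurable functions with the supremum norm. -/
def Bdd : Type _ := bddSubmodule Γ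

namespace Bdd

instance : FunLike (Bdd Γ) Γ ℝ := ⟨fun u => u.1, Subtype.val_injective⟩

lemma isBddMeas (u : Bdd Γ) : IsBddMeas (u : Γ → ℝ) := u.2

lemma measurable (u : Bdd Γ) : Measurable (u : Γ → ℝ) := u.2.1

@[ext] lemma ext {u v : Bdd Γ} (h : ∀ x, u x = v x) : u = v := DFunLike.ext _ _ h

/-- The element of `Bdd Γ` given by a bounded measurable function. -/
def of (φ : Γ → ℝ) (h : IsBddMeas φ) : Bdd Γ := ⟨φ, h⟩

@[simp] lemma of_apply (φ : Γ → ℝ) (h : IsBddMeas φ) (x : Γ) : of φ h x = φ x := rfl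

instance : Norm (Bdd Γ) := ⟨fun u => ⨆ x, |u x|⟩

lemma abs_apply_le (u : Bdd Γ) (x : Γ) : |u x| ≤ ‖u‖ := by
  obtain ⟨M, hM⟩ := u.isBddMeas.2
  exact le_ciSup (f := fun x => |u x|) ⟨M, by rintro _ ⟨y, rfl⟩; exact hM y⟩ x

lemma norm_le {u : Bdd Γ} {C : ℝ} (hC : 0 ≤ C) (h : ∀ x, |u x| ≤ C) : ‖u‖ ≤ C :=
  Real.iSup_le h hC

lemma norm_nonneg' (u : Bdd Γ) : 0 ≤ ‖u‖ := Real.iSup_nonneg fun _ => abs_nonneg _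

/-- The pointwise group structure. It is used only to build the normed group structure. -/
@[reducible] def addCommGroup : AddCommGroup (Bdd Γ) := inferInstanceAs (AddCommGroup (bddSubmodule Γ))

instance : NormedAddCommGroup (Bdd Γ) :=
  letI : AddCommGroup (Bdd Γ) := addCommGroup
  AddGroupNorm.toNormedAddCommGroup
    { toFun := fun u => ‖u‖
      map_zero' := le_antisymm (norm_le le_rfl fun _ => abs_zero.le) (norm_nonneg' _)
      add_le' := fun u v => norm_le (add_nonneg (norm_nonneg' u) (norm_nonneg' v)) fun x =>
        (abs_add_le (u x) (v x)).trans (add_le_add (abs_apply_le u x) (abs_apply_le v x))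
      neg' := fun u => by
        change (⨆ x, |-(u x)|) = ⨆ x, |u x|
        simp
      eq_zero_of_map_eq_zero' := fun u hu => by
        ext x
        have h := abs_apply_le u x
        rw [show ‖u‖ = 0 from hu] at h
        exact abs_nonpos_iff.1 h }

instance : NormedSpace ℝ (Bdd Γ) :=
  { (inferInstanceAs (Module ℝ (bddSubmodule Γ)) : Module ℝ (Bdd Γ)) with
    norm_smul_le := fun a u => norm_le (mul_nonneg (norm_nonneg a) (norm_nonneg' u)) fun x => by
      change |a * u x| ≤ _
      rw [abs_mul]
      exact mul_le_mul_of_nonneg_left (abs_apply_le u x) (abs_nonneg _) }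

instance : One (Bdd Γ) := ⟨of (fun _ => 1) ⟨measurable_const, 1, fun _ => abs_one.le⟩⟩

instance : Mul (Bdd Γ) := ⟨fun u v => of (fun x => u x * v x) (by
  refine ⟨u.measurable.mul v.measurable, ‖u‖ * ‖v‖, fun x => ?_⟩
  rw [abs_mul]
  exact mul_le_mul (u.abs_apply_le x) (v.abs_apply_le x) (abs_nonneg _) (norm_nonneg _))⟩

@[simp] lemma add_apply (u v : Bdd Γ) (x : Γ) : (u + v) x = u x + v x := rfl
@[simp] lemma sub_apply (u v : Bdd Γ) (x : Γ) : (u - v) x = u x - v x := rfl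
@[simp] lemma neg_apply (u : Bdd Γ) (x : Γ) : (-u) x = -u x := rfl
@[simp] lemma mul_apply (u v : Bdd Γ) (x : Γ) : (u * v) x = u x * v x := rfl
@[simp] lemma smul_apply (a : ℝ) (u : Bdd Γ) (x : Γ) : (a • u) x = a * u x := rfl
@[simp] lemma zero_apply (x : Γ) : (0 : Bdd Γ) x = 0 := rfl
@[simp] lemma one_apply (x : Γ) : (1 : Bdd Γ) x = 1 := rfl

/-- Evaluation at a point. -/
def eval (x : Γ) : Bdd Γ →L[ℝ] ℝ :=
  LinearMap.mkContinuous
    { toFun := fun u : Bdd Γ => u x, map_add' := fun _ _ => rfl, map_smul' := fun _ _ => rfl } 1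
    (fun u => by rw [one_mul]; exact u.abs_apply_le x)

@[simp] lemma eval_apply (x : Γ) (u : Bdd Γ) : eval x u = u x := rfl

instance : CompleteSpace (Bdd Γ) := by
  refine Metric.complete_of_cauchySeq_tendsto fun u hu => ?_
  have hx : ∀ x, CauchySeq fun n => u n x := fun x => hu.map (eval x).uniformContinuous
  choose v hv using fun x => cauchySeq_tendsto_of_complete (hx x)
  have hm : Measurable v :=
    measurable_of_tendsto_metrizable (fun n => (u n).measurable) (tendsto_pi_nhds.2 hv)
  obtain ⟨M, hM⟩ := hu.norm_bddAbove
  have hb : IsBddMeas v := ⟨hm, M, fun x => le_of_tendsto (hv x).abs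
    (Eventually.of_forall fun n => ((u n).abs_apply_le x).trans (hM ⟨n, rfl⟩))⟩
  refine ⟨of v hb, Metric.tendsto_atTop.2 fun ε hε => ?_⟩
  obtain ⟨N, hN⟩ := Metric.cauchySeq_iff.1 hu (ε / 2) (half_pos hε)
  refine ⟨N, fun n hn => ?_⟩
  rw [dist_eq_norm]
  refine lt_of_le_of_lt (norm_le (half_pos hε).le fun x => ?_) (half_lt_self hε)
  refine le_of_tendsto ((tendsto_const_nhds.sub (hv x)).abs)
    (eventually_atTop.2 ⟨N, fun m hm => ?_⟩)
  have h := hN n hn m hm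
  rw [dist_eq_norm] at h
  exact ((u n - u m).abs_apply_le x).trans h.le

variable (Γ) in
/-- Pointwise multiplication as a bounded bilinear map. -/
def mulL : Bdd Γ →L[ℝ] Bdd Γ →L[ℝ] Bdd Γ :=
  LinearMap.mkContinuous₂
    (LinearMap.mk₂ ℝ (fun u v : Bdd Γ => u * v)
      (fun u u' v => by ext x; simp; ring) (fun a u v => by ext x; simp; ring)
      (fun u v v' => by ext x; simp; ring) (fun a u v => by ext x; simp; ring)) 1
    (fun u v => by
      refine norm_le (by positivity) fun x => ?_
      rw [one_mul, LinearMap.mk₂_apply, mul_apply, abs_mul]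
      exact mul_le_mul (u.abs_apply_le x) (v.abs_apply_le x) (abs_nonneg _) (norm_nonneg _))

lemma hasDerivAt_mul {u v : ℝ → Bdd Γ} {u' v' : Bdd Γ} {t : ℝ} (hu : HasDerivAt u u' t)
    (hv : HasDerivAt v v' t) : HasDerivAt (fun s => u s * v s) (u' * v t + u t * v') t :=
  ((mulL Γ).hasFDerivAt.comp_hasDerivAt t hu).clm_apply hv

lemma integrable (u : Bdd Γ) (ν : Measure Γ) [IsFiniteMeasure ν] : Integrable (u : Γ → ℝ) ν :=
  Integrable.of_bound u.measurable.aestronglyMeasurable ‖u‖ (ae_of_all _ u.abs_apply_le)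

end Bdd

lemma IsBddMeas.integrable {φ : Γ → ℝ} (h : IsBddMeas φ) (ν : Measure Γ) [IsFiniteMeasure ν] :
    Integrable φ ν :=
  (Bdd.of φ h).integrable ν

lemma IsBddMeas.const (a : ℝ) : IsBddMeas (fun _ : Γ => a) :=
  ⟨measurable_const, |a|, fun _ => le_rfl⟩

lemma IsBddMeas.dgrad {φ : Γ → ℝ} (h : IsBddMeas φ) : IsBddMeas (dgrad φ) := by
  obtain ⟨hm, M, hM⟩ := h
  refine ⟨(hm.comp measurable_snd).sub (hm.comp measurable_fst), M + M, fun z => ?_⟩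
  exact (abs_sub _ _).trans (add_le_add (hM _) (hM _))

lemma IsBddMeas.mul {φ χ : Γ → ℝ} (h : IsBddMeas φ) (h' : IsBddMeas χ) :
    IsBddMeas (fun x => φ x * χ x) :=
  (Bdd.of φ h * Bdd.of χ h').isBddMeas

lemma IsBddMeas.add {φ χ : Γ → ℝ} (h : IsBddMeas φ) (h' : IsBddMeas χ) :
    IsBddMeas (fun x => φ x + χ x) :=
  (Bdd.of φ h + Bdd.of χ h').isBddMeas

lemma IsBddMeas.sub {φ χ : Γ → ℝ} (h : IsBddMeas φ) (h' : IsBddMeas χ) :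
    IsBddMeas (fun x => φ x - χ x) :=
  (Bdd.of φ h - Bdd.of χ h').isBddMeas

lemma IsBddMeas.comp {α : Type*} [MeasurableSpace α] {φ : Γ → ℝ} (h : IsBddMeas φ) {k : α → Γ}
    (hk : Measurable k) : IsBddMeas (fun x => φ (k x)) :=
  ⟨h.1.comp hk, h.2.imp fun _ hM _ => hM _⟩

/-! ### The generator, its positive shift and the semigroup. -/

/-- A bound for the total jump rate of a finite kernel. -/
def rateBound (L : Kernel Γ Γ) : ℝ := L.bound.toReal

lemma rateBound_nonneg (L : Kernel Γ Γ) : 0 ≤ rateBound L := ENNReal.toReal_nonneg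

lemma real_univ_le_rateBound (L : Kernel Γ Γ) [IsFiniteKernel L] (x : Γ) :
    (L x).real univ ≤ rateBound L :=
  ENNReal.toReal_mono (Kernel.bound_ne_top L) (Kernel.measure_le_bound L x univ)

lemma abs_integral_le_rateBound (L : Kernel Γ Γ) [IsFiniteKernel L] (x : Γ) {φ : Γ → ℝ} {M : ℝ}
    (hM : ∀ y, |φ y| ≤ M) : |∫ y, φ y ∂(L x)| ≤ rateBound L * M := by
  have hM0 : 0 ≤ M := (abs_nonneg _).trans (hM x)
  have := norm_integral_le_of_norm_le_const (μ := L x) (f := φ) (C := M) (ae_of_all _ hM)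
  refine this.trans ?_
  rw [mul_comm]
  exact mul_le_mul_of_nonneg_right (real_univ_le_rateBound L x) hM0

variable (L : Kernel Γ Γ) [IsFiniteKernel L]

lemma isBddMeas_integral_kernel {χ : Γ × Γ → ℝ} (hχ : IsBddMeas χ) :
    IsBddMeas (fun x => ∫ y, χ (x, y) ∂(L x)) := by
  refine ⟨(hχ.1.stronglyMeasurable.integral_kernel_prod_right' (κ := L)).measurable, ?_⟩
  obtain ⟨M, hM⟩ := hχ.2
  exact ⟨rateBound L * M, fun x => abs_integral_le_rateBound L x fun y => hM _⟩

/-- The operator `u ↦ ∫ u(y) χ(x, y) L(x, dy)` on bounded measurable functions. -/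
def jumpOp (χ : Γ × Γ → ℝ) (hχ : IsBddMeas χ) : Bdd Γ →L[ℝ] Bdd Γ :=
  LinearMap.mkContinuous
    { toFun := fun u => Bdd.of (fun x => ∫ y, u y * χ (x, y) ∂(L x))
        (isBddMeas_integral_kernel L ((u.isBddMeas.comp measurable_snd).mul hχ))
      map_add' := fun u v => by
        ext x
        simp only [Bdd.of_apply, Bdd.add_apply, add_mul]
        exact integral_add ((u.isBddMeas.mul (hχ.comp measurable_prodMk_left)).integrable _)
          ((v.isBddMeas.mul (hχ.comp measurable_prodMk_left)).integrable _)
      map_smul' := fun a u => by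
        ext x
        simp only [Bdd.of_apply, Bdd.smul_apply, mul_assoc, integral_const_mul, RingHom.id_apply] }
    (rateBound L * |hχ.2.choose|)
    (fun u => by
      refine Bdd.norm_le (mul_nonneg (mul_nonneg (rateBound_nonneg L) (abs_nonneg _))
        (norm_nonneg _)) fun x => ?_
      rw [mul_assoc]
      refine abs_integral_le_rateBound L x fun y => ?_
      rw [abs_mul, mul_comm]
      exact mul_le_mul ((hχ.2.choose_spec _).trans (le_abs_self _)) (u.abs_apply_le y)
        (abs_nonneg _) (abs_nonneg _))

@[simp] lemma jumpOp_apply (χ : Γ × Γ → ℝ) (hχ : IsBddMeas χ) (u : Bdd Γ) (x : Γ) :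
    jumpOp L χ hχ u x = ∫ y, u y * χ (x, y) ∂(L x) := rfl

/-- The integral operator of the kernel. -/
def kerOp : Bdd Γ →L[ℝ] Bdd Γ := jumpOp L (fun _ => 1) (IsBddMeas.const 1)

@[simp] lemma kerOp_apply (u : Bdd Γ) (x : Γ) : kerOp L u x = ∫ y, u y ∂(L x) := by
  simp [kerOp]

/-- The total jump rate. -/
def rate : Bdd Γ := kerOp L 1

@[simp] lemma rate_apply (x : Γ) : rate L x = (L x).real univ := by simp [rate]

/-- The generator `u ↦ ∫ (u(y) - u(x)) L(x, dy)`. -/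
def gen : Bdd Γ →L[ℝ] Bdd Γ := kerOp L - Bdd.mulL Γ (rate L)

lemma gen_apply (u : Bdd Γ) (x : Γ) :
    gen L u x = ∫ y, u y ∂(L x) - (L x).real univ * u x := by
  change kerOp L u x - (rate L * u) x = _
  simp

lemma gen_apply' (u : Bdd Γ) (x : Γ) : gen L u x = ∫ y, dgrad u (x, y) ∂(L x) := by
  simp only [dgrad]
  rw [gen_apply, integral_sub (u.integrable _) (integrable_const _)]
  simp

/-- The nonnegative operator `gen L + rateBound L`. -/
def posOp : Bdd Γ →L[ℝ] Bdd Γ := gen L + rateBound L • ContinuousLinearMap.id ℝ (Bdd Γ)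

lemma posOp_apply (u : Bdd Γ) (x : Γ) :
    posOp L u x = ∫ y, u y ∂(L x) + (rateBound L - (L x).real univ) * u x := by
  change gen L u x + rateBound L * u x = _
  rw [gen_apply]; ring

lemma posOp_nonneg {u : Bdd Γ} (hu : ∀ x, 0 ≤ u x) (x : Γ) : 0 ≤ posOp L u x := by
  rw [posOp_apply]
  exact add_nonneg (integral_nonneg hu)
    (mul_nonneg (sub_nonneg.2 (real_univ_le_rateBound L x)) (hu x))

lemma posOp_pow_nonneg {u : Bdd Γ} (hu : ∀ x, 0 ≤ u x) (n : ℕ) (x : Γ) :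
    0 ≤ (posOp L ^ n) u x := by
  induction n generalizing x with
  | zero => simpa using hu x
  | succ n ih => rw [pow_succ']; exact posOp_nonneg L ih x

lemma posOp_one : posOp L 1 = rateBound L • 1 := by
  ext x; simp [posOp_apply]

lemma posOp_pow_one (n : ℕ) : (posOp L ^ n) 1 = rateBound L ^ n • (1 : Bdd Γ) := by
  induction n with
  | zero => simp
  | succ n ih => rw [pow_succ', mul_apply_eq_comp, ih, map_smul, posOp_one, smul_smul, pow_succ]

lemma gen_one : gen L 1 = 0 := by
  ext x; simp [gen_apply]

/-- The semigroup generated by `gen L`. -/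
def semi (t : ℝ) : Bdd Γ →L[ℝ] Bdd Γ := NormedSpace.exp (t • gen L)

lemma hasDerivAt_semi (t : ℝ) : HasDerivAt (semi L) (semi L t * gen L) t :=
  hasDerivAt_exp_smul_const (𝕂 := ℝ) (gen L) t

lemma hasDerivAt_semi' (t : ℝ) : HasDerivAt (semi L) (gen L * semi L t) t :=
  hasDerivAt_exp_smul_const' (𝕂 := ℝ) (gen L) t

lemma continuous_semi : Continuous (semi L) :=
  continuous_iff_continuousAt.2 fun t => (hasDerivAt_semi L t).continuousAt

@[simp] lemma semi_zero : semi L 0 = 1 := by simp [semi]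

lemma semi_add (s t : ℝ) : semi L (s + t) = semi L s * semi L t := by
  have hc : Commute (s • gen L) (t • gen L) := ((Commute.refl (gen L)).smul_left s).smul_right t
  let := NormedAlgebra.restrictScalars ℚ ℝ (Bdd Γ →L[ℝ] Bdd Γ)
  rw [semi, add_smul, NormedSpace.exp_add_of_commute hc]
  rfl

lemma semi_comm_gen (t : ℝ) : gen L * semi L t = semi L t * gen L :=
  (hasDerivAt_semi' L t).unique (hasDerivAt_semi L t)

lemma semi_comm_posOp (t : ℝ) (u : Bdd Γ) : semi L t (posOp L u) = posOp L (semi L t u) := by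
  have := congrArg (fun B : Bdd Γ →L[ℝ] Bdd Γ => B u) (semi_comm_gen L t)
  simp only [mul_apply_eq_comp] at this
  simp only [posOp, add_apply, map_add, smul_apply,
    map_smul, ContinuousLinearMap.id_apply, this]

/-- Uniformization: the generator is a positive operator minus a multiple of the identity, and the
two commute. This is where positivity of the semigroup becomes visible. -/
lemma semi_eq_exp_posOp (t : ℝ) :
    semi L t = Real.exp (-(rateBound L * t)) • NormedSpace.exp (t • posOp L) := by
  have h1 : t • gen L = t • posOp L + (-(rateBound L * t)) • (1 : Bdd Γ →L[ℝ] Bdd Γ) := by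
    rw [posOp, smul_add, smul_smul]
    change _ = _ + (t * rateBound L) • (1 : Bdd Γ →L[ℝ] Bdd Γ) + _
    module
  have hc : Commute (t • posOp L) ((-(rateBound L * t)) • (1 : Bdd Γ →L[ℝ] Bdd Γ)) :=
    (Commute.one_right _).smul_right _
  let := NormedAlgebra.restrictScalars ℚ ℝ (Bdd Γ →L[ℝ] Bdd Γ)
  rw [semi, h1, NormedSpace.exp_add_of_commute hc, ← Algebra.algebraMap_eq_smul_one,
    ← NormedSpace.algebraMap_exp_comm, ← Real.exp_eq_exp_ℝ, Algebra.algebraMap_eq_smul_one,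
    mul_smul_comm, mul_one]

/-- Expansion by the number of jumps of the uniformized process. Positivity, the construction of
`semiMeasure` and the jump-count estimate all read off this series term by term. -/
lemma hasSum_semi (t : ℝ) (u : Bdd Γ) (x : Γ) :
    HasSum (fun n : ℕ => Real.exp (-(rateBound L * t)) * (t ^ n / n.factorial) *
      (posOp L ^ n) u x) (semi L t u x) := by
  have h := NormedSpace.exp_series_hasSum_exp' (𝕂 := ℝ) (t • posOp L)
  have h2 := (h.mapL (ContinuousLinearMap.apply ℝ (Bdd Γ) u)).mapL (Bdd.eval x)
  have h3 := h2.mul_left (Real.exp (-(rateBound L * t)))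
  have e : semi L t u x =
      Real.exp (-(rateBound L * t)) * NormedSpace.exp (t • posOp L) u x := by
    rw [semi_eq_exp_posOp]; rfl
  rw [e]
  refine HasSum.congr_fun h3 fun n => ?_
  rw [smul_pow, map_smul, map_smul, map_smul, map_smul, ContinuousLinearMap.apply_apply,
    Bdd.eval_apply, smul_eq_mul, smul_eq_mul]
  ring

lemma semi_nonneg {t : ℝ} (ht : 0 ≤ t) {u : Bdd Γ} (hu : ∀ x, 0 ≤ u x) (x : Γ) :
    0 ≤ semi L t u x :=
  (hasSum_semi L t u x).nonneg fun n =>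
    mul_nonneg (by positivity) (posOp_pow_nonneg L hu n x)

lemma semi_mono {t : ℝ} (ht : 0 ≤ t) {u v : Bdd Γ} (h : ∀ x, u x ≤ v x) (x : Γ) :
    semi L t u x ≤ semi L t v x := by
  have := semi_nonneg L ht (u := v - u) (fun x => sub_nonneg.2 (h x)) x
  rw [map_sub] at this
  exact sub_nonneg.1 this

@[simp] lemma semi_one (t : ℝ) : semi L t 1 = 1 := by
  have h : ∀ s, HasDerivAt (fun s => semi L s 1) 0 s := fun s => by
    have := (hasDerivAt_semi L s).clm_apply (hasDerivAt_const s (1 : Bdd Γ))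
    simpa [gen_one] using this
  have := is_const_of_deriv_eq_zero (fun s => (h s).differentiableAt) (fun s => (h s).deriv) t 0
  simpa using this

end JumpControl
end

/-! ### Uniqueness of nonnegative solutions without growth conditions. -/

noncomputable section

namespace JumpControl

variable {Γ : Type*} [MeasurableSpace Γ]

lemma le_of_hasDerivAt_nonneg {F F' : ℝ → ℝ} {a b : ℝ} (hab : a ≤ b)
    (hc : ContinuousOn F (Icc a b)) (hd : ∀ s ∈ Ioo a b, HasDerivAt F (F' s) s)
    (h : ∀ s ∈ Ioo a b, 0 ≤ F' s) : F a ≤ F b := by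
  refine monotoneOn_of_deriv_nonneg (convex_Icc a b) hc ?_ ?_ (left_mem_Icc.2 hab)
    (right_mem_Icc.2 hab) hab
  · rw [interior_Icc]
    exact fun s hs => (hd s hs).differentiableAt.differentiableWithinAt
  · rw [interior_Icc]
    exact fun s hs => by rw [(hd s hs).deriv]; exact h s hs

lemma hasDerivAt_pow_succ_div_factorial (n : ℕ) (s : ℝ) :
    HasDerivAt (fun s : ℝ => s ^ (n + 1) / (n + 1).factorial) (s ^ n / n.factorial) s := by
  have e2 := (hasDerivAt_pow (n + 1) s).div_const ((n + 1).factorial : ℝ)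
  have h1 : (n.factorial : ℝ) ≠ 0 := by positivity
  have h2 : (n + 1 : ℝ) ≠ 0 := by positivity
  have e : s ^ n / n.factorial = ((n + 1 : ℕ) : ℝ) * s ^ (n + 1 - 1) / (n + 1).factorial := by
    rw [Nat.factorial_succ, Nat.add_sub_cancel]
    push_cast
    field_simp
  rw [e]
  exact e2

section Unbounded

set_option linter.unusedSectionVars false

variable (L : Kernel Γ Γ)

/-- The operator `gen L + rateBound L` on functions that may be unbounded. -/
def posFun (u : Γ → ℝ) (x : Γ) : ℝ :=
  ∫ y, u y ∂(L x) + (rateBound L - (L x).real univ) * u x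

/-- Nonnegative, possibly unbounded solutions on `[0, S)` of `∂ₛ U = (gen L + rateBound L) U`. -/
structure IsPosSolution (S : ℝ) (U : ℝ → Γ → ℝ) : Prop where
  nonneg : ∀ s ∈ Ico 0 S, ∀ x, 0 ≤ U s x
  measurable : ∀ s ∈ Ioo 0 S, Measurable (U s)
  integrable : ∀ s ∈ Ioo 0 S, ∀ x, Integrable (U s) (L x)
  continuousOn : ∀ x, ContinuousOn (fun s => U s x) (Ico 0 S)
  equation : ∀ s ∈ Ioo 0 S, ∀ x, HasDerivAt (fun r => U r x) (posFun L (U s) x) s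

variable {L} [IsFiniteKernel L]

lemma posFun_mono {u v : Γ → ℝ} {x : Γ} (hu : Integrable u (L x)) (hv : Integrable v (L x))
    (h : ∀ y, u y ≤ v y) : posFun L u x ≤ posFun L v x :=
  add_le_add (integral_mono hu hv h)
    (mul_le_mul_of_nonneg_left (h x) (sub_nonneg.2 (real_univ_le_rateBound L x)))

lemma posFun_nonneg {u : Γ → ℝ} (h : ∀ y, 0 ≤ u y) (x : Γ) : 0 ≤ posFun L u x :=
  add_nonneg (integral_nonneg h)
    (mul_nonneg (sub_nonneg.2 (real_univ_le_rateBound L x)) (h x))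

lemma posFun_const_mul (a : ℝ) (u : Γ → ℝ) (x : Γ) :
    posFun L (fun y => a * u y) x = a * posFun L u x := by
  simp only [posFun, integral_const_mul]; ring

lemma posFun_add {u v : Γ → ℝ} {x : Γ} (hu : Integrable u (L x)) (hv : Integrable v (L x)) :
    posFun L (fun y => u y + v y) x = posFun L u x + posFun L v x := by
  simp only [posFun, integral_add hu hv]; ring

lemma posFun_sub {u v : Γ → ℝ} {x : Γ} (hu : Integrable u (L x)) (hv : Integrable v (L x)) :
    posFun L (fun y => u y - v y) x = posFun L u x - posFun L v x := by
  simp only [posFun, integral_sub hu hv]; ring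

lemma measurable_posFun {u : Γ → ℝ} (hu : Measurable u) : Measurable (posFun L u) := by
  have h1 : Measurable fun x => ∫ y, u y ∂(L x) :=
    ((hu.comp measurable_snd).stronglyMeasurable.integral_kernel_prod_right' (κ := L)).measurable
  have h2 : Measurable fun x => (L x).real univ := (L.measurable_coe MeasurableSet.univ).ennreal_toReal
  exact h1.add ((measurable_const.sub h2).mul hu)

namespace IsPosSolution

variable {S : ℝ} {U V : ℝ → Γ → ℝ}

lemma add (hU : IsPosSolution L S U) (hV : IsPosSolution L S V) :
    IsPosSolution L S (fun s x => U s x + V s x) where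
  nonneg s hs x := add_nonneg (hU.nonneg s hs x) (hV.nonneg s hs x)
  measurable s hs := (hU.measurable s hs).add (hV.measurable s hs)
  integrable s hs x := (hU.integrable s hs x).add (hV.integrable s hs x)
  continuousOn x := (hU.continuousOn x).add (hV.continuousOn x)
  equation s hs x := by
    rw [posFun_add (hU.integrable s hs x) (hV.integrable s hs x)]
    exact (hU.equation s hs x).add (hV.equation s hs x)

lemma shift (hU : IsPosSolution L S U) {a : ℝ} (ha : 0 ≤ a) :
    IsPosSolution L (S - a) (fun s x => U (a + s) x) where
  nonneg s hs x := hU.nonneg _ ⟨by linarith [hs.1], by linarith [hs.2]⟩ x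
  measurable s hs := hU.measurable _ ⟨by linarith [hs.1], by linarith [hs.2]⟩
  integrable s hs x := hU.integrable _ ⟨by linarith [hs.1], by linarith [hs.2]⟩ x
  continuousOn x := (hU.continuousOn x).comp (by fun_prop)
    fun s hs => ⟨by linarith [hs.1], by linarith [hs.2]⟩
  equation s hs x := by
    have h := hU.equation (a + s) ⟨by linarith [hs.1], by linarith [hs.2]⟩ x
    exact h.comp_const_add a s

lemma continuousOn_Icc (hU : IsPosSolution L S U) (x : Γ) {a b : ℝ} (ha : 0 ≤ a) (hb : b < S) :
    ContinuousOn (fun s => U s x) (Icc a b) :=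
  (hU.continuousOn x).mono fun _ hs => ⟨ha.trans hs.1, hs.2.trans_lt hb⟩

lemma mono (hU : IsPosSolution L S U) {s t : ℝ} (hs : 0 ≤ s) (hst : s ≤ t) (ht : t < S) (x : Γ) :
    U s x ≤ U t x :=
  le_of_hasDerivAt_nonneg hst (hU.continuousOn_Icc x hs ht)
    (fun r hr => hU.equation r ⟨hs.trans_lt hr.1, hr.2.trans ht⟩ x)
    (fun r hr => posFun_nonneg (hU.nonneg r ⟨hs.trans hr.1.le, hr.2.trans ht⟩) x)

/-- The iterates of the operator on a solution are controlled by the solution at later times. -/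
lemma iterate_posFun_le (hU : IsPosSolution L S U) {τ : ℝ} (hτ : τ ∈ Ioo 0 S) (n : ℕ) :
    Measurable ((posFun L)^[n] (U τ)) ∧ (∀ x, 0 ≤ (posFun L)^[n] (U τ) x) ∧
      ∀ δ, 0 ≤ δ → τ + δ < S → ∀ x,
        δ ^ n / n.factorial * (posFun L)^[n] (U τ) x ≤ U (τ + δ) x := by
  induction n with
  | zero =>
    refine ⟨hU.measurable τ hτ, hU.nonneg τ ⟨hτ.1.le, hτ.2⟩, fun δ h0 h1 x => ?_⟩
    simpa using hU.mono hτ.1.le (le_add_of_nonneg_right h0) h1 x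
  | succ n ih =>
    obtain ⟨hm, hn, hle⟩ := ih
    simp only [Function.iterate_succ_apply']
    refine ⟨measurable_posFun hm, posFun_nonneg hn, fun δ h0 h1 x => ?_⟩
    set K := (posFun L)^[n] (U τ) with hK
    have hd : ∀ s ∈ Ioo 0 δ, HasDerivAt
        (fun s => U (τ + s) x - s ^ (n + 1) / (n + 1).factorial * posFun L K x)
        (posFun L (U (τ + s)) x - s ^ n / n.factorial * posFun L K x) s := by
      intro s hs
      have e1 := (hU.equation (τ + s) ⟨by linarith [hτ.1, hs.1], by linarith [hs.2]⟩ x).comp_const_add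
        τ s
      refine e1.sub (HasDerivAt.mul_const ?_ _)
      exact hasDerivAt_pow_succ_div_factorial n s
    have hc : ContinuousOn
        (fun s => U (τ + s) x - s ^ (n + 1) / (n + 1).factorial * posFun L K x) (Icc 0 δ) := by
      refine ContinuousOn.sub ?_ (by fun_prop)
      exact (hU.continuousOn x).comp (by fun_prop)
        fun s hs => ⟨by linarith [hτ.1, hs.1], by linarith [hs.2]⟩
    -- The derivative of the difference is the positive operator applied to `U (τ + s) - sⁿ/n! K`,
    -- which is nonnegative by the induction hypothesis at time s.
    have key := le_of_hasDerivAt_nonneg h0 hc hd fun s hs => by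
      have hsS : τ + s ∈ Ioo 0 S := ⟨by linarith [hτ.1, hs.1], by linarith [hs.2]⟩
      have hb : ∀ y, s ^ n / n.factorial * K y ≤ U (τ + s) y := hle s hs.1.le hsS.2
      have hi : Integrable (fun y => s ^ n / n.factorial * K y) (L x) := by
        refine (hU.integrable _ hsS x).mono' (hm.const_mul _).aestronglyMeasurable
          (ae_of_all _ fun y => ?_)
        rw [Real.norm_of_nonneg (mul_nonneg (by have := hs.1; positivity) (hn y))]
        exact hb y
      rw [← posFun_const_mul]
      exact sub_nonneg.2 (posFun_mono hi (hU.integrable _ hsS x) hb)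
    have h00 : 0 ≤ U τ x := hU.nonneg τ ⟨hτ.1.le, hτ.2⟩ x
    simp only [add_zero, zero_pow (Nat.succ_ne_zero n), zero_div, zero_mul, sub_zero] at key
    linarith

/-- Iterates could fail to be integrable for unbounded functions; here they are dominated by a
multiple of the solution at a slightly later time, which is why room before `S` is kept. -/
lemma integrable_iterate (hU : IsPosSolution L S U) {τ : ℝ} (hτ : τ ∈ Ioo 0 S) (n : ℕ) (x : Γ) :
    Integrable ((posFun L)^[n] (U τ)) (L x) := by
  obtain ⟨hm, hn, hle⟩ := hU.iterate_posFun_le hτ n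
  obtain ⟨δ, h0, h1⟩ : ∃ δ, 0 < δ ∧ τ + δ < S :=
    ⟨(S - τ) / 2, by linarith [hτ.2], by linarith [hτ.2]⟩
  have hp : 0 < δ ^ n / n.factorial := by positivity
  refine ((hU.integrable (τ + δ) ⟨by linarith [hτ.1], h1⟩ x).const_mul
    (δ ^ n / n.factorial)⁻¹).mono' hm.aestronglyMeasurable (ae_of_all _ fun y => ?_)
  rw [Real.norm_of_nonneg (hn y), inv_mul_eq_div, le_div_iff₀ hp, mul_comm]
  exact hle δ h0.le h1 y

/-- Picard iteration started from |U - V| ≤ U + V, the latter being nondecreasing in time. Each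
integration from the common initial value applies the positive operator once and raises the power of
s. -/
lemma abs_sub_le (hU : IsPosSolution L S U) (hV : IsPosSolution L S V)
    (h0 : ∀ x, U 0 x = V 0 x) {τ : ℝ} (hτ : τ ∈ Ioo 0 S) (n : ℕ) :
    ∀ s ∈ Icc 0 τ, ∀ x, |U s x - V s x| ≤
      s ^ n / n.factorial * (posFun L)^[n] (fun y => U τ y + V τ y) x := by
  have hW := hU.add hV
  induction n with
  | zero =>
    intro s hs x
    have h := hW.mono hs.1 hs.2 hτ.2 x
    have hu := hU.nonneg s ⟨hs.1, hs.2.trans_lt hτ.2⟩ x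
    have hv := hV.nonneg s ⟨hs.1, hs.2.trans_lt hτ.2⟩ x
    simp only [pow_zero, Nat.factorial_zero, Nat.cast_one, div_one, one_mul,
      Function.iterate_zero, id_eq]
    exact abs_sub_le_iff.2 ⟨by linarith, by linarith⟩
  | succ n ih =>
    intro t ht x
    simp only [Function.iterate_succ_apply']
    set K := (posFun L)^[n] (fun y => U τ y + V τ y) with hK
    have hKi : Integrable K (L x) := hW.integrable_iterate hτ n x
    have hB : ∀ s, HasDerivAt (fun s : ℝ => s ^ (n + 1) / (n + 1).factorial * posFun L K x)
        (posFun L (fun y => s ^ n / n.factorial * K y) x) s := by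
      intro s
      rw [posFun_const_mul]
      refine HasDerivAt.mul_const ?_ _
      exact hasDerivAt_pow_succ_div_factorial n s
    have hsub : ∀ {A B : ℝ → Γ → ℝ}, IsPosSolution L S A → IsPosSolution L S B →
        (∀ x, A 0 x = B 0 x) → (∀ s ∈ Icc 0 τ, ∀ y, A s y - B s y ≤ s ^ n / n.factorial * K y) →
        A t x - B t x ≤ t ^ (n + 1) / (n + 1).factorial * posFun L K x := by
      intro A B hA hB' hAB hle
      have htS : t < S := ht.2.trans_lt hτ.2
      have key := le_of_hasDerivAt_nonneg ht.1
        (F := fun s => s ^ (n + 1) / (n + 1).factorial * posFun L K x - (A s x - B s x))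
        (F' := fun s => posFun L (fun y => s ^ n / n.factorial * K y) x -
          (posFun L (A s) x - posFun L (B s) x)) ?_ ?_ ?_
      · simp only [zero_pow (Nat.succ_ne_zero n), zero_div, zero_mul, hAB, sub_self] at key
        linarith
      · exact ContinuousOn.sub (by fun_prop)
          ((hA.continuousOn_Icc x le_rfl htS).sub (hB'.continuousOn_Icc x le_rfl htS))
      · intro s hs
        have hs' : s ∈ Ioo 0 S := ⟨hs.1, hs.2.trans htS⟩
        exact (hB s).sub ((hA.equation s hs' x).sub (hB'.equation s hs' x))
      · intro s hs
        have hs' : s ∈ Ioo 0 S := ⟨hs.1, hs.2.trans htS⟩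
        rw [← posFun_sub (hA.integrable s hs' x) (hB'.integrable s hs' x)]
        exact sub_nonneg.2 (posFun_mono ((hA.integrable s hs' x).sub (hB'.integrable s hs' x))
          (hKi.const_mul _) (hle s ⟨hs.1.le, hs.2.le.trans ht.2⟩))
    rw [abs_sub_le_iff]
    exact ⟨hsub hU hV h0 fun s hs y => (le_abs_self _).trans (ih s hs y),
      hsub hV hU (fun x => (h0 x).symm) fun s hs y => by
        have := (neg_le_abs _).trans (ih s hs y)
        linarith⟩

/-- The Picard bound τⁿ/n! Aⁿ(U + V)(τ) is compared with (S/2)ⁿ/n! Aⁿ(U + V)(τ), which is at most (U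
+ V)(τ + S/2). For τ ≤ S/3 the ratio is (2τ/S)ⁿ ≤ (2/3)ⁿ, and τ + S/2 still lies before S. -/
lemma eq_of_le_third (hU : IsPosSolution L S U) (hV : IsPosSolution L S V)
    (h0 : ∀ x, U 0 x = V 0 x) {τ : ℝ} (h : 0 ≤ τ) (hS : τ ≤ S / 3) (x : Γ) :
    U τ x = V τ x := by
  rcases h.eq_or_lt with rfl | hpos
  · exact h0 x
  have hτ : τ ∈ Ioo 0 S := ⟨hpos, by linarith⟩
  have hW := hU.add hV
  have hδ : τ + S / 2 < S := by linarith
  have hb : ∀ n : ℕ, |U τ x - V τ x| ≤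
      (2 / 3 : ℝ) ^ n * (U (τ + S / 2) x + V (τ + S / 2) x) := by
    intro n
    have h1 := hU.abs_sub_le hV h0 hτ n τ ⟨h, le_rfl⟩ x
    obtain ⟨-, hn, hle⟩ := hW.iterate_posFun_le hτ n
    have h2 := hle (S / 2) (by linarith) hδ x
    refine h1.trans ?_
    refine le_trans ?_ (mul_le_mul_of_nonneg_left h2 (by positivity))
    rw [← mul_assoc]
    refine mul_le_mul_of_nonneg_right ?_ (hn x)
    rw [← mul_div_assoc, ← mul_pow]
    gcongr
    linarith
  have hlim : Tendsto (fun n : ℕ => (2 / 3 : ℝ) ^ n * (U (τ + S / 2) x + V (τ + S / 2) x)) atTop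
      (𝓝 0) := by
    simpa using (tendsto_pow_atTop_nhds_zero_of_lt_one (by norm_num : (0 : ℝ) ≤ 2 / 3)
      (by norm_num)).mul_const (U (τ + S / 2) x + V (τ + S / 2) x)
  have := ge_of_tendsto' hlim hb
  exact sub_eq_zero.1 (abs_nonpos_iff.1 this)

/-- Uniqueness of nonnegative solutions, with no growth condition. -/
lemma unique (hU : IsPosSolution L S U) (hV : IsPosSolution L S V)
    (h0 : ∀ x, U 0 x = V 0 x) {s : ℝ} (hs : s ∈ Ico 0 S) (x : Γ) : U s x = V s x := by
  have hS0 : 0 < S := hs.1.trans_lt hs.2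
  -- Each restart covers a third of the remaining interval, so after n of them a length S(2/3)ⁿ
  -- remains.
  have key : ∀ n : ℕ, ∀ s ∈ Icc 0 (S - S * (2 / 3 : ℝ) ^ n), ∀ x, U s x = V s x := by
    intro n
    induction n with
    | zero =>
      intro s hs x
      have : s = 0 := le_antisymm (by simpa using hs.2) hs.1
      rw [this, h0]
    | succ n ih =>
      intro s hs x
      set a := S - S * (2 / 3 : ℝ) ^ n with ha
      have hq : 0 < (2 / 3 : ℝ) ^ n := by positivity
      have hq1 : (2 / 3 : ℝ) ^ n ≤ 1 := pow_le_one₀ (by norm_num) (by norm_num)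
      have ha0 : 0 ≤ a := by rw [ha]; nlinarith
      rcases le_total s a with h | h
      · exact ih s ⟨hs.1, h⟩ x
      have h2 := hs.2
      rw [pow_succ] at h2
      have := (hU.shift ha0).eq_of_le_third (hV.shift ha0)
        (fun x => by simpa using ih a ⟨ha0, le_rfl⟩ x) (τ := s - a) (by linarith)
        (by rw [ha] at *; linarith) x
      simpa using this
  have hlim : Tendsto (fun n : ℕ => S - S * (2 / 3 : ℝ) ^ n) atTop (𝓝 S) := by
    simpa using tendsto_const_nhds.sub ((tendsto_pow_atTop_nhds_zero_of_lt_one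
      (by norm_num : (0 : ℝ) ≤ 2 / 3) (by norm_num)).const_mul S)
  obtain ⟨n, hn⟩ := (hlim.eventually (lt_mem_nhds hs.2)).exists
  exact key n s ⟨hs.1, hn.le⟩ x

end IsPosSolution

end Unbounded

end JumpControl
end

/-! ### The backward equation and the Hamilton-Jacobi equation. -/

noncomputable section

namespace JumpControl

variable {Γ : Type*} [MeasurableSpace Γ]

section ExpNeg

set_option linter.unusedSectionVars false

variable {f : Γ → ℝ≥0∞}

lemma exp_neg_le_one (f : Γ → ℝ≥0∞) (x : Γ) : EReal.exp (-(f x : EReal)) ≤ 1 := by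
  rw [EReal.exp_le_one_iff, EReal.neg_le_zero]
  exact EReal.coe_ennreal_nonneg _

lemma ofReal_expNeg (f : Γ → ℝ≥0∞) (x : Γ) :
    ENNReal.ofReal (expNeg f x) = EReal.exp (-(f x : EReal)) :=
  ENNReal.ofReal_toReal (ne_top_of_le_ne_top ENNReal.one_ne_top (exp_neg_le_one f x))

lemma expNeg_nonneg (f : Γ → ℝ≥0∞) (x : Γ) : 0 ≤ expNeg f x := ENNReal.toReal_nonneg

lemma expNeg_le_one (f : Γ → ℝ≥0∞) (x : Γ) : expNeg f x ≤ 1 := by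
  simpa [expNeg] using ENNReal.toReal_mono ENNReal.one_ne_top (exp_neg_le_one f x)

lemma isBddMeas_expNeg (hf : Measurable f) : IsBddMeas (expNeg f) :=
  ⟨(EReal.measurable_exp.comp hf.coe_ereal_ennreal.neg).ennreal_toReal, 1, fun x => by
    rw [abs_of_nonneg (expNeg_nonneg f x)]; exact expNeg_le_one f x⟩

lemma expNeg_of_eq_top {x : Γ} (h : f x = ⊤) : expNeg f x = 0 := by simp [expNeg, h]

lemma expNeg_of_ne_top {x : Γ} (h : f x ≠ ⊤) : expNeg f x = Real.exp (-(f x).toReal) := by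
  lift f x to NNReal using h with a ha
  rw [expNeg, ← ha]
  change (EReal.exp (-((a : ℝ) : EReal))).toReal = _
  rw [← EReal.coe_neg, EReal.exp_coe, ENNReal.toReal_ofReal (Real.exp_pos _).le]
  rfl

/-- The exponential is a homeomorphism from the extended reals to [0, ∞], so the terminal condition,
including the value -∞, becomes convergence of real numbers. -/
lemma tendsto_coe_neg_iff {ι : Type*} {l : Filter ι} {a : ι → ℝ} {x : Γ} :
    Tendsto (fun i => (a i : EReal)) l (𝓝 (-(f x : EReal))) ↔
      Tendsto (fun i => Real.exp (a i)) l (𝓝 (expNeg f x)) := by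
  rw [EReal.expHomeomorph.isInducing.tendsto_nhds_iff, EReal.expHomeomorph_apply, ← ofReal_expNeg]
  have e : EReal.expHomeomorph ∘ (fun i => (a i : EReal)) =
      fun i => ENNReal.ofReal (Real.exp (a i)) := rfl
  rw [e]
  refine ⟨fun h => ?_, fun h => ENNReal.tendsto_ofReal h⟩
  have h2 := (ENNReal.tendsto_toReal ENNReal.ofReal_ne_top).comp h
  rw [ENNReal.toReal_ofReal (expNeg_nonneg f x)] at h2
  refine h2.congr fun i => ?_
  simp only [Function.comp_apply]
  exact ENNReal.toReal_ofReal (Real.exp_pos _).le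

end ExpNeg

section Backward

set_option linter.unusedSectionVars false

variable (L : Kernel Γ Γ) [IsFiniteKernel L] (T : ℝ) (g : Bdd Γ)

/-- The solution of the backward Kolmogorov equation with terminal value `g`, frozen after `T`. -/
def bke (t : ℝ) : Bdd Γ := semi L (max (T - t) 0) g

lemma bke_terminal : bke L T g T = g := by simp [bke]

lemma bke_of_le {t : ℝ} (ht : t ≤ T) : bke L T g t = semi L (T - t) g := by
  rw [bke, max_eq_left (sub_nonneg.2 ht)]

lemma continuous_bke : Continuous (bke L T g) :=
  ((continuous_semi L).comp (by fun_prop : Continuous fun t : ℝ => max (T - t) 0)).clm_apply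
    continuous_const

lemma hasDerivAt_bke {t : ℝ} (ht : t < T) : HasDerivAt (bke L T g) (-gen L (bke L T g t)) t := by
  have h1 : HasDerivAt (fun s => semi L (T - s) g) (-gen L (semi L (T - t) g)) t := by
    have h := ((hasDerivAt_semi' L (T - t)).scomp t ((hasDerivAt_id t).const_sub T)).clm_apply
      (hasDerivAt_const t g)
    simpa using h
  rw [bke_of_le L T g ht.le]
  refine h1.congr_of_eventuallyEq ?_
  filter_upwards [gt_mem_nhds ht] with s hs
  exact bke_of_le L T g hs.le

variable {g}

lemma bke_nonneg (hg : ∀ x, 0 ≤ g x) (t : ℝ) (x : Γ) : 0 ≤ bke L T g t x :=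
  semi_nonneg L (le_max_right _ _) hg x

lemma bke_le_one (hg : ∀ x, g x ≤ 1) (t : ℝ) (x : Γ) : bke L T g t x ≤ 1 := by
  have := semi_mono L (le_max_right (T - t) 0) (u := g) (v := 1) hg x
  rw [semi_one, Bdd.one_apply] at this
  exact this

lemma hasDerivAt_eval {u : ℝ → Bdd Γ} {u' : Bdd Γ} {t : ℝ} (h : HasDerivAt u u' t) (x : Γ) :
    HasDerivAt (fun s => u s x) (u' x) t :=
  (Bdd.eval x).hasFDerivAt.comp_hasDerivAt t h

lemma continuous_eval {u : ℝ → Bdd Γ} (h : Continuous u) (x : Γ) : Continuous fun s => u s x :=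
  (Bdd.eval x).continuous.comp h

lemma isBKESolution_bke (hg : ∀ x, 0 ≤ g x) (hg1 : ∀ x, g x ≤ 1) :
    IsBKESolution L T g (fun t => bke L T g t) where
  measurable t _ := (bke L T g t).measurable
  bounded := ⟨1, fun t _ x => by
    rw [abs_of_nonneg (bke_nonneg L T hg t x)]; exact bke_le_one L T hg1 t x⟩
  continuousOn x := (continuous_eval (continuous_bke L T g) x).continuousOn
  equation t ht x := by
    rw [← gen_apply']
    exact hasDerivAt_eval (hasDerivAt_bke L T g ht.2) x
  terminal x := by rw [bke_terminal]

/-- The Hopf-Cole linearization: exp(log u(y) - log u(x)) - 1 = (u(y) - u(x))/u(x). -/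
lemma hamiltonian_dgrad_log {u : Γ → ℝ} (hu : ∀ x, 0 < u x) (x : Γ) :
    hamiltonian L x (dgrad fun y => Real.log (u y)) = (∫ y, dgrad u (x, y) ∂(L x)) / u x := by
  rw [hamiltonian, ← integral_div]
  congr 1
  ext y
  simp only [dgrad]
  rw [Real.exp_sub, Real.exp_log (hu _), Real.exp_log (hu _), sub_div, div_self (hu x).ne']

/-- The logarithm of a positive solution of the backward Kolmogorov equation solves the
Hamilton-Jacobi equation. -/
lemma isHJESolution_log_bke {f : Γ → ℝ≥0∞} (hT : 0 < T) (hgf : ∀ x, g x = expNeg f x)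
    (hpos : ∀ t ∈ Ico 0 T, ∀ x, 0 < bke L T g t x) :
    IsHJESolution L T f (fun t x => Real.log (bke L T g t x)) where
  measurable t _ := Real.measurable_log.comp (bke L T g t).measurable
  continuousOn x := ContinuousOn.log (continuous_eval (continuous_bke L T g) x).continuousOn
    fun t ht => (hpos t ht x).ne'
  contDiffOn x := by
    have hd : ∀ t ∈ Ioo 0 T, HasDerivAt (fun s => Real.log (bke L T g s x))
        ((-gen L (bke L T g t)) x / bke L T g t x) t := fun t ht =>
      (hasDerivAt_eval (hasDerivAt_bke L T g ht.2) x).log (hpos t ⟨ht.1.le, ht.2⟩ x).ne'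
    rw [contDiffOn_one_iff_derivWithin (uniqueDiffOn_Ioo 0 T)]
    refine ⟨fun t ht => (hd t ht).differentiableAt.differentiableWithinAt, ?_⟩
    have hc : ContinuousOn (fun t => (-gen L (bke L T g t)) x / bke L T g t x) (Ioo 0 T) := by
      refine ContinuousOn.div ?_ (continuous_eval (continuous_bke L T g) x).continuousOn
        fun t ht => (hpos t ⟨ht.1.le, ht.2⟩ x).ne'
      exact (continuous_eval ((gen L).continuous.comp (continuous_bke L T g)).neg x).continuousOn
    refine hc.congr fun t ht => ?_
    rw [derivWithin_of_isOpen isOpen_Ioo ht, (hd t ht).deriv]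
  integrable t ht x := by
    have ht' : t ∈ Ico 0 T := ⟨ht.1.le, ht.2⟩
    refine (((bke L T g t).integrable (L x)).div_const (bke L T g t x)).congr (ae_of_all _ fun y => ?_)
    simp only [dgrad]
    rw [Real.exp_sub, Real.exp_log (hpos t ht' _), Real.exp_log (hpos t ht' _)]
  equation t ht x := by
    have ht' : t ∈ Ico 0 T := ⟨ht.1.le, ht.2⟩
    rw [hamiltonian_dgrad_log L (hpos t ht'), ← gen_apply', ← neg_div]
    exact (hasDerivAt_eval (hasDerivAt_bke L T g ht.2) x).log (hpos t ht' x).ne'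
  terminal x := by
    rw [tendsto_coe_neg_iff, ← hgf]
    have h := ((continuous_eval (continuous_bke L T g) x).tendsto T).mono_left
      (nhdsWithin_le_nhds (s := Iio T))
    rw [bke_terminal] at h
    refine h.congr' ?_
    filter_upwards [Ioo_mem_nhdsLT hT] with t ht
    rw [Real.exp_log (hpos t ⟨ht.1.le, ht.2⟩ x)]

/-- The exponential of a solution of the Hamilton-Jacobi equation, in reversed time. -/
def expSolution (f : Γ → ℝ≥0∞) (ψ : ℝ → Γ → ℝ) (s : ℝ) (x : Γ) : ℝ :=
  if s = 0 then expNeg f x else Real.exp (rateBound L * s) * Real.exp (ψ (T - s) x)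

-- Multiplication by e^{Rs} replaces the generator by its positive shift, and the terminal condition
-- becomes continuity at s = 0. Only the convergence of the Hamiltonian integral is used, so
-- unbounded solutions are covered.
variable {L T} in
lemma IsHJESolution.isPosSolution {f : Γ → ℝ≥0∞} {ψ : ℝ → Γ → ℝ} (h : IsHJESolution L T f ψ) :
    IsPosSolution L T (expSolution L T f ψ) where
  nonneg s _ x := by
    rw [expSolution]
    split_ifs
    · exact expNeg_nonneg f x
    · positivity
  measurable s hs := by
    have e : expSolution L T f ψ s =
        fun x => Real.exp (rateBound L * s) * Real.exp (ψ (T - s) x) := by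
      ext x; rw [expSolution, if_neg hs.1.ne']
    rw [e]
    exact (Real.measurable_exp.comp
      (h.measurable (T - s) ⟨by linarith [hs.2], by linarith [hs.1]⟩)).const_mul _
  integrable s hs x := by
    have hi := h.integrable (T - s) ⟨by linarith [hs.2], by linarith [hs.1]⟩ x
    refine (hi.const_mul (Real.exp (rateBound L * s) * Real.exp (ψ (T - s) x))).congr
      (ae_of_all _ fun y => ?_)
    simp only [expSolution, if_neg hs.1.ne', dgrad]
    rw [mul_assoc, ← Real.exp_add, add_sub_cancel]
  continuousOn x := by
    intro s hs
    rcases hs.1.eq_or_lt with rfl | h0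
    · have hT : (0 : ℝ) < T := hs.2
      rw [← Ioo_insert_left hT, continuousWithinAt_insert_self, ContinuousWithinAt, expSolution,
        if_pos rfl]
      have h1 : Tendsto (fun s : ℝ => T - s) (𝓝[Ioo 0 T] 0) (𝓝[<] T) := by
        refine tendsto_nhdsWithin_iff.2 ⟨?_, ?_⟩
        · have : Tendsto (fun s : ℝ => T - s) (𝓝 0) (𝓝 (T - 0)) :=
            (continuous_const.sub continuous_id).tendsto 0
          rw [sub_zero] at this
          exact this.mono_left nhdsWithin_le_nhds
        · filter_upwards [self_mem_nhdsWithin] with s hs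
          exact sub_lt_self T hs.1
      have h2 := (tendsto_coe_neg_iff.1 (h.terminal x)).comp h1
      have h3 : Tendsto (fun s : ℝ => Real.exp (rateBound L * s)) (𝓝[Ioo 0 T] 0) (𝓝 1) := by
        have : Tendsto (fun s : ℝ => Real.exp (rateBound L * s)) (𝓝 0)
            (𝓝 (Real.exp (rateBound L * 0))) := (by fun_prop : Continuous _).tendsto 0
        rw [mul_zero, Real.exp_zero] at this
        exact this.mono_left nhdsWithin_le_nhds
      have h4 := h3.mul h2
      rw [one_mul] at h4
      refine h4.congr' ?_
      filter_upwards [self_mem_nhdsWithin] with s hs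
      simp [expSolution, hs.1.ne']
    · have hs' : T - s ∈ Ioo 0 T := ⟨by linarith [hs.2], by linarith⟩
      have hc : ContinuousAt (fun r => Real.exp (rateBound L * r) * Real.exp (ψ (T - r) x)) s := by
        have h1 := (h.equation (T - s) hs' x).continuousAt
        have h2 : ContinuousAt (fun r => ψ (T - r) x) s :=
          ContinuousAt.comp (f := fun r : ℝ => T - r) (g := fun r => ψ r x) h1
            (by fun_prop)
        fun_prop
      refine ContinuousAt.continuousWithinAt (hc.congr ?_)
      filter_upwards [lt_mem_nhds h0] with r hr
      rw [expSolution, if_neg hr.ne']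
  equation s hs x := by
    have hs' : T - s ∈ Ioo 0 T := ⟨by linarith [hs.2], by linarith [hs.1]⟩
    have h1 : HasDerivAt (fun r => ψ (T - r) x) (hamiltonian L x (dgrad (ψ (T - s)))) s := by
      have := (h.equation (T - s) hs' x).comp_const_sub T s
      rwa [neg_neg] at this
    have h2 : HasDerivAt (fun r => Real.exp (rateBound L * r))
        (Real.exp (rateBound L * s) * rateBound L) s := by
      have := ((hasDerivAt_id s).const_mul (rateBound L)).exp
      rwa [mul_one] at this
    have h4 : HasDerivAt (fun r => expSolution L T f ψ r x)
        (Real.exp (rateBound L * s) * rateBound L * Real.exp (ψ (T - s) x) +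
          Real.exp (rateBound L * s) *
            (Real.exp (ψ (T - s) x) * hamiltonian L x (dgrad (ψ (T - s))))) s := by
      refine (h2.fun_mul h1.exp).congr_of_eventuallyEq ?_
      filter_upwards [lt_mem_nhds hs.1] with r hr
      rw [expSolution, if_neg hr.ne']
    have hi := h.integrable (T - s) hs' x
    have e1 : ∫ y, expSolution L T f ψ s y ∂(L x) =
        Real.exp (rateBound L * s) * Real.exp (ψ (T - s) x) *
          ∫ y, Real.exp (dgrad (ψ (T - s)) (x, y)) ∂(L x) := by
      rw [← integral_const_mul]
      refine integral_congr_ae (ae_of_all _ fun y => ?_)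
      simp only [expSolution, if_neg hs.1.ne', dgrad]
      rw [mul_assoc, ← Real.exp_add (ψ (T - s) x), add_sub_cancel]
    have e2 : hamiltonian L x (dgrad (ψ (T - s))) =
        ∫ y, Real.exp (dgrad (ψ (T - s)) (x, y)) ∂(L x) - (L x).real univ := by
      rw [hamiltonian, integral_sub hi (integrable_const _)]
      simp
    rw [e2] at h4
    rw [posFun, e1, expSolution, if_neg hs.1.ne']
    convert h4 using 1
    ring

variable {L T} in
/-- Uniqueness for the Hamilton-Jacobi equation. -/
lemma IsHJESolution.unique {f : Γ → ℝ≥0∞} {ψ ψ' : ℝ → Γ → ℝ} (h : IsHJESolution L T f ψ)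
    (h' : IsHJESolution L T f ψ') {t : ℝ} (ht : t ∈ Ico 0 T) (x : Γ) : ψ t x = ψ' t x := by
  have hIoo : ∀ t ∈ Ioo 0 T, ψ t x = ψ' t x := by
    intro t ht
    have hne : T - t ≠ 0 := (sub_pos.2 ht.2).ne'
    have := h.isPosSolution.unique h'.isPosSolution (fun x => by simp [expSolution])
      (s := T - t) ⟨by linarith [ht.2], by linarith [ht.1]⟩ x
    simp only [expSolution, if_neg hne, sub_sub_cancel] at this
    exact Real.exp_injective (mul_left_cancel₀ (Real.exp_pos _).ne' this)
  -- Reversed time is half open at S = T, which leaves out t = 0; that value follows by right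
  -- continuity.
  rcases ht.1.eq_or_lt with rfl | h0
  · have hT : (0 : ℝ) < T := ht.2
    have h1 := (h.continuousOn x 0 ht).mono (Ioo_subset_Ico_self (a := 0) (b := T))
    have h2 := (h'.continuousOn x 0 ht).mono (Ioo_subset_Ico_self (a := 0) (b := T))
    have : (𝓝[Ioo 0 T] (0 : ℝ)).NeBot := by
      rw [nhdsWithin_Ioo_eq_nhdsGT hT]; infer_instance
    refine tendsto_nhds_unique h1 (h2.congr' ?_)
    filter_upwards [self_mem_nhdsWithin] with s hs
    exact (hIoo s hs).symm
  · exact hIoo t ⟨h0, ht.2⟩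

end Backward

end JumpControl
end

/-! ### Superposition operators in the supremum norm. -/

noncomputable section

namespace JumpControl

variable {Γ : Type*} [MeasurableSpace Γ]

section Superposition

/-- Truncation of a real number to `[0, 1]`. -/
def clampUnit (a : ℝ) : ℝ := max 0 (min 1 a)

lemma clampUnit_mem (a : ℝ) : clampUnit a ∈ Icc (0 : ℝ) 1 :=
  ⟨le_max_left _ _, max_le zero_le_one (min_le_left _ _)⟩

lemma clampUnit_of_mem {a : ℝ} (h : a ∈ Icc (0 : ℝ) 1) : clampUnit a = a := by
  rw [clampUnit, min_eq_right h.2, max_eq_right h.1]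

/-- Functions that act by superposition on the elements of `Bdd Γ` with values in `[0, 1]`. -/
def ActsOnUnit (Φ : ℝ → ℝ) : Prop := Measurable Φ ∧ ContinuousOn Φ (Icc 0 1)

lemma ActsOnUnit.exists_bound {Φ : ℝ → ℝ} (h : ActsOnUnit Φ) :
    ∃ C, 0 ≤ C ∧ ∀ a ∈ Icc (0 : ℝ) 1, |Φ a| ≤ C := by
  obtain ⟨C, hC⟩ := isCompact_Icc.exists_bound_of_continuousOn h.2
  exact ⟨C, (norm_nonneg _).trans (hC 0 ⟨le_rfl, zero_le_one⟩), hC⟩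

/-- The superposition of `Φ` with an element of `Bdd Γ` truncated to `[0, 1]`. -/
def superpose (Φ : ℝ → ℝ) (hΦ : ActsOnUnit Φ) (u : Bdd Γ) : Bdd Γ :=
  Bdd.of (fun x => Φ (clampUnit (u x)))
    ⟨hΦ.1.comp (measurable_const.max (measurable_const.min u.measurable)),
      hΦ.exists_bound.imp fun _ hC _ => hC.2 _ (clampUnit_mem _)⟩

lemma superpose_apply {Φ : ℝ → ℝ} (hΦ : ActsOnUnit Φ) {u : Bdd Γ} {x : Γ}
    (hu : u x ∈ Icc (0 : ℝ) 1) : superpose Φ hΦ u x = Φ (u x) := by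
  change Φ (clampUnit (u x)) = _
  rw [clampUnit_of_mem hu]

variable {Φ Φ' Φ'' : ℝ → ℝ}

lemma exists_lipschitz_of_hasDerivAt (hΦ' : ActsOnUnit Φ')
    (hd : ∀ a ∈ Icc (0 : ℝ) 1, HasDerivAt Φ (Φ' a) a) :
    ∃ C, 0 ≤ C ∧ ∀ a ∈ Icc (0 : ℝ) 1, ∀ b ∈ Icc (0 : ℝ) 1, |Φ b - Φ a| ≤ C * |b - a| := by
  obtain ⟨C, hC0, hC⟩ := hΦ'.exists_bound
  exact ⟨C, hC0, fun a ha b hb => (convex_Icc 0 1).norm_image_sub_le_of_norm_hasDerivWithin_le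
    (fun x hx => (hd x hx).hasDerivWithinAt) hC ha hb⟩

/-- The mean value inequality for `Φ s - Φ' a * s`, whose derivative is at most C|b - a| between a
and b. The constant does not depend on a, as differentiability in the supremum norm requires. -/
lemma exists_taylor_of_hasDerivAt (hΦ'' : ActsOnUnit Φ'')
    (hd : ∀ a ∈ Icc (0 : ℝ) 1, HasDerivAt Φ (Φ' a) a)
    (hd' : ∀ a ∈ Icc (0 : ℝ) 1, HasDerivAt Φ' (Φ'' a) a) :
    ∃ C, 0 ≤ C ∧ ∀ a ∈ Icc (0 : ℝ) 1, ∀ b ∈ Icc (0 : ℝ) 1,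
      |Φ b - Φ a - Φ' a * (b - a)| ≤ C * |b - a| ^ 2 := by
  obtain ⟨C, hC0, hC⟩ := exists_lipschitz_of_hasDerivAt hΦ'' hd'
  refine ⟨C, hC0, fun a ha b hb => ?_⟩
  have hsub : uIcc a b ⊆ Icc (0 : ℝ) 1 := (ordConnected_Icc).uIcc_subset ha hb
  have h := (convex_uIcc a b).norm_image_sub_le_of_norm_hasDerivWithin_le
    (f := fun s => Φ s - Φ' a * s) (f' := fun s => Φ' s - Φ' a * 1) (C := C * |b - a|)
    (fun x hx => ((hd x (hsub hx)).sub ((hasDerivAt_id x).const_mul _)).hasDerivWithinAt)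
    (fun x hx => by
      rw [mul_one]
      refine (hC a ha x (hsub hx)).trans (mul_le_mul_of_nonneg_left ?_ hC0)
      exact Set.abs_sub_left_of_mem_uIcc hx) left_mem_uIcc right_mem_uIcc
  rw [Real.norm_eq_abs, Real.norm_eq_abs] at h
  calc |Φ b - Φ a - Φ' a * (b - a)| = |Φ b - Φ' a * b - (Φ a - Φ' a * a)| := by ring_nf
    _ ≤ C * |b - a| * |b - a| := h
    _ = C * |b - a| ^ 2 := by ring

lemma norm_superpose_sub_le {C : ℝ} (hΦ : ActsOnUnit Φ) (hC0 : 0 ≤ C)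
    (hC : ∀ a ∈ Icc (0 : ℝ) 1, ∀ b ∈ Icc (0 : ℝ) 1, |Φ b - Φ a| ≤ C * |b - a|) {u v : Bdd Γ}
    (hu : ∀ x, u x ∈ Icc (0 : ℝ) 1) (hv : ∀ x, v x ∈ Icc (0 : ℝ) 1) :
    ‖superpose Φ hΦ v - superpose Φ hΦ u‖ ≤ C * ‖v - u‖ := by
  refine Bdd.norm_le (by positivity) fun x => ?_
  rw [Bdd.sub_apply, superpose_apply hΦ (hu x), superpose_apply hΦ (hv x)]
  exact (hC _ (hu x) _ (hv x)).trans
    (mul_le_mul_of_nonneg_left ((v - u).abs_apply_le x) hC0)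

lemma continuous_superpose (hΦ : ActsOnUnit Φ) (hΦ' : ActsOnUnit Φ')
    (hd : ∀ a ∈ Icc (0 : ℝ) 1, HasDerivAt Φ (Φ' a) a) {u : ℝ → Bdd Γ} (hu : Continuous u)
    (hI : ∀ s x, u s x ∈ Icc (0 : ℝ) 1) : Continuous fun s => superpose Φ hΦ (u s) := by
  obtain ⟨C, hC0, hC⟩ := exists_lipschitz_of_hasDerivAt hΦ' hd
  refine continuous_iff_continuousAt.2 fun t => tendsto_iff_norm_sub_tendsto_zero.2 ?_
  have h1 := (tendsto_iff_norm_sub_tendsto_zero.1 (hu.tendsto t)).const_mul C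
  rw [mul_zero] at h1
  exact squeeze_zero (fun _ => norm_nonneg _)
    (fun s => norm_superpose_sub_le hΦ hC0 hC (hI t) (hI s)) h1

/-- Chain rule for superposition operators in the supremum norm. -/
lemma hasDerivAt_superpose (hΦ : ActsOnUnit Φ) (hΦ' : ActsOnUnit Φ') (hΦ'' : ActsOnUnit Φ'')
    (hd : ∀ a ∈ Icc (0 : ℝ) 1, HasDerivAt Φ (Φ' a) a)
    (hd' : ∀ a ∈ Icc (0 : ℝ) 1, HasDerivAt Φ' (Φ'' a) a) {u : ℝ → Bdd Γ} {u' : Bdd Γ} {t : ℝ}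
    (hu : HasDerivAt u u' t) (hI : ∀ s x, u s x ∈ Icc (0 : ℝ) 1) :
    HasDerivAt (fun s => superpose Φ hΦ (u s)) (superpose Φ' hΦ' (u t) * u') t := by
  obtain ⟨C, hC0, hC⟩ := exists_taylor_of_hasDerivAt hΦ'' hd hd'
  obtain ⟨M, hM0, hM⟩ := hΦ'.exists_bound
  have h2 : (fun s => C * ‖u s - u t‖ ^ 2) =o[𝓝 t] fun s => s - t :=
    (((Asymptotics.isLittleO_pow_sub_sub (u t) one_lt_two).comp_tendsto
      hu.continuousAt).trans_isBigO hu.isBigO_sub).const_mul_left C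
  rw [hasDerivAt_iff_isLittleO] at hu ⊢
  have h3 : (fun s => M * ‖u s - u t - (s - t) • u'‖) =o[𝓝 t] fun s => s - t :=
    hu.norm_left.const_mul_left M
  refine (Asymptotics.isBigO_of_le _ fun s => ?_).trans_isLittleO (h2.add h3)
  refine le_trans ?_ (le_abs_self _)
  refine Bdd.norm_le (by positivity) fun x => ?_
  have e : (superpose Φ hΦ (u s) - superpose Φ hΦ (u t) -
      (s - t) • (superpose Φ' hΦ' (u t) * u')) x =
      (Φ (u s x) - Φ (u t x) - Φ' (u t x) * (u s x - u t x)) +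
        Φ' (u t x) * (u s - u t - (s - t) • u') x := by
    simp only [Bdd.sub_apply, Bdd.smul_apply, Bdd.mul_apply, superpose_apply _ (hI s x),
      superpose_apply _ (hI t x)]
    ring
  rw [e]
  refine (abs_add_le _ _).trans (add_le_add ?_ ?_)
  · refine (hC _ (hI t x) _ (hI s x)).trans (mul_le_mul_of_nonneg_left ?_ hC0)
    exact pow_le_pow_left₀ (abs_nonneg _) ((u s - u t).abs_apply_le x) 2
  · rw [abs_mul]
    exact mul_le_mul (hM _ (hI t x)) (Bdd.abs_apply_le _ x) (abs_nonneg _) hM0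

end Superposition

end JumpControl
end

/-! ### The product rule along admissible pairs. -/

noncomputable section

namespace JumpControl

variable {Γ : Type*} [MeasurableSpace Γ]

section Leibniz

/-- Over n + 1 equal steps the increments sum to at most K T (Q T - Q 0)/(n + 1). This replaces
differentiation in time for a flux that is merely integrable in time. -/
lemma eq_of_abs_sub_le_mul {D Q : ℝ → ℝ} {K T : ℝ} (hT : 0 ≤ T)
    (h : ∀ s t, 0 ≤ s → s ≤ t → t ≤ T → |D t - D s| ≤ K * (t - s) * (Q t - Q s)) : D T = D 0 := by
  have key : ∀ n : ℕ, |D T - D 0| ≤ K * T * (Q T - Q 0) / (n + 1) := by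
    intro n
    have hn : (0 : ℝ) < n + 1 := by positivity
    set τ : ℕ → ℝ := fun k => k * T / (n + 1) with hτ
    have h0 : τ 0 = 0 := by simp [hτ]
    have h1 : τ (n + 1) = T := by
      simp only [hτ]; push_cast; field_simp
    have e1 : D T - D 0 = ∑ k ∈ Finset.range (n + 1), (D (τ (k + 1)) - D (τ k)) := by
      rw [Finset.sum_range_sub (fun k => D (τ k)), h0, h1]
    have e2 : Q T - Q 0 = ∑ k ∈ Finset.range (n + 1), (Q (τ (k + 1)) - Q (τ k)) := by
      rw [Finset.sum_range_sub (fun k => Q (τ k)), h0, h1]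
    rw [e1, e2, Finset.mul_sum, Finset.sum_div]
    refine (Finset.abs_sum_le_sum_abs _ _).trans (Finset.sum_le_sum fun k hk => ?_)
    have hk' : (k : ℝ) + 1 ≤ n + 1 := by
      have := Finset.mem_range.1 hk
      exact_mod_cast this
    have hstep : τ (k + 1) - τ k = T / (n + 1) := by
      simp only [hτ]; push_cast; ring
    refine (h _ _ (by simp only [hτ]; positivity) ?_ ?_).trans_eq ?_
    · have : 0 ≤ T / (n + 1) := by positivity
      linarith
    · simp only [hτ]
      push_cast
      rw [div_le_iff₀ hn, mul_comm T]
      exact mul_le_mul_of_nonneg_right hk' hT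
    · rw [hstep]; ring
  have hlim : Tendsto (fun n : ℕ => K * T * (Q T - Q 0) / ((n : ℝ) + 1)) atTop (𝓝 0) :=
    tendsto_const_nhds.div_atTop (tendsto_natCast_atTop_atTop.atTop_add tendsto_const_nhds)
  exact sub_eq_zero.1 (abs_nonpos_iff.1 (ge_of_tendsto' hlim key))

/-- A kernel of finite measures is s-finite. -/
lemma isSFiniteKernel_of_isFiniteMeasure {α β : Type*} [MeasurableSpace α] [MeasurableSpace β]
    (q : Kernel α β) (hq : ∀ a, IsFiniteMeasure (q a)) : IsSFiniteKernel q := by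
  classical
  have hs : ∀ n : ℕ, MeasurableSet {a | ⌊(q a univ).toReal⌋₊ = n} := fun n =>
    (Nat.measurable_floor.comp (q.measurable_coe MeasurableSet.univ).ennreal_toReal)
      (measurableSet_singleton n)
  refine ⟨fun n => Kernel.piecewise (hs n) q 0, fun n => ⟨ENNReal.ofReal (n + 1),
    ENNReal.ofReal_lt_top, fun a => ?_⟩, ?_⟩
  · rw [Kernel.piecewise_apply]
    split_ifs with h
    · have h' : ⌊(q a univ).toReal⌋₊ = n := h
      rw [← ENNReal.ofReal_toReal (measure_ne_top (q a) univ)]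
      refine ENNReal.ofReal_le_ofReal ?_
      rw [← h']
      exact (Nat.lt_floor_add_one _).le
    · simp
  · ext a s hs'
    rw [Kernel.sum_apply' _ _ hs', tsum_eq_single ⌊(q a univ).toReal⌋₊]
    · rw [Kernel.piecewise_apply, if_pos
        (show a ∈ {b | ⌊(q b univ).toReal⌋₊ = ⌊(q a univ).toReal⌋₊} from rfl)]
    · intro n hn
      rw [Kernel.piecewise_apply, if_neg
        (show a ∉ {b | ⌊(q b univ).toReal⌋₊ = n} from fun h => hn (Eq.symm h))]
      simp

variable {L : Kernel Γ Γ} {T : ℝ} {μ : Measure Γ} {P : DensityFlux Γ}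

/-- The total flux at a given time. -/
def DensityFlux.mass (P : DensityFlux Γ) (t : ℝ) : ℝ := (P.q t).real univ

lemma DensityFlux.mass_nonneg (P : DensityFlux Γ) (t : ℝ) : 0 ≤ P.mass t := measureReal_nonneg

lemma DensityFlux.abs_integral_dgrad_le (P : DensityFlux Γ) (φ : Bdd Γ) (t : ℝ) :
    |∫ z, dgrad φ z ∂(P.q t)| ≤ 2 * ‖φ‖ * P.mass t := by
  have := P.finite_q t
  refine norm_integral_le_of_norm_le_const (μ := P.q t) (f := dgrad φ) (C := 2 * ‖φ‖)
    (ae_of_all _ fun z => ?_)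
  have := (abs_sub (φ z.2) (φ z.1)).trans (add_le_add (φ.abs_apply_le _) (φ.abs_apply_le _))
  rw [dgrad, Real.norm_eq_abs]
  linarith

lemma Bdd.abs_integral_le (φ : Bdd Γ) (ν : ProbabilityMeasure Γ) :
    |∫ x, φ x ∂(ν : Measure Γ)| ≤ ‖φ‖ := by
  have := norm_integral_le_of_norm_le_const (μ := (ν : Measure Γ)) (f := φ) (C := ‖φ‖)
    (ae_of_all _ φ.abs_apply_le)
  simpa using this

/-- Integration against a probability measure as a functional on `Bdd Γ`. -/
def Bdd.integralL (ν : ProbabilityMeasure Γ) : Bdd Γ →L[ℝ] ℝ :=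
  LinearMap.mkContinuous
    { toFun := fun φ : Bdd Γ => ∫ x, φ x ∂(ν : Measure Γ)
      map_add' := fun φ χ => integral_add (φ.integrable _) (χ.integrable _)
      map_smul' := fun a φ => integral_const_mul a _ } 1
    (fun φ => by rw [one_mul]; exact φ.abs_integral_le ν)

@[simp] lemma Bdd.integralL_apply (ν : ProbabilityMeasure Γ) (φ : Bdd Γ) :
    Bdd.integralL ν φ = ∫ x, φ x ∂(ν : Measure Γ) := rfl

namespace IsAdmissible

lemma integrableOn_mass (hP : IsAdmissible L T μ P) : IntegrableOn P.mass (Ioo 0 T) := by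
  refine integrable_toReal_of_lintegral_ne_top ?_ hP.flux_integrable.ne
  exact (P.q.measurable_coe MeasurableSet.univ).aemeasurable

lemma intervalIntegrable_mass (hP : IsAdmissible L T μ P) {s t : ℝ} (hs : 0 ≤ s) (hst : s ≤ t)
    (ht : t ≤ T) : IntervalIntegrable P.mass volume s t := by
  rw [intervalIntegrable_iff_integrableOn_Ioo_of_le hst]
  exact hP.integrableOn_mass.mono_set (Ioo_subset_Ioo hs ht)

/-- The estimate is uniform over test functions of bounded norm, hence stronger than setwise
continuity. It allows test functions that depend on time. -/
lemma abs_integral_sub_le (hP : IsAdmissible L T μ P) {s t : ℝ} (hs : 0 ≤ s) (hst : s ≤ t)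
    (ht : t ≤ T) (φ : Bdd Γ) :
    |∫ x, φ x ∂(P.p t : Measure Γ) - ∫ x, φ x ∂(P.p s : Measure Γ)| ≤
      2 * ‖φ‖ * ∫ r in s..t, P.mass r := by
  rw [hP.continuity_equation s t hs hst ht φ φ.isBddMeas, ← intervalIntegral.integral_const_mul]
  exact intervalIntegral.norm_integral_le_of_norm_le (f := fun r => ∫ z, dgrad φ z ∂(P.q r))
    (g := fun r => 2 * ‖φ‖ * P.mass r) hst (ae_of_all _ fun r _ => P.abs_integral_dgrad_le φ r)
    ((hP.intervalIntegrable_mass hs hst ht).const_mul _)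

lemma measurable_integral_dgrad (P : DensityFlux Γ) {φ : ℝ → Bdd Γ} (hφ : Continuous φ) :
    Measurable fun r => ∫ z, dgrad (φ r) z ∂(P.q r) := by
  have := isSFiniteKernel_of_isFiniteMeasure P.q P.finite_q
  have h : Measurable (Function.uncurry fun r z => dgrad (φ r) z) :=
    measurable_uncurry_of_continuous_of_measurable
      (fun z => (continuous_eval hφ z.2).sub (continuous_eval hφ z.1))
      (fun r => (φ r).isBddMeas.dgrad.1)
  exact (h.stronglyMeasurable.integral_kernel_prod_right (κ := P.q)).measurable

lemma intervalIntegrable_integral_dgrad (hP : IsAdmissible L T μ P) {φ : ℝ → Bdd Γ}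
    (hφ : Continuous φ) {s t : ℝ} (hs : 0 ≤ s) (hst : s ≤ t) (ht : t ≤ T) :
    IntervalIntegrable (fun r => ∫ z, dgrad (φ r) z ∂(P.q r)) volume s t := by
  obtain ⟨C, hC⟩ := (isCompact_Icc (a := s) (b := t)).exists_bound_of_continuousOn
    hφ.continuousOn
  refine IntervalIntegrable.mono_fun' ((hP.intervalIntegrable_mass hs hst ht).const_mul (2 * C))
    (measurable_integral_dgrad P hφ).aestronglyMeasurable ?_
  rw [uIoc_of_le hst]
  filter_upwards [ae_restrict_mem measurableSet_Ioc] with r hr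
  refine (P.abs_integral_dgrad_le _ _).trans ?_
  have := hC r ⟨hr.1.le, hr.2⟩
  gcongr
  exact P.mass_nonneg r

lemma continuousOn_integral (hP : IsAdmissible L T μ P) {φ : ℝ → Bdd Γ} (hφ : Continuous φ) :
    ContinuousOn (fun r => ∫ x, φ r x ∂(P.p r : Measure Γ)) (Icc 0 T) := by
  intro s hs
  have hT : 0 ≤ T := hs.1.trans hs.2
  have hQ : ContinuousOn (fun t => ∫ r in (0 : ℝ)..t, P.mass r) (Icc 0 T) := by
    refine intervalIntegral.continuousOn_primitive_interval' (b₁ := 0) (b₂ := T)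
      (hP.intervalIntegrable_mass le_rfl hT le_rfl) left_mem_uIcc |>.mono ?_
    rw [uIcc_of_le hT]
  have hsub : ∀ t ∈ Icc 0 T, |∫ x, φ s x ∂(P.p t : Measure Γ) - ∫ x, φ s x ∂(P.p s : Measure Γ)| ≤
      2 * ‖φ s‖ * |(∫ r in (0 : ℝ)..t, P.mass r) - ∫ r in (0 : ℝ)..s, P.mass r| := by
    intro t ht
    have e : ∀ a b, a ∈ Icc 0 T → b ∈ Icc 0 T → a ≤ b →
        (∫ r in (0 : ℝ)..b, P.mass r) - ∫ r in (0 : ℝ)..a, P.mass r = ∫ r in a..b, P.mass r := by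
      intro a b ha hb _
      exact intervalIntegral.integral_interval_sub_left
        (hP.intervalIntegrable_mass le_rfl hb.1 hb.2) (hP.intervalIntegrable_mass le_rfl ha.1 ha.2)
    rcases le_total s t with h | h
    · rw [e s t hs ht h]
      refine (hP.abs_integral_sub_le hs.1 h ht.2 _).trans ?_
      gcongr
      exact le_abs_self _
    · rw [abs_sub_comm, abs_sub_comm (∫ r in (0 : ℝ)..t, P.mass r), e t s ht hs h]
      refine (hP.abs_integral_sub_le ht.1 h hs.2 _).trans ?_
      gcongr
      exact le_abs_self _
  have hlim : Tendsto (fun t => ‖φ t - φ s‖ + 2 * ‖φ s‖ *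
      |(∫ r in (0 : ℝ)..t, P.mass r) - ∫ r in (0 : ℝ)..s, P.mass r|) (𝓝[Icc 0 T] s) (𝓝 0) := by
    have h1 := (tendsto_iff_norm_sub_tendsto_zero.1 (hφ.tendsto s)).mono_left
      (nhdsWithin_le_nhds (s := Icc 0 T))
    have h2 := (((hQ s hs).tendsto.sub_const (∫ r in (0 : ℝ)..s, P.mass r)).abs).const_mul
      (2 * ‖φ s‖)
    rw [sub_self, abs_zero, mul_zero] at h2
    simpa using h1.add h2
  refine tendsto_iff_norm_sub_tendsto_zero.2 (squeeze_zero' (Eventually.of_forall fun _ =>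
    norm_nonneg _) ?_ hlim)
  filter_upwards [self_mem_nhdsWithin] with t ht
  have e : ∫ x, φ t x ∂(P.p t : Measure Γ) - ∫ x, φ s x ∂(P.p s : Measure Γ) =
      ∫ x, (φ t - φ s) x ∂(P.p t : Measure Γ) +
      (∫ x, φ s x ∂(P.p t : Measure Γ) - ∫ x, φ s x ∂(P.p s : Measure Γ)) := by
    have : ∫ x, (φ t - φ s) x ∂(P.p t : Measure Γ) =
        ∫ x, φ t x ∂(P.p t : Measure Γ) - ∫ x, φ s x ∂(P.p t : Measure Γ) :=
      integral_sub ((φ t).integrable _) ((φ s).integrable _)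
    rw [this]; ring
  rw [e]
  exact (abs_add_le _ _).trans (add_le_add (Bdd.abs_integral_le _ _) (hsub t ht))

lemma intervalIntegrable_integral (hP : IsAdmissible L T μ P) {φ : ℝ → Bdd Γ}
    (hφ : Continuous φ) {s t : ℝ} (hs : 0 ≤ s) (hst : s ≤ t) (ht : t ≤ T) :
    IntervalIntegrable (fun r => ∫ x, φ r x ∂(P.p r : Measure Γ)) volume s t := by
  refine ContinuousOn.intervalIntegrable ((hP.continuousOn_integral hφ).mono ?_)
  rw [uIcc_of_le hst]
  exact Icc_subset_Icc hs ht

/-- The product rule along an admissible pair, for a test function that is `C¹` in time with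
respect to the supremum norm. -/
lemma integral_sub_integral (hP : IsAdmissible L T μ P) {φ φ' : ℝ → Bdd Γ} (hφ : Continuous φ)
    (hφ' : Continuous φ') {S : ℝ} (hS : 0 ≤ S) (hST : S ≤ T)
    (hd : ∀ t ∈ Ioo 0 S, HasDerivAt φ (φ' t) t) :
    ∫ x, φ S x ∂(P.p S : Measure Γ) - ∫ x, φ 0 x ∂(P.p 0 : Measure Γ) =
      ∫ r in (0 : ℝ)..S, (∫ x, φ' r x ∂(P.p r : Measure Γ) + ∫ z, dgrad (φ r) z ∂(P.q r)) := by
  obtain ⟨C, hC⟩ := (isCompact_Icc (a := 0) (b := S)).exists_bound_of_continuousOn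
    hφ'.continuousOn
  have hC0 : 0 ≤ C := (norm_nonneg _).trans (hC 0 ⟨le_rfl, hS⟩)
  set G : ℝ → ℝ := fun r => ∫ x, φ' r x ∂(P.p r : Measure Γ) + ∫ z, dgrad (φ r) z ∂(P.q r) with hG
  have hGi : ∀ s t, 0 ≤ s → s ≤ t → t ≤ S → IntervalIntegrable G volume s t :=
    fun s t hs hst ht => (hP.intervalIntegrable_integral hφ' hs hst (ht.trans hST)).add
      (hP.intervalIntegrable_integral_dgrad hφ hs hst (ht.trans hST))
  have hftc : ∀ s t, 0 ≤ s → s ≤ t → t ≤ S → ∫ r in s..t, φ' r = φ t - φ s := by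
    intro s t hs hst ht
    exact intervalIntegral.integral_eq_sub_of_hasDerivAt_of_le hst hφ.continuousOn
      (fun r hr => hd r ⟨hs.trans_lt hr.1, hr.2.trans_le ht⟩) (hφ'.intervalIntegrable _ _)
  have hlip : ∀ s t, 0 ≤ s → s ≤ t → t ≤ S → ‖φ t - φ s‖ ≤ C * (t - s) := by
    intro s t hs hst ht
    rw [← hftc s t hs hst ht]
    have := intervalIntegral.norm_integral_le_of_norm_le_const (f := φ') (a := s) (b := t) (C := C)
      fun r hr => by
        rw [uIoc_of_le hst] at hr
        exact hC r ⟨hs.trans hr.1.le, hr.2.trans ht⟩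
    rwa [abs_of_nonneg (sub_nonneg.2 hst)] at this
  -- On [s, t] the test function is frozen at time t in the flux term and the density at time s in
  -- the derivative term. Each replacement costs at most 2C(t - s) times the flux mass of [s, t],
  -- hence the constant 4C.
  have key := eq_of_abs_sub_le_mul (K := 4 * C) (Q := fun t => ∫ r in (0 : ℝ)..t, P.mass r)
    (D := fun t => ∫ x, φ t x ∂(P.p t : Measure Γ) - ∫ r in (0 : ℝ)..t, G r) hS ?_
  · simp only [intervalIntegral.integral_same, sub_zero] at key
    linarith
  intro s t hs hst ht
  have htT := ht.trans hST
  have hm := hP.intervalIntegrable_mass hs hst htT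
  have eQ : (∫ r in (0 : ℝ)..t, P.mass r) - ∫ r in (0 : ℝ)..s, P.mass r = ∫ r in s..t, P.mass r :=
    intervalIntegral.integral_interval_sub_left
      (hP.intervalIntegrable_mass le_rfl (hs.trans hst) htT)
      (hP.intervalIntegrable_mass le_rfl hs (hst.trans htT))
  have eG : (∫ r in (0 : ℝ)..t, G r) - ∫ r in (0 : ℝ)..s, G r = ∫ r in s..t, G r :=
    intervalIntegral.integral_interval_sub_left
      (hGi _ _ le_rfl (hs.trans hst) ht) (hGi _ _ le_rfl hs (hst.trans ht))
  have hint1 : IntervalIntegrable (fun r => ∫ x, φ' r x ∂(P.p r : Measure Γ)) volume s t :=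
    hP.intervalIntegrable_integral hφ' hs hst htT
  have hint2 := hP.intervalIntegrable_integral_dgrad hφ hs hst htT
  have hint3 : IntervalIntegrable (fun r => ∫ x, φ' r x ∂(P.p s : Measure Γ)) volume s t :=
    ((Bdd.integralL (P.p s)).continuous.comp hφ').intervalIntegrable _ _
  have hint4 : IntervalIntegrable (fun r => ∫ z, dgrad (φ t) z ∂(P.q r)) volume s t :=
    hP.intervalIntegrable_integral_dgrad (φ := fun _ => φ t) continuous_const hs hst htT
  have e1 : ∫ x, φ t x ∂(P.p t : Measure Γ) - ∫ x, φ t x ∂(P.p s : Measure Γ) =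
      ∫ r in s..t, ∫ z, dgrad (φ t) z ∂(P.q r) :=
    hP.continuity_equation s t hs hst htT (φ t) (φ t).isBddMeas
  have e2 : ∫ x, φ t x ∂(P.p s : Measure Γ) - ∫ x, φ s x ∂(P.p s : Measure Γ) =
      ∫ r in s..t, ∫ x, φ' r x ∂(P.p s : Measure Γ) := by
    have := (Bdd.integralL (P.p s)).intervalIntegral_comp_comm
      (hφ'.intervalIntegrable (μ := volume) s t)
    simp only [Bdd.integralL_apply] at this
    rw [this, hftc s t hs hst ht]
    exact (map_sub (Bdd.integralL (P.p s)) _ _).symm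
  have e3 : (∫ x, φ t x ∂(P.p t : Measure Γ) - ∫ r in (0 : ℝ)..t, G r) -
      (∫ x, φ s x ∂(P.p s : Measure Γ) - ∫ r in (0 : ℝ)..s, G r) =
      (∫ r in s..t, (∫ z, dgrad (φ t) z ∂(P.q r) - ∫ z, dgrad (φ r) z ∂(P.q r))) +
      ∫ r in s..t, (∫ x, φ' r x ∂(P.p s : Measure Γ) - ∫ x, φ' r x ∂(P.p r : Measure Γ)) := by
    rw [intervalIntegral.integral_sub hint4 hint2, intervalIntegral.integral_sub hint3 hint1,
      ← e1, ← e2]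
    have : ∫ r in s..t, G r = (∫ r in s..t, ∫ x, φ' r x ∂(P.p r : Measure Γ)) +
        ∫ r in s..t, ∫ z, dgrad (φ r) z ∂(P.q r) := intervalIntegral.integral_add hint1 hint2
    linarith
  have b1 : |∫ r in s..t, (∫ z, dgrad (φ t) z ∂(P.q r) - ∫ z, dgrad (φ r) z ∂(P.q r))| ≤
      ∫ r in s..t, 2 * (C * (t - s)) * P.mass r := by
    refine intervalIntegral.norm_integral_le_of_norm_le
      (f := fun r => ∫ z, dgrad (φ t) z ∂(P.q r) - ∫ z, dgrad (φ r) z ∂(P.q r))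
      (g := fun r => 2 * (C * (t - s)) * P.mass r) hst (ae_of_all _ fun r hr => ?_)
      (hm.const_mul _)
    have := P.finite_q r
    have e : ∫ z, dgrad (φ t) z ∂(P.q r) - ∫ z, dgrad (φ r) z ∂(P.q r) =
        ∫ z, dgrad (φ t - φ r) z ∂(P.q r) := by
      rw [← integral_sub ((φ t).isBddMeas.dgrad.integrable _) ((φ r).isBddMeas.dgrad.integrable _)]
      congr 1
      ext z
      simp only [dgrad, Bdd.sub_apply]; ring
    rw [e]
    refine (P.abs_integral_dgrad_le _ _).trans ?_
    have h1 := hlip r t (hs.trans hr.1.le) hr.2 ht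
    have h2 : C * (t - r) ≤ C * (t - s) := by
      have := hr.1.le
      gcongr
    have := P.mass_nonneg r
    gcongr
    exact h1.trans h2
  have b2 : |∫ r in s..t, (∫ x, φ' r x ∂(P.p s : Measure Γ) - ∫ x, φ' r x ∂(P.p r : Measure Γ))| ≤
      2 * C * (∫ r in s..t, P.mass r) * (t - s) := by
    have := intervalIntegral.norm_integral_le_of_norm_le_const (a := s) (b := t)
      (C := 2 * C * ∫ r in s..t, P.mass r)
      (f := fun r => ∫ x, φ' r x ∂(P.p s : Measure Γ) - ∫ x, φ' r x ∂(P.p r : Measure Γ)) ?_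
    · rwa [abs_of_nonneg (sub_nonneg.2 hst)] at this
    · intro r hr
      rw [uIoc_of_le hst] at hr
      rw [Real.norm_eq_abs, abs_sub_comm]
      refine (hP.abs_integral_sub_le hs hr.1.le (hr.2.trans htT) _).trans ?_
      have h1 := hC r ⟨hs.trans hr.1.le, hr.2.trans ht⟩
      have h2 : ∫ r in s..r, P.mass r ≤ ∫ r in s..t, P.mass r :=
        intervalIntegral.integral_mono_interval le_rfl hr.1.le hr.2
          (ae_of_all _ fun r => P.mass_nonneg r) hm
      have h3 : 0 ≤ ∫ r in s..r, P.mass r :=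
        intervalIntegral.integral_nonneg hr.1.le fun u _ => P.mass_nonneg u
      gcongr
  rw [intervalIntegral.integral_const_mul] at b1
  change |(∫ x, φ t x ∂(P.p t : Measure Γ) - ∫ r in (0 : ℝ)..t, G r) -
      (∫ x, φ s x ∂(P.p s : Measure Γ) - ∫ r in (0 : ℝ)..s, G r)| ≤ 4 * C * (t - s) *
      ((∫ r in (0 : ℝ)..t, P.mass r) - ∫ r in (0 : ℝ)..s, P.mass r)
  rw [e3, eQ]
  refine (abs_add_le _ _).trans ((add_le_add b1 b2).trans_eq ?_)
  ring

end IsAdmissible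

end Leibniz

end JumpControl
end

/-! ### Entropy duality and the lower bound. -/

noncomputable section

namespace JumpControl

variable {Γ : Type*} [MeasurableSpace Γ]

open InformationTheory

lemma ofReal_integral_le_lintegral_ofReal (ν : Measure Γ) (F : Γ → ℝ) :
    ENNReal.ofReal (∫ x, F x ∂ν) ≤ ∫⁻ x, ENNReal.ofReal (F x) ∂ν := by
  by_cases hF : Integrable F ν
  · have h1 : Integrable (fun x => max (F x) 0) ν := hF.pos_part
    refine (ENNReal.ofReal_le_ofReal (integral_mono hF h1 fun x => le_max_left _ _)).trans_eq ?_
    rw [ofReal_integral_eq_lintegral_ofReal h1 (ae_of_all _ fun x => le_max_right _ _)]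
    simp [ENNReal.ofReal_max]
  · simp [integral_undef hF]

section Young

variable {α β : Measure Γ} [IsFiniteMeasure α] [IsFiniteMeasure β]

/-- The dual functional of the relative entropy. -/
def dualPairing (α β : Measure Γ) (ξ : Γ → ℝ) : ℝ := ∫ z, ξ z ∂α - ∫ z, (Real.exp (ξ z) - 1) ∂β

lemma IsBddMeas.exp {ξ : Γ → ℝ} (hξ : IsBddMeas ξ) : IsBddMeas fun z => Real.exp (ξ z) := by
  obtain ⟨hm, M, hM⟩ := hξ
  refine ⟨hm.exp, Real.exp M, fun z => ?_⟩
  rw [abs_of_pos (Real.exp_pos _)]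
  exact Real.exp_le_exp.2 ((le_abs_self _).trans (hM z))

/-- The right side is the defect in the scalar Young inequality between `klFun` and its conjugate
e^ξ - 1. The left side shows that it is nonnegative and vanishes only for s = e^ξ. -/
lemma exp_mul_klFun {s : ℝ} (hs : 0 ≤ s) (ξ : ℝ) :
    Real.exp ξ * klFun (s * Real.exp (-ξ)) = klFun s - s * ξ + (Real.exp ξ - 1) := by
  have h1 : Real.exp ξ * Real.exp (-ξ) = 1 := by rw [← Real.exp_add, add_neg_cancel, Real.exp_zero]
  rcases hs.eq_or_lt with rfl | h
  · simp [klFun]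
  · rw [klFun, klFun, Real.log_mul h.ne' (Real.exp_pos _).ne', Real.log_exp]
    linear_combination (s * (Real.log s + -ξ) - s) * h1

/-- Integrated form of `exp_mul_klFun`; boundedness of ξ makes each term integrable. The exact
defect serves twice: its sign is Young's inequality, and its vanishing identifies the optimal flux.
-/
lemma toReal_klDiv_eq_dualPairing_add (h : klDiv α β ≠ ⊤) {ξ : Γ → ℝ} (hξ : IsBddMeas ξ) :
    Integrable (fun z => Real.exp (ξ z) * klFun ((α.rnDeriv β z).toReal * Real.exp (-ξ z))) β ∧
      (klDiv α β).toReal = dualPairing α β ξ +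
        ∫ z, Real.exp (ξ z) * klFun ((α.rnDeriv β z).toReal * Real.exp (-ξ z)) ∂β := by
  obtain ⟨hac, hint⟩ := klDiv_ne_top_iff.1 h
  have i1 : Integrable (fun z => klFun (α.rnDeriv β z).toReal) β :=
    (integrable_klFun_rnDeriv_iff hac).2 hint
  have i2 : Integrable (fun z => (α.rnDeriv β z).toReal * ξ z) β :=
    (integrable_rnDeriv_smul_iff hac).2 (hξ.integrable α)
  have i3 : Integrable (fun z => Real.exp (ξ z) - 1) β :=
    (hξ.exp.integrable β).sub (integrable_const 1)
  simp only [exp_mul_klFun ENNReal.toReal_nonneg]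
  refine ⟨(i1.sub i2).add i3, ?_⟩
  have e : ∫ z, (α.rnDeriv β z).toReal * ξ z ∂β = ∫ z, ξ z ∂α := integral_rnDeriv_smul hac
  rw [integral_add (f := fun z => klFun (α.rnDeriv β z).toReal - (α.rnDeriv β z).toReal * ξ z)
    (i1.sub i2) i3, integral_sub i1 i2, e, toReal_klDiv_eq_integral_klFun hac,
    dualPairing]
  ring

/-- Young's inequality for the relative entropy. -/
lemma ofReal_dualPairing_le_klDiv {ξ : Γ → ℝ} (hξ : IsBddMeas ξ) :
    ENNReal.ofReal (dualPairing α β ξ) ≤ klDiv α β := by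
  by_cases h : klDiv α β = ⊤
  · rw [h]; exact le_top
  obtain ⟨-, e⟩ := toReal_klDiv_eq_dualPairing_add h hξ
  refine ENNReal.ofReal_le_of_le_toReal ?_
  rw [e]
  refine le_add_of_nonneg_right (integral_nonneg fun z => ?_)
  exact mul_nonneg (Real.exp_pos _).le (klFun_nonneg (by positivity))

end Young

section LogApprox

variable {ε : ℝ}

lemma add_pos_of_mem {a : ℝ} (hε : 0 < ε) (ha : a ∈ Icc (0 : ℝ) 1) : 0 < a + ε :=
  add_pos_of_nonneg_of_pos ha.1 hε

/-- The normalized logarithm, regularized at `0`. -/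
def logApprox (ε u : ℝ) : ℝ := Real.log (u + ε) - Real.log (1 + ε)

lemma hasDerivAt_logApprox (hε : 0 < ε) {a : ℝ} (ha : a ∈ Icc (0 : ℝ) 1) :
    HasDerivAt (logApprox ε) (a + ε)⁻¹ a := by
  have := (((hasDerivAt_id a).add_const ε).log (add_pos_of_mem hε ha).ne').sub_const
    (Real.log (1 + ε))
  rwa [one_div] at this

lemma hasDerivAt_inv_add (hε : 0 < ε) {a : ℝ} (ha : a ∈ Icc (0 : ℝ) 1) :
    HasDerivAt (fun u : ℝ => (u + ε)⁻¹) (-((a + ε) ^ 2)⁻¹) a := by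
  have := ((hasDerivAt_id a).add_const ε).fun_inv (add_pos_of_mem hε ha).ne'
  rwa [neg_div, one_div] at this

lemma actsOnUnit_logApprox (hε : 0 < ε) : ActsOnUnit (logApprox ε) :=
  ⟨(Real.measurable_log.comp (measurable_id.add_const ε)).sub_const _,
    fun _ ha => (hasDerivAt_logApprox hε ha).continuousAt.continuousWithinAt⟩

lemma actsOnUnit_inv_add (hε : 0 < ε) : ActsOnUnit fun u => (u + ε)⁻¹ :=
  ⟨(measurable_id.add_const ε).inv,
    fun _ ha => (hasDerivAt_inv_add hε ha).continuousAt.continuousWithinAt⟩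

lemma actsOnUnit_neg_inv_add_sq (hε : 0 < ε) : ActsOnUnit fun u => -((u + ε) ^ 2)⁻¹ := by
  refine ⟨((measurable_id.add_const ε).pow_const 2).inv.neg, ContinuousOn.neg ?_⟩
  exact ContinuousOn.inv₀ (by fun_prop) fun a ha => pow_ne_zero 2 (add_pos_of_mem hε ha).ne'

lemma exp_logApprox (hε : 0 < ε) {a : ℝ} (ha : a ∈ Icc (0 : ℝ) 1) :
    Real.exp (logApprox ε a) = (a + ε) / (1 + ε) := by
  rw [logApprox, Real.exp_sub, Real.exp_log (add_pos_of_mem hε ha), Real.exp_log (by positivity)]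

lemma logApprox_nonpos (hε : 0 < ε) {a : ℝ} (ha : a ∈ Icc (0 : ℝ) 1) : logApprox ε a ≤ 0 :=
  sub_nonpos.2 (Real.log_le_log (add_pos_of_mem hε ha) (by linarith [ha.2]))

/-- The normalization by 1 + ε gives a ≤ (a + ε)/(1 + ε) for a ≤ 1. Hence the regularized terminal
cost stays below f, and -log a dominates its regularizations. -/
lemma log_le_logApprox (hε : 0 < ε) {a : ℝ} (h0 : 0 < a) (h1 : a ≤ 1) :
    Real.log a ≤ logApprox ε a := by
  rw [logApprox, le_sub_iff_add_le, ← Real.log_mul h0.ne' (by positivity)]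
  refine Real.log_le_log (by positivity) ?_
  nlinarith

lemma tendsto_logApprox {a : ℝ} (h0 : 0 < a) :
    Tendsto (fun ε => logApprox ε a) (𝓝 0) (𝓝 (Real.log a)) := by
  have h : ContinuousAt (fun ε => logApprox ε a) 0 := by
    unfold logApprox
    refine ContinuousAt.sub (ContinuousAt.log (by fun_prop) (by simpa using h0.ne'))
      (ContinuousAt.log (by fun_prop) (by simp))
  simpa [ContinuousAt, logApprox] using h

end LogApprox

section LowerBound

variable (L : Kernel Γ Γ) [IsFiniteKernel L] (T : ℝ) {g : Bdd Γ} {μ : Measure Γ} {P : DensityFlux Γ}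
  {ε : ℝ}

lemma bke_mem (hg : ∀ x, g x ∈ Icc (0 : ℝ) 1) (t : ℝ) (x : Γ) : bke L T g t x ∈ Icc (0 : ℝ) 1 :=
  ⟨bke_nonneg L T (fun x => (hg x).1) t x, bke_le_one L T (fun x => (hg x).2) t x⟩

variable (g) in
/-- The regularized logarithm of the solution of the backward equation. -/
def logBke (hε : 0 < ε) (t : ℝ) : Bdd Γ := superpose _ (actsOnUnit_logApprox hε) (bke L T g t)

variable (g) in
/-- The time derivative of the regularized logarithm. -/
def logBkeDeriv (hε : 0 < ε) (t : ℝ) : Bdd Γ :=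
  superpose _ (actsOnUnit_inv_add hε) (bke L T g t) * -gen L (bke L T g t)

lemma logBke_apply (hg : ∀ x, g x ∈ Icc (0 : ℝ) 1) (hε : 0 < ε) (t : ℝ) (x : Γ) :
    logBke L T g hε t x = logApprox ε (bke L T g t x) := superpose_apply _ (bke_mem L T hg t x)

lemma Bdd.continuous_mul {u v : ℝ → Bdd Γ} (hu : Continuous u) (hv : Continuous v) :
    Continuous fun t => u t * v t :=
  ((Bdd.mulL Γ).continuous.comp hu).clm_apply hv

lemma continuous_logBke (hg : ∀ x, g x ∈ Icc (0 : ℝ) 1) (hε : 0 < ε) :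
    Continuous (logBke L T g hε) :=
  continuous_superpose _ (actsOnUnit_inv_add hε) (fun _ ha => hasDerivAt_logApprox hε ha)
    (continuous_bke L T g) (bke_mem L T hg)

lemma continuous_logBkeDeriv (hg : ∀ x, g x ∈ Icc (0 : ℝ) 1) (hε : 0 < ε) :
    Continuous (logBkeDeriv L T g hε) :=
  Bdd.continuous_mul
    (continuous_superpose _ (actsOnUnit_neg_inv_add_sq hε) (fun _ ha => hasDerivAt_inv_add hε ha)
      (continuous_bke L T g) (bke_mem L T hg))
    ((gen L).continuous.comp (continuous_bke L T g)).neg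

lemma hasDerivAt_logBke (hg : ∀ x, g x ∈ Icc (0 : ℝ) 1) (hε : 0 < ε) {t : ℝ} (ht : t < T) :
    HasDerivAt (logBke L T g hε) (logBkeDeriv L T g hε t) t :=
  hasDerivAt_superpose _ _ (actsOnUnit_neg_inv_add_sq hε) (fun _ ha => hasDerivAt_logApprox hε ha)
    (fun _ ha => hasDerivAt_inv_add hε ha) (hasDerivAt_bke L T g ht) (bke_mem L T hg)

lemma exp_dgrad_logBke (hg : ∀ x, g x ∈ Icc (0 : ℝ) 1) (hε : 0 < ε) (t : ℝ) (z : Γ × Γ) :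
    Real.exp (dgrad (logBke L T g hε t) z) =
      (bke L T g t z.2 + ε) / (bke L T g t z.1 + ε) := by
  have h1 := add_pos_of_mem hε (bke_mem L T hg t z.1)
  rw [dgrad, Real.exp_sub, logBke_apply L T hg, logBke_apply L T hg,
    exp_logApprox hε (bke_mem L T hg t _), exp_logApprox hε (bke_mem L T hg t _),
    div_div_div_cancel_right₀ (by positivity)]

/-- The generator kills constants, so h + ε is again a backward solution and its logarithm satisfies
the Hamilton-Jacobi equation exactly for each ε; no error term has to be controlled. -/
lemma logBkeDeriv_apply (hg : ∀ x, g x ∈ Icc (0 : ℝ) 1) (hε : 0 < ε) (t : ℝ) (x : Γ) :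
    logBkeDeriv L T g hε t x = -∫ y, (Real.exp (dgrad (logBke L T g hε t) (x, y)) - 1) ∂(L x) := by
  have h1 := add_pos_of_mem hε (bke_mem L T hg t x)
  rw [logBkeDeriv, Bdd.mul_apply, Bdd.neg_apply, superpose_apply _ (bke_mem L T hg t x), gen_apply',
    mul_neg, ← integral_const_mul]
  congr 2
  ext y
  rw [exp_dgrad_logBke L T hg hε]
  simp only [dgrad]
  field_simp
  ring

variable {L T}

/-- The time derivative is minus the Hamiltonian; integrated against p_r it supplies the exponential
term of the dual functional, and the continuity equation supplies the linear term. -/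
lemma IsAdmissible.integral_logBke_sub [IsProbabilityMeasure μ] (hP : IsAdmissible L T μ P)
    (hT : 0 ≤ T) (hg : ∀ x, g x ∈ Icc (0 : ℝ) 1) (hε : 0 < ε) :
    IntervalIntegrable
      (fun r => dualPairing (P.q r) ((P.p r : Measure Γ) ⊗ₘ L) (dgrad (logBke L T g hε r)))
      volume 0 T ∧
    ∫ x, logBke L T g hε T x ∂(P.p T : Measure Γ) - ∫ x, logBke L T g hε 0 x ∂μ =
      ∫ r in (0 : ℝ)..T,
        dualPairing (P.q r) ((P.p r : Measure Γ) ⊗ₘ L) (dgrad (logBke L T g hε r)) := by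
  have hc := continuous_logBke L T hg hε
  have hc' := continuous_logBkeDeriv L T hg hε
  have e : (fun r => dualPairing (P.q r) ((P.p r : Measure Γ) ⊗ₘ L) (dgrad (logBke L T g hε r))) =
      fun r => ∫ x, logBkeDeriv L T g hε r x ∂(P.p r : Measure Γ) +
        ∫ z, dgrad (logBke L T g hε r) z ∂(P.q r) := by
    ext r
    have hb : IsBddMeas fun z => Real.exp (dgrad (logBke L T g hε r) z) - 1 :=
      (logBke L T g hε r).isBddMeas.dgrad.exp.sub (IsBddMeas.const 1)
    rw [dualPairing, Measure.integral_compProd (hb.integrable _)]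
    simp only [logBkeDeriv_apply L T hg hε r, integral_neg]
    ring
  rw [e, ← hP.initial]
  exact ⟨(hP.intervalIntegrable_integral hc' le_rfl hT le_rfl).add
      (hP.intervalIntegrable_integral_dgrad hc le_rfl hT le_rfl),
    hP.integral_sub_integral hc hc' hT le_rfl fun t ht => hasDerivAt_logBke L T hg hε ht.2⟩

lemma ofReal_neg_logBke_terminal_le {f : Γ → ℝ≥0∞} (hgf : ∀ x, g x = expNeg f x)
    (hg : ∀ x, g x ∈ Icc (0 : ℝ) 1) (hε : 0 < ε) (x : Γ) :
    ENNReal.ofReal (-logBke L T g hε T x) ≤ f x := by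
  rw [logBke_apply L T hg, bke_terminal, hgf]
  by_cases h : f x = ⊤
  · rw [h]; exact le_top
  · have h1 : 0 < expNeg f x := by rw [expNeg_of_ne_top h]; exact Real.exp_pos _
    refine ENNReal.ofReal_le_of_le_toReal ?_
    have := log_le_logApprox hε h1 (expNeg_le_one f x)
    have e : Real.log (expNeg f x) = -(f x).toReal := by rw [expNeg_of_ne_top h, Real.log_exp]
    linarith

lemma IsAdmissible.lintegral_neg_logBke_le [IsProbabilityMeasure μ] (hP : IsAdmissible L T μ P)
    (hT : 0 ≤ T) {f : Γ → ℝ≥0∞} (hgf : ∀ x, g x = expNeg f x)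
    (hg : ∀ x, g x ∈ Icc (0 : ℝ) 1) (hε : 0 < ε) :
    ∫⁻ x, ENNReal.ofReal (-logBke L T g hε 0 x) ∂μ ≤ cost L T f P := by
  obtain ⟨hi, e⟩ := hP.integral_logBke_sub hT hg hε
  have hnp : ∀ t x, 0 ≤ -logBke L T g hε t x := fun t x => by
    rw [logBke_apply L T hg]
    exact neg_nonneg.2 (logApprox_nonpos hε (bke_mem L T hg t x))
  have hof : ∀ t (ν : Measure Γ) [IsFiniteMeasure ν],
      ∫⁻ x, ENNReal.ofReal (-logBke L T g hε t x) ∂ν =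
        ENNReal.ofReal (-∫ x, logBke L T g hε t x ∂ν) := fun t ν _ => by
    rw [← integral_neg]
    exact (ofReal_integral_eq_lintegral_ofReal ((logBke L T g hε t).integrable ν).neg
      (ae_of_all _ (hnp t))).symm
  rw [hof]
  have e' : -∫ x, logBke L T g hε 0 x ∂μ = -∫ x, logBke L T g hε T x ∂(P.p T : Measure Γ) +
      ∫ r in (0 : ℝ)..T,
        dualPairing (P.q r) ((P.p r : Measure Γ) ⊗ₘ L) (dgrad (logBke L T g hε r)) := by
    rw [← e]; ring
  rw [e']
  refine ENNReal.ofReal_add_le.trans (add_le_add ?_ ?_)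
  · rw [← hof]
    exact lintegral_mono (ofReal_neg_logBke_terminal_le hgf hg hε)
  · rw [intervalIntegral.integral_of_le hT, integral_Ioc_eq_integral_Ioo]
    refine (ofReal_integral_le_lintegral_ofReal _ _).trans (lintegral_mono fun t => ?_)
    have := P.finite_q t
    exact ofReal_dualPairing_le_klDiv (logBke L T g hε t).isBddMeas.dgrad

/-- The value is bounded below by the integral of `-log h₀`. -/
lemma IsAdmissible.lintegral_neg_log_bke_le [IsProbabilityMeasure μ] (hP : IsAdmissible L T μ P)
    (hT : 0 ≤ T) {f : Γ → ℝ≥0∞} (hgf : ∀ x, g x = expNeg f x)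
    (hg : ∀ x, g x ∈ Icc (0 : ℝ) 1) (hpos : ∀ x, 0 < bke L T g 0 x) :
    ∫⁻ x, ENNReal.ofReal (-Real.log (bke L T g 0 x)) ∂μ ≤ cost L T f P := by
  have hε : ∀ n : ℕ, (0 : ℝ) < 1 / ((n : ℝ) + 1) := fun n => by positivity
  have hlim : ∀ x, Tendsto (fun n : ℕ => ENNReal.ofReal (-logBke L T g (hε n) 0 x)) atTop
      (𝓝 (ENNReal.ofReal (-Real.log (bke L T g 0 x)))) := fun x => by
    simp only [logBke_apply L T hg]
    exact ENNReal.tendsto_ofReal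
      ((tendsto_logApprox (hpos x)).comp tendsto_one_div_add_atTop_nhds_zero_nat).neg
  -- Fatou is used because log h₀ is not assumed integrable here, and the value may be infinite.
  calc ∫⁻ x, ENNReal.ofReal (-Real.log (bke L T g 0 x)) ∂μ
      = ∫⁻ x, liminf (fun n : ℕ => ENNReal.ofReal (-logBke L T g (hε n) 0 x)) atTop ∂μ := by
        simp only [fun x => (hlim x).liminf_eq]
    _ ≤ liminf (fun n : ℕ => ∫⁻ x, ENNReal.ofReal (-logBke L T g (hε n) 0 x) ∂μ) atTop :=
        lintegral_liminf_le fun n => (logBke L T g (hε n) 0).measurable.neg.ennreal_ofReal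
    _ ≤ cost L T f P := by
        refine (liminf_le_liminf (Eventually.of_forall fun n =>
          hP.lintegral_neg_logBke_le hT hgf hg (hε n))).trans_eq ?_
        simp

end LowerBound

end JumpControl
end

/-! ### The jump-count estimate and the laws of the jump process. -/

noncomputable section

namespace JumpControl

variable {Γ : Type*} [MeasurableSpace Γ]

section EntropyBound

variable (L : Kernel Γ Γ) [IsFiniteKernel L]

lemma posOp_pow_le {g : Bdd Γ} (hg : ∀ x, g x ≤ 1) (n : ℕ) (x : Γ) :
    (posOp L ^ n) g x ≤ rateBound L ^ n := by
  have h := posOp_pow_nonneg L (u := 1 - g) (fun x => sub_nonneg.2 (hg x)) n x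
  rw [map_sub, posOp_pow_one, Bdd.sub_apply, Bdd.smul_apply, Bdd.one_apply, mul_one] at h
  linarith

/-- The expected number of jumps of the conditioned process is controlled by the logarithm of
the normalizing factor. -/
lemma exists_posOp_semi_le (T : ℝ) (hT : 0 ≤ T) {g : Bdd Γ} (hg : ∀ x, g x ∈ Icc (0 : ℝ) 1) :
    ∃ C : ℝ, ∀ x, 0 < semi L T g x →
      T * posOp L (semi L T g) x ≤ semi L T g x * (-Real.log (semi L T g x) + C) := by
  have hE : 0 < Real.exp (-(rateBound L * T)) := Real.exp_pos _
  -- Poisson weights of parameter RT, tilted by eⁿ; their sum is the exponential moment of the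
  -- number of jumps.
  set π : ℕ → ℝ := fun n => Real.exp (-(rateBound L * T)) *
    ((rateBound L * T * Real.exp 1) ^ n / n.factorial) with hπ
  have hπs : Summable π := (Real.summable_pow_div_factorial _).mul_left _
  refine ⟨∑' n, π n, fun x hpos => ?_⟩
  set h := semi L T g x with hh
  set a : ℕ → ℝ := fun n => Real.exp (-(rateBound L * T)) * (T ^ n / n.factorial) *
    (posOp L ^ n) g x with ha
  have hsa : HasSum a h := hasSum_semi L T g x
  have ha0 : ∀ n, 0 ≤ a n := fun n =>
    mul_nonneg (by positivity) (posOp_pow_nonneg L (fun x => (hg x).1) n x)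
  have haπ : ∀ n, a n * Real.exp n ≤ π n := by
    intro n
    have h1 := posOp_pow_le L (fun x => (hg x).2) n x
    have e : π n = Real.exp (-(rateBound L * T)) * (T ^ n / n.factorial) * rateBound L ^ n *
        Real.exp n := by
      simp only [hπ]
      rw [mul_pow, mul_pow, ← Real.exp_nat_mul, mul_one]
      ring
    rw [e]
    refine mul_le_mul_of_nonneg_right ?_ (Real.exp_pos _).le
    exact mul_le_mul_of_nonneg_left h1 (by positivity)
  have hb : HasSum (fun n : ℕ => n * a n) (T * posOp L (semi L T g) x) := by
    have h1 := (hasSum_semi L T (posOp L g) x).mul_left T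
    rw [semi_comm_posOp] at h1
    rw [← hasSum_nat_add_iff' 1]
    simp only [Finset.range_one, Finset.sum_singleton, Nat.cast_zero, zero_mul, sub_zero]
    refine HasSum.congr_fun h1 fun n => ?_
    simp only [ha]
    rw [pow_succ (posOp L) n, mul_apply_eq_comp, Nat.factorial_succ]
    have : (n.factorial : ℝ) ≠ 0 := by positivity
    push_cast
    field_simp
    ring
  have hc : HasSum (fun n => a n * -Real.log h + h * π n) (h * -Real.log h + h * ∑' n, π n) :=
    (hsa.mul_right _).add (hπs.hasSum.mul_left h)
  rw [mul_add]
  refine hasSum_le (fun n => ?_) hb hc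
  -- From 1 + x ≤ e^x at x = n + log h. Multiplied by a n and combined with a n eⁿ ≤ π n, it gives n
  -- a n ≤ -a n log h + h π n, which is then summed.
  have h1 : (n : ℝ) + Real.log h ≤ h * Real.exp n := by
    have := Real.add_one_le_exp ((n : ℝ) + Real.log h)
    rw [Real.exp_add, Real.exp_log hpos] at this
    linarith
  have h2 := mul_le_mul_of_nonneg_left h1 (ha0 n)
  have h3 := mul_le_mul_of_nonneg_left (haπ n) hpos.le
  nlinarith

end EntropyBound

section Measures

variable (L : Kernel Γ Γ) [IsFiniteKernel L]

/-- The measures `ν (gen L + rateBound L)ⁿ`. -/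
def iterMeasure (ν : Measure Γ) : ℕ → Measure Γ
  | 0 => ν
  | n + 1 => (iterMeasure ν n).bind L + (iterMeasure ν n).withDensity
      (fun x => ENNReal.ofReal (rateBound L - (L x).real univ))

lemma lintegral_iterMeasure (ν : Measure Γ) (n : ℕ) (φ : Bdd Γ) (hφ : ∀ x, 0 ≤ φ x) :
    ∫⁻ x, ENNReal.ofReal (φ x) ∂(iterMeasure L ν n) =
      ∫⁻ x, ENNReal.ofReal ((posOp L ^ n) φ x) ∂ν := by
  induction n generalizing φ with
  | zero => rfl
  | succ n ih =>
    have hm : Measurable fun x => ENNReal.ofReal (rateBound L - (L x).real univ) := by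
      have := (L.measurable_coe MeasurableSet.univ).ennreal_toReal
      exact (measurable_const.sub this).ennreal_ofReal
    rw [iterMeasure, lintegral_add_measure,
      Measure.lintegral_bind L.measurable.aemeasurable φ.measurable.ennreal_ofReal.aemeasurable,
      lintegral_withDensity_eq_lintegral_mul _ hm φ.measurable.ennreal_ofReal,
      ← lintegral_add_right _ (hm.mul φ.measurable.ennreal_ofReal), pow_succ]
    simp only [mul_apply_eq_comp]
    rw [← ih (posOp L φ) (posOp_nonneg L hφ)]
    refine lintegral_congr fun x => ?_
    have h1 : 0 ≤ rateBound L - (L x).real univ := sub_nonneg.2 (real_univ_le_rateBound L x)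
    rw [posOp_apply, ENNReal.ofReal_add (integral_nonneg hφ) (mul_nonneg h1 (hφ x)),
      ofReal_integral_eq_lintegral_ofReal (φ.integrable _) (ae_of_all _ hφ),
      ENNReal.ofReal_mul h1]
    rfl

/-- The law at time `t` of the jump process started from the measure `ν`. -/
def semiMeasure (ν : Measure Γ) (t : ℝ) : Measure Γ :=
  Measure.sum fun n => ENNReal.ofReal (Real.exp (-(rateBound L * t)) * (t ^ n / n.factorial)) •
    iterMeasure L ν n

/-- Duality with the semigroup, in terms of integrals with values in [0, ∞]: it is applied to the
initial measure μ/h₀, which need not be finite. -/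
lemma lintegral_semiMeasure (ν : Measure Γ) {t : ℝ} (ht : 0 ≤ t) (φ : Bdd Γ) (hφ : ∀ x, 0 ≤ φ x) :
    ∫⁻ x, ENNReal.ofReal (φ x) ∂(semiMeasure L ν t) =
      ∫⁻ x, ENNReal.ofReal (semi L t φ x) ∂ν := by
  have hw : ∀ n : ℕ, 0 ≤ Real.exp (-(rateBound L * t)) * (t ^ n / n.factorial) := fun n => by
    positivity
  rw [semiMeasure, lintegral_sum_measure]
  simp only [lintegral_smul_measure, smul_eq_mul, lintegral_iterMeasure L ν _ φ hφ]
  have e : ∀ x, ENNReal.ofReal (semi L t φ x) =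
      ∑' n : ℕ, ENNReal.ofReal (Real.exp (-(rateBound L * t)) * (t ^ n / n.factorial)) *
        ENNReal.ofReal ((posOp L ^ n) φ x) := by
    intro x
    have hs := hasSum_semi L t φ x
    rw [← hs.tsum_eq, ENNReal.ofReal_tsum_of_nonneg (fun n =>
      mul_nonneg (hw n) (posOp_pow_nonneg L hφ n x)) hs.summable]
    exact tsum_congr fun n => ENNReal.ofReal_mul (hw n)
  simp only [e]
  rw [lintegral_tsum fun n => (((posOp L ^ n) φ).measurable.ennreal_ofReal.const_mul _).aemeasurable]
  refine tsum_congr fun n => ?_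
  rw [lintegral_const_mul _ ((posOp L ^ n) φ).measurable.ennreal_ofReal]

/-- A finite measure given on nonnegative functions by a density functional is given by it on all
bounded functions. -/
lemma integral_eq_of_lintegral_eq {X : Type*} [MeasurableSpace X] {α : Measure X}
    [IsFiniteMeasure α] {μ : Measure Γ} (Λ : Bdd X →ₗ[ℝ] (Γ → ℝ)) (hm : ∀ φ, Measurable (Λ φ))
    (hn : ∀ φ : Bdd X, (∀ z, 0 ≤ φ z) → ∀ x, 0 ≤ Λ φ x)
    (h : ∀ φ : Bdd X, (∀ z, 0 ≤ φ z) →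
      ∫⁻ z, ENNReal.ofReal (φ z) ∂α = ∫⁻ x, ENNReal.ofReal (Λ φ x) ∂μ) (φ : Bdd X) :
    Integrable (Λ φ) μ ∧ ∫ z, φ z ∂α = ∫ x, Λ φ x ∂μ := by
  have key : ∀ φ : Bdd X, (∀ z, 0 ≤ φ z) → Integrable (Λ φ) μ ∧ ∫ z, φ z ∂α = ∫ x, Λ φ x ∂μ := by
    intro φ hφ
    have hfin : ∫⁻ x, ENNReal.ofReal (Λ φ x) ∂μ ≠ ⊤ := by
      rw [← h φ hφ, ← ofReal_integral_eq_lintegral_ofReal (φ.integrable α) (ae_of_all _ hφ)]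
      exact ENNReal.ofReal_ne_top
    refine ⟨(lintegral_ofReal_ne_top_iff_integrable (hm φ).aestronglyMeasurable
      (ae_of_all _ (hn φ hφ))).1 hfin, ?_⟩
    rw [integral_eq_lintegral_of_nonneg_ae (ae_of_all _ hφ) φ.measurable.aestronglyMeasurable, h φ hφ,
      integral_eq_lintegral_of_nonneg_ae (ae_of_all _ (hn φ hφ)) (hm φ).aestronglyMeasurable]
  have h1 := key (φ + ‖φ‖ • 1) fun z => by
    have := neg_le_of_abs_le (φ.abs_apply_le z)
    simp only [Bdd.add_apply, Bdd.smul_apply, Bdd.one_apply, mul_one]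
    linarith
  have h2 := key (‖φ‖ • 1) fun z => by simp
  have e : φ = (φ + ‖φ‖ • 1) - ‖φ‖ • 1 := by abel
  have e1 : Λ φ = Λ (φ + ‖φ‖ • 1) - Λ (‖φ‖ • 1) := by rw [← map_sub, ← e]
  have e2 : ∫ z, φ z ∂α = ∫ z, (φ + ‖φ‖ • 1) z ∂α - ∫ z, (‖φ‖ • (1 : Bdd X)) z ∂α := by
    rw [← integral_sub ((φ + ‖φ‖ • 1).integrable α) ((‖φ‖ • (1 : Bdd X)).integrable α)]
    congr 1
    ext z
    simp
  refine ⟨by rw [e1]; exact h1.1.sub h2.1, ?_⟩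
  rw [e2, h1.2, h2.2, e1, ← integral_sub h1.1 h2.1]
  rfl

end Measures

end JumpControl
end

/-! ### The Doob transform: marginals and flux. -/

noncomputable section

namespace JumpControl

variable {Γ : Type*} [MeasurableSpace Γ]


section WeightedIntegral

variable {μ : Measure Γ} {T : ℝ} {U V : ℝ → Bdd Γ} {w D : Γ → ℝ}

lemma continuousOn_integral_mul (hw : Measurable w) (hV : Continuous V) (hD : Integrable D μ)
    (hb : ∀ t ∈ Icc 0 T, ∀ x, |V t x * w x| ≤ D x) :
    ContinuousOn (fun t => ∫ x, V t x * w x ∂μ) (Icc 0 T) := by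
  refine continuousOn_of_dominated (bound := D)
    (fun t _ => ((V t).measurable.mul hw).aestronglyMeasurable)
    (fun t ht => ae_of_all _ (hb t ht)) hD (ae_of_all _ fun x => ?_)
  exact ((continuous_eval hV x).mul_const _).continuousOn

lemma integrable_mul_of_abs_le (hw : Measurable w) (hD : Integrable D μ) {u : Bdd Γ}
    (hb : ∀ x, |u x * w x| ≤ D x) : Integrable (fun x => u x * w x) μ :=
  hD.mono' (u.measurable.mul hw).aestronglyMeasurable (ae_of_all _ hb)

/-- The weight w (later 1/h₀) is unbounded, so the fundamental theorem cannot be applied in `Bdd Γ`.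
It is applied pointwise, and Fubini follows from the dominating function D. -/
lemma integral_mul_sub_integral_mul [SFinite μ] (hw : Measurable w) (hU : Continuous U)
    (hV : Continuous V) (hd : ∀ t ∈ Ioo 0 T, HasDerivAt U (V t) t) (hD : Integrable D μ)
    (hb : ∀ t ∈ Icc 0 T, ∀ x, |V t x * w x| ≤ D x)
    (hi : ∀ t ∈ Icc 0 T, Integrable (fun x => U t x * w x) μ) {s t : ℝ} (hs : 0 ≤ s) (hst : s ≤ t)
    (ht : t ≤ T) :
    ∫ x, U t x * w x ∂μ - ∫ x, U s x * w x ∂μ = ∫ r in s..t, ∫ x, V r x * w x ∂μ := by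
  have hpt : ∀ x, U t x * w x - U s x * w x = ∫ r in s..t, V r x * w x := by
    intro x
    rw [intervalIntegral.integral_mul_const,
      intervalIntegral.integral_eq_sub_of_hasDerivAt_of_le (f := fun r => U r x) hst
        (continuous_eval hU x).continuousOn
        (fun r hr => hasDerivAt_eval (hd r ⟨hs.trans_lt hr.1, hr.2.trans_le ht⟩) x)
        ((continuous_eval hV x).intervalIntegrable _ _)]
    ring
  rw [← integral_sub (hi t ⟨hs.trans hst, ht⟩) (hi s ⟨hs, hst.trans ht⟩)]
  simp only [hpt, intervalIntegral.integral_of_le hst]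
  refine integral_integral_swap ?_
  have hm : Measurable (Function.uncurry fun (x : Γ) (r : ℝ) => V r x * w x) := by
    have : Measurable (Function.uncurry fun (r : ℝ) (x : Γ) => V r x * w x) :=
      measurable_uncurry_of_continuous_of_measurable
        (fun x => (continuous_eval hV x).mul_const _) (fun r => (V r).measurable.mul hw)
    exact this.comp measurable_swap
  have hDp : Integrable (fun z : Γ × ℝ => D z.1) (μ.prod (volume.restrict (Ioc s t))) :=
    hD.comp_fst _
  refine hDp.mono' hm.aestronglyMeasurable ?_
  have : ∀ᵐ z ∂(μ.prod (volume.restrict (Ioc s t))), z.2 ∈ Ioc s t := by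
    have h := (ae_restrict_mem (μ := (volume : Measure ℝ)) (measurableSet_Ioc (a := s) (b := t)))
    exact Measure.quasiMeasurePreserving_snd.ae h
  filter_upwards [this] with z hz
  exact hb z.2 ⟨hs.trans hz.1.le, hz.2.trans ht⟩ z.1

end WeightedIntegral

section Transform

set_option linter.unusedSectionVars false

/-- The data of a Doob transform by the backward solution with terminal value `g`. -/
structure IsDoobTransform (L : Kernel Γ Γ) [IsFiniteKernel L] (T : ℝ) (g : Bdd Γ) (μ : Measure Γ) :
    Prop where
  time_pos : 0 < T
  mem : ∀ x, g x ∈ Icc (0 : ℝ) 1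
  pos : ∀ t ∈ Ico 0 T, ∀ x, 0 < bke L T g t x
  integrable_log : Integrable (fun x => Real.log (bke L T g 0 x)) μ

variable (L : Kernel Γ Γ) [IsFiniteKernel L] (T : ℝ) (g : Bdd Γ) (μ : Measure Γ)

/-- The law of the jump process at time `t`, from the initial density `1 / h₀`. -/
def baseLaw (t : ℝ) : Measure Γ :=
  semiMeasure L (μ.withDensity fun x => ENNReal.ofReal (bke L T g 0 x)⁻¹) t

/-- The marginal law at time `t` of the Doob transform. -/
def condLaw (t : ℝ) : Measure Γ :=
  (baseLaw L T g μ t).withDensity fun x => ENNReal.ofReal (bke L T g t x)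

/-- The jump flux at time `t` of the Doob transform. -/
def condFlux (t : ℝ) : Measure (Γ × Γ) :=
  expFlux L (fun x => Real.log (bke L T g t x)) (condLaw L T g μ t)

/-- The integrable bound for time derivatives along the Doob transform. -/
def jumpBound (x : Γ) : ℝ := posOp L (bke L T g 0) x * (bke L T g 0 x)⁻¹ + 1

variable {L T g μ}

lemma semi_bke {t : ℝ} (ht : t ∈ Icc 0 T) : semi L t (bke L T g t) = bke L T g 0 := by
  rw [bke_of_le L T g ht.2, bke_of_le L T g (ht.1.trans ht.2), ← mul_apply_eq_comp, ← semi_add]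
  congr 2; ring

/-- The positive shift dominates the kernel operator and commutes with the semigroup, and `semi L t`
maps h_t to h₀. This gives a bound of the jump flux independent of time. -/
lemma semi_kerOp_bke_le (hg : ∀ x, g x ∈ Icc (0 : ℝ) 1) {t : ℝ} (ht : t ∈ Icc 0 T) (x : Γ) :
    semi L t (kerOp L (bke L T g t)) x ≤ posOp L (bke L T g 0) x := by
  rw [← semi_bke ht, ← semi_comm_posOp]
  refine semi_mono L ht.1 (fun x => ?_) x
  rw [kerOp_apply, posOp_apply]
  exact le_add_of_nonneg_right (mul_nonneg (sub_nonneg.2 (real_univ_le_rateBound L x))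
    (bke_mem L T hg t x).1)

lemma jumpOp_nonneg {χ : Γ × Γ → ℝ} (hχ : IsBddMeas χ) (h0 : ∀ z, 0 ≤ χ z) {u : Bdd Γ}
    (hu : ∀ x, 0 ≤ u x) (x : Γ) : 0 ≤ jumpOp L χ hχ u x :=
  integral_nonneg fun y => mul_nonneg (hu y) (h0 (x, y))

lemma abs_jumpOp_le {χ : Γ × Γ → ℝ} (hχ : IsBddMeas χ) {C : ℝ} (hC : ∀ z, |χ z| ≤ C) {u : Bdd Γ}
    (hu : ∀ x, 0 ≤ u x) (x : Γ) : |jumpOp L χ hχ u x| ≤ C * kerOp L u x := by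
  rw [jumpOp_apply, kerOp_apply, ← integral_const_mul]
  refine norm_integral_le_of_norm_le (f := fun y => u y * χ (x, y)) ((u.integrable _).const_mul C)
    (ae_of_all _ fun y => ?_)
  rw [Real.norm_eq_abs, abs_mul, abs_of_nonneg (hu y), mul_comm]
  exact mul_le_mul_of_nonneg_right (hC _) (hu y)

lemma abs_semi_le {t : ℝ} (ht : 0 ≤ t) {u v : Bdd Γ} (h : ∀ x, |u x| ≤ v x) (x : Γ) :
    |semi L t u x| ≤ semi L t v x := by
  refine abs_le.2 ⟨?_, semi_mono L ht (fun x => (le_abs_self _).trans (h x)) x⟩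
  have := semi_mono L ht (u := -v) (v := u) (fun x => neg_le_of_abs_le (h x)) x
  rwa [map_neg, Bdd.neg_apply] at this

namespace IsDoobTransform

lemma zero_mem (H : IsDoobTransform L T g μ) : (0 : ℝ) ∈ Ico 0 T := ⟨le_rfl, H.time_pos⟩

lemma measurable_inv (L : Kernel Γ Γ) [IsFiniteKernel L] (T : ℝ) (g : Bdd Γ) :
    Measurable fun x => (bke L T g 0 x)⁻¹ := (bke L T g 0).measurable.inv

/-- The jump-count estimate divided by T h₀ bounds Ah₀/h₀ by (-log h₀ + C)/T. Here the integrability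
of ψ₀ enters. -/
lemma integrable_jumpBound [IsProbabilityMeasure μ] (H : IsDoobTransform L T g μ) :
    Integrable (jumpBound L T g) μ := by
  refine Integrable.add ?_ (integrable_const 1)
  obtain ⟨C, hC⟩ := exists_posOp_semi_le L T H.time_pos.le H.mem
  have e : bke L T g 0 = semi L T g := by rw [bke_of_le L T g H.time_pos.le, sub_zero]
  rw [← e] at hC
  refine Integrable.mono' ((H.integrable_log.neg.add (integrable_const C)).const_mul T⁻¹)
    ((posOp L _).measurable.mul (measurable_inv L T g)).aestronglyMeasurable
    (ae_of_all _ fun x => ?_)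
  have hp := H.pos 0 H.zero_mem x
  have h0 : 0 ≤ posOp L (bke L T g 0) x := posOp_nonneg L (fun x => (bke_mem L T H.mem 0 x).1) x
  rw [Real.norm_eq_abs, abs_of_nonneg (mul_nonneg h0 (inv_nonneg.2 hp.le)), ← div_eq_mul_inv,
    div_le_iff₀ hp, mul_comm T⁻¹, mul_assoc, mul_comm T⁻¹, ← mul_assoc, ← div_eq_mul_inv,
    le_div_iff₀ H.time_pos]
  have := hC x hp
  simp only [Pi.add_apply, Pi.neg_apply]
  linarith

lemma abs_mul_inv_le (H : IsDoobTransform L T g μ) {C : ℝ} {u : Bdd Γ} {x : Γ}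
    (hu : |u x| ≤ C * (posOp L (bke L T g 0) x + bke L T g 0 x)) :
    |u x * (bke L T g 0 x)⁻¹| ≤ C * jumpBound L T g x := by
  have hp := H.pos 0 H.zero_mem x
  rw [abs_mul, abs_of_pos (inv_pos.2 hp)]
  refine (mul_le_mul_of_nonneg_right hu (inv_pos.2 hp).le).trans_eq ?_
  rw [jumpBound]
  field_simp

lemma abs_semi_jumpOp_le (H : IsDoobTransform L T g μ) {χ : Γ × Γ → ℝ} (hχ : IsBddMeas χ) {C : ℝ}
    (hC0 : 0 ≤ C) (hC : ∀ z, |χ z| ≤ C) {t : ℝ} (ht : t ∈ Icc 0 T) (x : Γ) :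
    |semi L t (jumpOp L χ hχ (bke L T g t)) x * (bke L T g 0 x)⁻¹| ≤ C * jumpBound L T g x := by
  refine H.abs_mul_inv_le ?_
  have h1 := abs_semi_le (L := L) ht.1 (v := C • kerOp L (bke L T g t))
    (abs_jumpOp_le (L := L) hχ hC fun x => (bke_mem L T H.mem t x).1) x
  rw [map_smul, Bdd.smul_apply] at h1
  refine h1.trans (mul_le_mul_of_nonneg_left ?_ hC0)
  linarith [semi_kerOp_bke_le (L := L) H.mem ht x, (bke_mem L T H.mem 0 x).1]

lemma abs_semi_mul_le (H : IsDoobTransform L T g μ) (φ : Bdd Γ) {t : ℝ} (ht : t ∈ Icc 0 T) (x : Γ) :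
    |semi L t (bke L T g t * φ) x * (bke L T g 0 x)⁻¹| ≤ ‖φ‖ := by
  have hp := H.pos 0 H.zero_mem x
  have h1 := abs_semi_le (L := L) ht.1 (u := bke L T g t * φ) (v := ‖φ‖ • bke L T g t)
    (fun x => by
      rw [Bdd.mul_apply, Bdd.smul_apply, abs_mul, abs_of_nonneg (bke_mem L T H.mem t x).1, mul_comm]
      exact mul_le_mul_of_nonneg_right (φ.abs_apply_le x) (bke_mem L T H.mem t x).1) x
  rw [map_smul, Bdd.smul_apply, semi_bke ht] at h1
  rw [abs_mul, abs_of_pos (inv_pos.2 hp), ← div_eq_mul_inv, div_le_iff₀ hp]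
  exact h1

lemma lintegral_baseLaw {t : ℝ} (ht : 0 ≤ t) {φ : Bdd Γ}
    (hφ : ∀ x, 0 ≤ φ x) :
    ∫⁻ x, ENNReal.ofReal (φ x) ∂(baseLaw L T g μ t) =
      ∫⁻ x, ENNReal.ofReal (semi L t φ x * (bke L T g 0 x)⁻¹) ∂μ := by
  rw [baseLaw, lintegral_semiMeasure L _ ht φ hφ, lintegral_withDensity_eq_lintegral_mul _
    (measurable_inv L T g).ennreal_ofReal (semi L t φ).measurable.ennreal_ofReal]
  refine lintegral_congr fun x => ?_
  rw [ENNReal.ofReal_mul (semi_nonneg L ht hφ x), mul_comm]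
  rfl

lemma lintegral_condLaw (H : IsDoobTransform L T g μ) {t : ℝ} (ht : t ∈ Icc 0 T) {φ : Bdd Γ}
    (hφ : ∀ x, 0 ≤ φ x) :
    ∫⁻ x, ENNReal.ofReal (φ x) ∂(condLaw L T g μ t) =
      ∫⁻ x, ENNReal.ofReal (semi L t (bke L T g t * φ) x * (bke L T g 0 x)⁻¹) ∂μ := by
  rw [condLaw, lintegral_withDensity_eq_lintegral_mul _ (bke L T g t).measurable.ennreal_ofReal
    φ.measurable.ennreal_ofReal, ← lintegral_baseLaw ht.1 fun x =>
      mul_nonneg (bke_mem L T H.mem t x).1 (hφ x)]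
  refine lintegral_congr fun x => ?_
  rw [Bdd.mul_apply, ENNReal.ofReal_mul (bke_mem L T H.mem t x).1]
  rfl

lemma isProbabilityMeasure_condLaw [IsProbabilityMeasure μ] (H : IsDoobTransform L T g μ) {t : ℝ}
    (ht : t ∈ Icc 0 T) : IsProbabilityMeasure (condLaw L T g μ t) := by
  refine ⟨?_⟩
  have h := H.lintegral_condLaw ht (φ := 1) fun _ => zero_le_one
  have e : bke L T g t * 1 = bke L T g t := by ext x; simp
  simp only [e, semi_bke ht, Bdd.one_apply, ENNReal.ofReal_one, lintegral_one] at h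
  rw [h]
  simp [fun x => mul_inv_cancel₀ (H.pos 0 H.zero_mem x).ne']

lemma integral_condLaw [IsProbabilityMeasure μ] (H : IsDoobTransform L T g μ) {t : ℝ}
    (ht : t ∈ Icc 0 T) (φ : Bdd Γ) :
    Integrable (fun x => semi L t (bke L T g t * φ) x * (bke L T g 0 x)⁻¹) μ ∧
    ∫ x, φ x ∂(condLaw L T g μ t) =
      ∫ x, semi L t (bke L T g t * φ) x * (bke L T g 0 x)⁻¹ ∂μ := by
  have := H.isProbabilityMeasure_condLaw ht
  have hinv : ∀ x, 0 ≤ (bke L T g 0 x)⁻¹ := fun x => inv_nonneg.2 (bke_mem L T H.mem 0 x).1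
  exact integral_eq_of_lintegral_eq (α := condLaw L T g μ t)
    { toFun := fun (φ : Bdd Γ) x => semi L t (bke L T g t * φ) x * (bke L T g 0 x)⁻¹
      map_add' := fun φ χ => by
        ext x
        have e : bke L T g t * (φ + χ) = bke L T g t * φ + bke L T g t * χ :=
          map_add (Bdd.mulL Γ (bke L T g t)) φ χ
        simp only [e, map_add, Bdd.add_apply, Pi.add_apply, add_mul]
      map_smul' := fun a φ => by
        ext x
        have e : bke L T g t * (a • φ) = a • (bke L T g t * φ) :=
          map_smul (Bdd.mulL Γ (bke L T g t)) a φ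
        simp only [e, map_smul, Bdd.smul_apply, Pi.smul_apply, smul_eq_mul, RingHom.id_apply,
          mul_assoc] }
    (fun φ => (semi L t _).measurable.mul (measurable_inv L T g))
    (fun φ hφ x => mul_nonneg (semi_nonneg L ht.1
      (fun x => mul_nonneg (bke_mem L T H.mem t x).1 (hφ x)) x) (hinv x))
    (fun φ hφ => H.lintegral_condLaw ht hφ) φ

lemma lintegral_condLaw_compProd [IsProbabilityMeasure μ] (H : IsDoobTransform L T g μ) {t : ℝ}
    (ht : t ∈ Icc 0 T) {F : Γ × Γ → ℝ≥0∞} (hF : Measurable F) :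
    ∫⁻ z, F z ∂(condLaw L T g μ t ⊗ₘ L) =
      ∫⁻ x, ∫⁻ y, ENNReal.ofReal (bke L T g t x) * F (x, y) ∂(L x) ∂(baseLaw L T g μ t) := by
  have := H.isProbabilityMeasure_condLaw ht
  rw [Measure.lintegral_compProd hF, condLaw, lintegral_withDensity_eq_lintegral_mul _
    (bke L T g t).measurable.ennreal_ofReal hF.lintegral_kernel_prod_right']
  refine lintegral_congr fun x => ?_
  exact (lintegral_const_mul _ (hF.comp measurable_prodMk_left)).symm

lemma measurable_exp_dgrad (t : ℝ) :
    Measurable fun z => Real.exp (dgrad (fun x => Real.log (bke L T g t x)) z) := by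
  have h := Real.measurable_log.comp (bke L T g t).measurable
  exact ((h.comp measurable_snd).sub (h.comp measurable_fst)).exp

lemma exp_dgrad_log (H : IsDoobTransform L T g μ) {t : ℝ} (ht : t ∈ Ico 0 T) (z : Γ × Γ) :
    Real.exp (dgrad (fun x => Real.log (bke L T g t x)) z) =
      bke L T g t z.2 / bke L T g t z.1 := by
  rw [dgrad, Real.exp_sub, Real.exp_log (H.pos t ht _), Real.exp_log (H.pos t ht _)]

/-- The density h_t(x) of the marginal cancels the denominator of exp(∇log h_t) = h_t(y)/h_t(x). The
flux is then expressed by the semigroup without division by h_t, and the formula extends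
continuously up to t = T. -/
lemma lintegral_condFlux [IsProbabilityMeasure μ] (H : IsDoobTransform L T g μ) {t : ℝ}
    (ht : t ∈ Ico 0 T) {χ : Γ × Γ → ℝ} (hχ : IsBddMeas χ) (h0 : ∀ z, 0 ≤ χ z) :
    ∫⁻ z, ENNReal.ofReal (χ z) ∂(condFlux L T g μ t) =
      ∫⁻ x, ENNReal.ofReal (semi L t (jumpOp L χ hχ (bke L T g t)) x * (bke L T g 0 x)⁻¹) ∂μ := by
  have hn : ∀ x, 0 ≤ bke L T g t x := fun x => (bke_mem L T H.mem t x).1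
  have hm : Measurable fun z => ENNReal.ofReal
      (Real.exp (dgrad (fun x => Real.log (bke L T g t x)) z)) :=
    (measurable_exp_dgrad t).ennreal_ofReal
  rw [condFlux, expFlux, lintegral_withDensity_eq_lintegral_mul _ hm hχ.1.ennreal_ofReal,
    H.lintegral_condLaw_compProd ⟨ht.1, ht.2.le⟩ (hm.mul hχ.1.ennreal_ofReal),
    ← lintegral_baseLaw ht.1 (jumpOp_nonneg hχ h0 hn)]
  refine lintegral_congr fun x => ?_
  rw [jumpOp_apply, ofReal_integral_eq_lintegral_ofReal
    ((((bke L T g t).isBddMeas.mul (hχ.comp measurable_prodMk_left))).integrable _)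
    (ae_of_all _ fun y => mul_nonneg (hn y) (h0 (x, y)))]
  refine lintegral_congr fun y => ?_
  have hp := H.pos t ht x
  rw [Pi.mul_apply, H.exp_dgrad_log ht, ← ENNReal.ofReal_mul (div_nonneg (hn _) (hn _)),
    ← ENNReal.ofReal_mul (hn _)]
  congr 1
  field_simp

lemma condFlux_univ_le [IsProbabilityMeasure μ] (H : IsDoobTransform L T g μ) {t : ℝ}
    (ht : t ∈ Ico 0 T) :
    condFlux L T g μ t univ ≤ ENNReal.ofReal (∫ x, jumpBound L T g x ∂μ) := by
  have h := H.lintegral_condFlux ht (χ := fun _ => 1) (IsBddMeas.const 1) fun _ => zero_le_one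
  simp only [ENNReal.ofReal_one, lintegral_one] at h
  have hb : ∀ x, |semi L t (jumpOp L (fun _ => 1) (IsBddMeas.const 1) (bke L T g t)) x *
      (bke L T g 0 x)⁻¹| ≤ jumpBound L T g x := fun x => by
    have := H.abs_semi_jumpOp_le (IsBddMeas.const (1 : ℝ)) zero_le_one (fun _ => abs_one.le)
      ⟨ht.1, ht.2.le⟩ x
    rwa [one_mul] at this
  rw [h, ofReal_integral_eq_lintegral_ofReal H.integrable_jumpBound
    (ae_of_all _ fun x => (abs_nonneg _).trans (hb x))]
  exact lintegral_mono fun x => ENNReal.ofReal_le_ofReal ((le_abs_self _).trans (hb x))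

lemma isFiniteMeasure_condFlux [IsProbabilityMeasure μ] (H : IsDoobTransform L T g μ) {t : ℝ}
    (ht : t ∈ Ico 0 T) : IsFiniteMeasure (condFlux L T g μ t) :=
  ⟨(H.condFlux_univ_le ht).trans_lt ENNReal.ofReal_lt_top⟩

lemma integral_condFlux [IsProbabilityMeasure μ] (H : IsDoobTransform L T g μ) {t : ℝ}
    (ht : t ∈ Ico 0 T) {χ : Γ × Γ → ℝ} (hχ : IsBddMeas χ) :
    ∫ z, χ z ∂(condFlux L T g μ t) =
      ∫ x, semi L t (jumpOp L χ hχ (bke L T g t)) x * (bke L T g 0 x)⁻¹ ∂μ := by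
  have := H.isFiniteMeasure_condFlux ht
  have hinv : ∀ x, 0 ≤ (bke L T g 0 x)⁻¹ := fun x => inv_nonneg.2 (bke_mem L T H.mem 0 x).1
  have hn : ∀ x, 0 ≤ bke L T g t x := fun x => (bke_mem L T H.mem t x).1
  exact (integral_eq_of_lintegral_eq (α := condFlux L T g μ t)
    { toFun := fun (χ : Bdd (Γ × Γ)) x =>
        semi L t (jumpOp L χ χ.isBddMeas (bke L T g t)) x * (bke L T g 0 x)⁻¹
      map_add' := fun φ χ => by
        ext x
        have e : jumpOp L (φ + χ : Bdd (Γ × Γ)) (φ + χ).isBddMeas (bke L T g t) =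
            jumpOp L φ φ.isBddMeas (bke L T g t) + jumpOp L χ χ.isBddMeas (bke L T g t) := by
          ext x
          simp only [jumpOp_apply, Bdd.add_apply, mul_add]
          exact integral_add
            (((bke L T g t).isBddMeas.mul (φ.isBddMeas.comp measurable_prodMk_left)).integrable _)
            (((bke L T g t).isBddMeas.mul (χ.isBddMeas.comp measurable_prodMk_left)).integrable _)
        simp only [e, map_add, Bdd.add_apply, Pi.add_apply, add_mul]
      map_smul' := fun a φ => by
        ext x
        have e : jumpOp L (a • φ : Bdd (Γ × Γ)) (a • φ).isBddMeas (bke L T g t) =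
            a • jumpOp L φ φ.isBddMeas (bke L T g t) := by
          ext x
          simp only [jumpOp_apply, Bdd.smul_apply, mul_left_comm _ a, integral_const_mul]
        simp only [e, map_smul, Bdd.smul_apply, Pi.smul_apply, smul_eq_mul, RingHom.id_apply,
          mul_assoc] }
    (fun φ => (semi L t _).measurable.mul (measurable_inv L T g))
    (fun φ hφ x => mul_nonneg (semi_nonneg L ht.1 (jumpOp_nonneg φ.isBddMeas hφ hn) x) (hinv x))
    (fun φ hφ => H.lintegral_condFlux ht φ.isBddMeas hφ) (Bdd.of χ hχ)).2

end IsDoobTransform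

end Transform

end JumpControl
end

/-! ### Time evolution and admissibility of the Doob transform. -/

noncomputable section

namespace JumpControl

variable {Γ : Type*} [MeasurableSpace Γ]


lemma isBddMeas_indicator {A : Set Γ} (hA : MeasurableSet A) :
    IsBddMeas (A.indicator fun _ => (1 : ℝ)) := by
  refine ⟨measurable_const.indicator hA, 1, fun x => ?_⟩
  by_cases h : x ∈ A <;> simp [h]

lemma lintegral_ofReal_indicator {A : Set Γ} (hA : MeasurableSet A) (α : Measure Γ) :
    ∫⁻ x, ENNReal.ofReal (A.indicator (fun _ => (1 : ℝ)) x) ∂α = α A := by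
  rw [← lintegral_indicator_one hA]
  refine lintegral_congr fun x => ?_
  by_cases h : x ∈ A <;> simp [h]

/-- Truncation of the time variable to `[0, T]`. -/
def clampTime (T t : ℝ) : ℝ := max 0 (min t T)

lemma clampTime_mem {T : ℝ} (hT : 0 ≤ T) (t : ℝ) : clampTime T t ∈ Icc 0 T :=
  ⟨le_max_left _ _, max_le hT (min_le_right _ _)⟩

lemma clampTime_of_mem {T t : ℝ} (ht : t ∈ Icc 0 T) : clampTime T t = t := by
  rw [clampTime, min_eq_left ht.2, max_eq_right ht.1]

lemma continuous_clampTime (T : ℝ) : Continuous (clampTime T) := by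
  unfold clampTime; fun_prop

section Transform

set_option linter.unusedSectionVars false

variable {L : Kernel Γ Γ} [IsFiniteKernel L] {T : ℝ} {g : Bdd Γ} {μ : Measure Γ}

lemma hasDerivAt_semi_apply {u : ℝ → Bdd Γ} {u' : Bdd Γ} {t : ℝ} (hu : HasDerivAt u u' t) :
    HasDerivAt (fun r => semi L r (u r)) (semi L t (gen L (u t) + u')) t := by
  have := (hasDerivAt_semi L t).clm_apply hu
  rwa [mul_apply_eq_comp, ← map_add] at this

lemma continuous_semi_apply {u : ℝ → Bdd Γ} (hu : Continuous u) :
    Continuous fun r => semi L r (u r) := (continuous_semi L).clm_apply hu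

/-- The failure of the product rule for a jump generator. With u = h_t, this is h_t times the
generator of the conditioned process applied to φ. -/
lemma gen_mul_sub (u φ : Bdd Γ) :
    gen L (u * φ) + -gen L u * φ = jumpOp L (dgrad φ) φ.isBddMeas.dgrad u := by
  ext x
  have hu := u.integrable (L x)
  have huφ : Integrable (fun y => u y * φ y) (L x) := (u * φ).integrable (L x)
  simp only [Bdd.add_apply, Bdd.mul_apply, Bdd.neg_apply, gen_apply, jumpOp_apply, dgrad, mul_sub]
  rw [integral_sub huφ (hu.mul_const _), integral_mul_const]
  ring

lemma hasDerivAt_semi_bke_mul (φ : Bdd Γ) {t : ℝ} (ht : t < T) :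
    HasDerivAt (fun r => semi L r (bke L T g r * φ))
      (semi L t (jumpOp L (dgrad φ) φ.isBddMeas.dgrad (bke L T g t))) t := by
  have h := Bdd.hasDerivAt_mul (hasDerivAt_bke L T g ht) (hasDerivAt_const t φ)
  have e : bke L T g t * (0 : Bdd Γ) = 0 := map_zero (Bdd.mulL Γ (bke L T g t))
  rw [e, add_zero] at h
  rw [← gen_mul_sub]
  exact hasDerivAt_semi_apply h

namespace IsDoobTransform

/-- The integral of `χ` against the jump flux, as a function of time up to the terminal time. -/
lemma continuousOn_jump (H : IsDoobTransform L T g μ) [IsProbabilityMeasure μ] {χ : Γ × Γ → ℝ}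
    (hχ : IsBddMeas χ) :
    ContinuousOn (fun t => ∫ x, semi L t (jumpOp L χ hχ (bke L T g t)) x *
      (bke L T g 0 x)⁻¹ ∂μ) (Icc 0 T) := by
  obtain ⟨C, hC⟩ := hχ.2
  refine continuousOn_integral_mul (measurable_inv L T g)
    (continuous_semi_apply ((jumpOp L χ hχ).continuous.comp (continuous_bke L T g)))
    (H.integrable_jumpBound.const_mul |C|) fun t ht x => ?_
  exact H.abs_semi_jumpOp_le hχ (abs_nonneg C) (fun z => (hC z).trans (le_abs_self C)) ht x

/-- The weak continuity equation: the derivative of `semi L r` applied to h_r φ is `semi L r`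
applied to the jump operator of ∇φ, and `jumpBound` dominates it. -/
lemma integral_condLaw_sub [IsProbabilityMeasure μ] (H : IsDoobTransform L T g μ) (φ : Bdd Γ)
    {s t : ℝ} (hs : 0 ≤ s) (hst : s ≤ t) (ht : t ≤ T) :
    ∫ x, φ x ∂(condLaw L T g μ t) - ∫ x, φ x ∂(condLaw L T g μ s) =
      ∫ r in s..t, ∫ x, semi L r (jumpOp L (dgrad φ) φ.isBddMeas.dgrad (bke L T g r)) x *
        (bke L T g 0 x)⁻¹ ∂μ := by
  obtain ⟨C, hC⟩ := φ.isBddMeas.dgrad.2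
  rw [(H.integral_condLaw ⟨hs.trans hst, ht⟩ φ).2, (H.integral_condLaw ⟨hs, hst.trans ht⟩ φ).2]
  refine integral_mul_sub_integral_mul (T := T) (measurable_inv L T g)
    (continuous_semi_apply (Bdd.continuous_mul (continuous_bke L T g) continuous_const))
    (continuous_semi_apply ((jumpOp L _ _).continuous.comp (continuous_bke L T g)))
    (fun r hr => hasDerivAt_semi_bke_mul φ hr.2) (H.integrable_jumpBound.const_mul |C|)
    (fun r hr x => H.abs_semi_jumpOp_le _ (abs_nonneg C) (fun z => (hC z).trans (le_abs_self C))
      hr x) (fun r hr => (H.integral_condLaw hr φ).1) hs hst ht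

lemma condLaw_zero [IsProbabilityMeasure μ] (H : IsDoobTransform L T g μ) :
    condLaw L T g μ 0 = μ := by
  ext A hA
  have h := H.lintegral_condLaw ⟨le_rfl, H.time_pos.le⟩ (φ := Bdd.of _ (isBddMeas_indicator hA))
    fun x => indicator_nonneg (fun _ _ => zero_le_one) x
  simp only [Bdd.of_apply, lintegral_ofReal_indicator hA, semi_zero,
    one_apply_eq_self, Bdd.mul_apply] at h
  rw [h, ← lintegral_ofReal_indicator hA]
  refine lintegral_congr fun x => ?_
  have := (H.pos 0 H.zero_mem x).ne'
  congr 1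
  field_simp

-- The mass of a fixed set is continuous in time by the semigroup formula of `integral_condFlux`.
open Classical in
lemma measurable_condFlux [IsProbabilityMeasure μ] (H : IsDoobTransform L T g μ) :
    Measurable fun t => if t ∈ Ico 0 T then condFlux L T g μ t else 0 := by
  refine Measure.measurable_of_measurable_coe _ fun A hA => ?_
  have hχ := isBddMeas_indicator hA
  have hc := (H.continuousOn_jump hχ).mono Ico_subset_Icc_self
  have hm : Measurable ((Ico 0 T).piecewise (fun t => ∫ x, semi L t (jumpOp L _ hχ
      (bke L T g t)) x * (bke L T g 0 x)⁻¹ ∂μ) fun _ => 0) :=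
    hc.measurable_piecewise continuousOn_const measurableSet_Ico
  convert hm.ennreal_ofReal using 2 with t
  by_cases ht : t ∈ Ico 0 T
  · have := H.isFiniteMeasure_condFlux ht
    rw [if_pos ht, piecewise_eq_of_mem _ _ _ ht, ← H.integral_condFlux ht hχ,
      ofReal_integral_eq_lintegral_ofReal (hχ.integrable _)
        (ae_of_all _ fun x => indicator_nonneg (fun _ _ => zero_le_one) x),
      lintegral_ofReal_indicator hA]
  · rw [if_neg ht, piecewise_eq_of_notMem _ _ _ ht]
    simp

open Classical in
/-- The density-flux pair of the Doob transform. -/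
def pair [IsProbabilityMeasure μ] (H : IsDoobTransform L T g μ) : DensityFlux Γ where
  p t := ⟨condLaw L T g μ (clampTime T t),
    H.isProbabilityMeasure_condLaw (clampTime_mem H.time_pos.le t)⟩
  q := ⟨fun t => if t ∈ Ico 0 T then condFlux L T g μ t else 0, H.measurable_condFlux⟩
  finite_q t := by
    change IsFiniteMeasure (if t ∈ Ico 0 T then condFlux L T g μ t else 0)
    split_ifs with h
    · exact H.isFiniteMeasure_condFlux h
    · infer_instance

lemma pair_p [IsProbabilityMeasure μ] (H : IsDoobTransform L T g μ) {t : ℝ} (ht : t ∈ Icc 0 T) :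
    (H.pair.p t : Measure Γ) = condLaw L T g μ t := by
  change condLaw L T g μ (clampTime T t) = _
  rw [clampTime_of_mem ht]

lemma pair_q [IsProbabilityMeasure μ] (H : IsDoobTransform L T g μ) {t : ℝ} (ht : t ∈ Ico 0 T) :
    H.pair.q t = condFlux L T g μ t := if_pos ht

lemma pair_q_eq_expFlux [IsProbabilityMeasure μ] (H : IsDoobTransform L T g μ) {t : ℝ}
    (ht : t ∈ Ico 0 T) : H.pair.q t =
      expFlux L (fun x => Real.log (bke L T g t x)) (H.pair.p t : Measure Γ) := by
  rw [H.pair_q ht, H.pair_p (Ico_subset_Icc_self ht)]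
  rfl

/-- Finite action is a hypothesis because it comes from `cost_pair_le`, whose proof does not rely on
admissibility. -/
lemma isAdmissible_pair [IsProbabilityMeasure μ] (H : IsDoobTransform L T g μ)
    (hA : action L T H.pair < ⊤) : IsAdmissible L T μ H.pair where
  setwise_continuous A hA := by
    have hφ := isBddMeas_indicator hA
    have e : ∀ t ∈ Icc 0 T, (H.pair.p t : Measure Γ).real A =
        ∫ x, semi L t (bke L T g t * Bdd.of _ hφ) x * (bke L T g 0 x)⁻¹ ∂μ := fun t ht => by
      rw [H.pair_p ht, ← (H.integral_condLaw ht (Bdd.of _ hφ)).2]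
      exact (integral_indicator_one hA).symm
    refine ContinuousOn.congr ?_ e
    exact continuousOn_integral_mul (measurable_inv L T g)
      (continuous_semi_apply (Bdd.continuous_mul (continuous_bke L T g) continuous_const))
      (integrable_const _) fun t ht x => H.abs_semi_mul_le _ ht x
  flux_integrable := by
    have h : ∀ t ∈ Ioo 0 T, H.pair.q t univ ≤ ENNReal.ofReal (∫ x, jumpBound L T g x ∂μ) :=
      fun t ht => by rw [H.pair_q ⟨ht.1.le, ht.2⟩]; exact H.condFlux_univ_le ⟨ht.1.le, ht.2⟩
    refine (setLIntegral_mono measurable_const h).trans_lt ?_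
    rw [setLIntegral_const]
    exact ENNReal.mul_lt_top ENNReal.ofReal_lt_top measure_Ioo_lt_top
  continuity_equation s t hs hst ht φ hφ := by
    have h := H.integral_condLaw_sub (Bdd.of φ hφ) hs hst ht
    simp only [Bdd.of_apply] at h
    rw [H.pair_p ⟨hs.trans hst, ht⟩, H.pair_p ⟨hs, hst.trans ht⟩, h,
      intervalIntegral.integral_of_le hst, intervalIntegral.integral_of_le hst,
      integral_Ioc_eq_integral_Ioo, integral_Ioc_eq_integral_Ioo]
    refine setIntegral_congr_fun measurableSet_Ioo fun r hr => ?_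
    have hr' : r ∈ Ico 0 T := ⟨hs.trans hr.1.le, hr.2.trans_le ht⟩
    change _ = ∫ z, dgrad φ z ∂(H.pair.q r)
    rw [H.pair_q hr']
    exact (H.integral_condFlux hr' hφ.dgrad).symm
  finite_action := hA
  initial := by rw [H.pair_p ⟨le_rfl, H.time_pos.le⟩, H.condLaw_zero]

lemma solvesControlledEquation [IsProbabilityMeasure μ] (H : IsDoobTransform L T g μ) :
    SolvesControlledEquation L T (fun t x => Real.log (bke L T g t x)) H.pair.p := by
  have hq : ∀ t ∈ Ico 0 T, expFlux L (fun x => Real.log (bke L T g t x))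
      (H.pair.p t : Measure Γ) = condFlux L T g μ t := fun t ht => by
    rw [← H.pair_q_eq_expFlux ht, H.pair_q ht]
  have hc := fun (φ : Γ → ℝ) (hφ : IsBddMeas φ) => H.continuousOn_jump hφ.dgrad
  have he : ∀ (φ : Γ → ℝ) (hφ : IsBddMeas φ), ∀ t ∈ Ico 0 T,
      ∫ z, dgrad φ z ∂(expFlux L (fun x => Real.log (bke L T g t x)) (H.pair.p t : Measure Γ)) =
      ∫ x, semi L t (jumpOp L _ hφ.dgrad (bke L T g t)) x * (bke L T g 0 x)⁻¹ ∂μ :=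
    fun φ hφ t ht => by rw [hq t ht, H.integral_condFlux ht hφ.dgrad]
  refine ⟨fun t ht => ?_, fun φ hφ t ht => ?_, fun φ hφ => ?_⟩
  · rw [hq t ht]
    exact H.isFiniteMeasure_condFlux ht
  · set W : ℝ → ℝ := fun t =>
      ∫ x, semi L t (jumpOp L _ hφ.dgrad (bke L T g t)) x * (bke L T g 0 x)⁻¹ ∂μ with hW
    -- Constant extension outside [0, T] makes the derivative continuous on the whole line, so t = 0
    -- needs no separate treatment.
    have hW' : Continuous (W ∘ clampTime T) := (hc φ hφ).comp_continuous (continuous_clampTime T)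
      (clampTime_mem H.time_pos.le)
    have hd := (hW'.integral_hasStrictDerivAt 0 t).hasDerivAt.const_add
      (∫ x, φ x ∂(H.pair.p 0 : Measure Γ))
    rw [he φ hφ t ht]
    rw [Function.comp_apply, clampTime_of_mem (Ico_subset_Icc_self ht)] at hd
    have hF : ∀ s ∈ Ico 0 T, ∫ x, φ x ∂(H.pair.p s : Measure Γ) =
        ∫ x, φ x ∂(H.pair.p 0 : Measure Γ) + ∫ r in (0 : ℝ)..s, (W ∘ clampTime T) r := by
      intro s hs
      have h := H.integral_condLaw_sub (Bdd.of φ hφ) le_rfl hs.1 hs.2.le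
      simp only [Bdd.of_apply] at h
      rw [H.pair_p (Ico_subset_Icc_self hs), H.pair_p ⟨le_rfl, H.time_pos.le⟩,
        ← sub_eq_iff_eq_add', h]
      refine intervalIntegral.integral_congr fun r hr => ?_
      rw [uIcc_of_le hs.1] at hr
      rw [Function.comp_apply, clampTime_of_mem ⟨hr.1, hr.2.trans hs.2.le⟩]
      rfl
    exact hd.hasDerivWithinAt.congr hF (hF t ht)
  · exact ((hc φ hφ).mono Ico_subset_Icc_self).congr (he φ hφ)

end IsDoobTransform

end Transform

end JumpControl
end

/-! ### Entropy production and the cost of the Doob transform. -/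

noncomputable section

namespace JumpControl

variable {Γ : Type*} [MeasurableSpace Γ]


open InformationTheory

lemma le_liminf_add_ennreal (a b : ℕ → ℝ≥0∞) :
    liminf a atTop + liminf b atTop ≤ liminf (fun n => a n + b n) atTop := by
  simp only [liminf_eq_iSup_iInf_of_nat]
  rw [ENNReal.iSup_add_iSup_of_monotone]
  · exact iSup_mono fun n => le_iInf₂ fun i hi =>
      add_le_add (iInf₂_le i hi) (iInf₂_le i hi)
  · exact fun m n h => le_iInf₂ fun i hi => iInf₂_le i (h.trans hi)
  · exact fun m n h => le_iInf₂ fun i hi => iInf₂_le i (h.trans hi)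

section EntropyApprox

variable {ε : ℝ}

/-- The slope that normalizes the regularized entropy at `1`. -/
def entSlope (ε : ℝ) : ℝ := (1 + ε) * Real.log (1 + ε) - ε * Real.log ε

/-- The function `u log u`, regularized at `0`. -/
def entApprox (ε u : ℝ) : ℝ := (u + ε) * Real.log (u + ε) - ε * Real.log ε - entSlope ε * u

lemma hasDerivAt_entApprox (hε : 0 < ε) {a : ℝ} (ha : a ∈ Icc (0 : ℝ) 1) :
    HasDerivAt (entApprox ε) (Real.log (a + ε) + 1 - entSlope ε) a := by
  have h := (Real.hasDerivAt_mul_log (add_pos_of_mem hε ha).ne').comp a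
    ((hasDerivAt_id a).add_const ε)
  rw [mul_one] at h
  have h2 := (h.sub_const (ε * Real.log ε)).sub ((hasDerivAt_id a).const_mul (entSlope ε))
  rw [mul_one] at h2
  exact h2

lemma hasDerivAt_log_add (hε : 0 < ε) {a : ℝ} (ha : a ∈ Icc (0 : ℝ) 1) (c : ℝ) :
    HasDerivAt (fun u => Real.log (u + ε) + 1 - c) (a + ε)⁻¹ a := by
  have h := ((((hasDerivAt_id a).add_const ε).log (add_pos_of_mem hε ha).ne').add_const
    (1 : ℝ)).sub_const c
  rwa [one_div] at h

lemma actsOnUnit_entApprox (hε : 0 < ε) : ActsOnUnit (entApprox ε) :=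
  ⟨by unfold entApprox; fun_prop,
    fun _ ha => (hasDerivAt_entApprox hε ha).continuousAt.continuousWithinAt⟩

lemma actsOnUnit_log_add (hε : 0 < ε) (c : ℝ) : ActsOnUnit fun u => Real.log (u + ε) + 1 - c :=
  ⟨by fun_prop, fun _ ha => (hasDerivAt_log_add hε ha c).continuousAt.continuousWithinAt⟩

lemma entApprox_zero : entApprox ε 0 = 0 := by simp [entApprox]

/-- The function is convex and `entSlope` is chosen so that it vanishes at 0 and at 1. The sign
allows the terminal term to be treated by Fatou. -/
lemma entApprox_nonpos (hε : 0 < ε) {a : ℝ} (ha : a ∈ Icc (0 : ℝ) 1) : entApprox ε a ≤ 0 := by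
  have h := Real.convexOn_mul_log.2 (x := 1 + ε) (y := ε) (by simp; positivity) hε.le ha.1
    (sub_nonneg.2 ha.2) (by ring)
  have e : a • (1 + ε) + (1 - a) • ε = a + ε := by simp only [smul_eq_mul]; ring
  rw [e] at h
  simp only [smul_eq_mul] at h
  rw [entApprox, entSlope]
  linarith

lemma neg_entApprox_le (hε : 0 < ε) {a : ℝ} (ha : 0 < a) :
    -entApprox ε a ≤ -(a * Real.log a) + entSlope ε * a := by
  have h1 : Real.log a ≤ Real.log (a + ε) := Real.log_le_log ha (by linarith)
  have h2 : Real.log ε ≤ Real.log (a + ε) := Real.log_le_log hε (by linarith)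
  have h3 := mul_le_mul_of_nonneg_left h1 ha.le
  have h4 := mul_le_mul_of_nonneg_left h2 hε.le
  rw [entApprox]
  linarith

lemma tendsto_entSlope : Tendsto entSlope (𝓝 0) (𝓝 0) := by
  have h : Continuous entSlope :=
    (Real.continuous_mul_log.comp (continuous_const.add continuous_id)).sub Real.continuous_mul_log
  simpa [entSlope] using h.tendsto 0

lemma tendsto_entApprox (a : ℝ) : Tendsto (fun ε => entApprox ε a) (𝓝 0) (𝓝 (a * Real.log a)) := by
  have h : Tendsto (fun ε => (a + ε) * Real.log (a + ε) - ε * Real.log ε) (𝓝 0)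
      (𝓝 ((a + 0) * Real.log (a + 0) - 0 * Real.log 0)) :=
    ((Real.continuous_mul_log.comp (continuous_const.add continuous_id)).sub
      Real.continuous_mul_log).tendsto 0
  simpa [entApprox] using h.sub (tendsto_entSlope.mul_const a)

/-- The Bregman divergence of the regularized entropy. -/
def bregman (ε a b : ℝ) : ℝ := (a + ε) * klFun ((b + ε) / (a + ε))

lemma bregman_nonneg (hε : 0 < ε) {a b : ℝ} (ha : a ∈ Icc (0 : ℝ) 1) (hb : b ∈ Icc (0 : ℝ) 1) :
    0 ≤ bregman ε a b :=
  mul_nonneg (add_pos_of_mem hε ha).le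
    (klFun_nonneg (div_nonneg (add_pos_of_mem hε hb).le (add_pos_of_mem hε ha).le))

/-- First-order Taylor remainder of `entApprox` at a; the affine normalizations cancel. -/
lemma bregman_eq (hε : 0 < ε) {a b : ℝ} (ha : a ∈ Icc (0 : ℝ) 1) (hb : b ∈ Icc (0 : ℝ) 1) :
    bregman ε a b = entApprox ε b - entApprox ε a -
      (Real.log (a + ε) + 1 - entSlope ε) * (b - a) := by
  have h1 := add_pos_of_mem hε ha
  have h2 := add_pos_of_mem hε hb
  rw [bregman, klFun, Real.log_div h2.ne' h1.ne', entApprox, entApprox]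
  field_simp
  ring

lemma tendsto_bregman {a : ℝ} (ha : 0 < a) (b : ℝ) :
    Tendsto (fun ε => bregman ε a b) (𝓝 0) (𝓝 (a * klFun (b / a))) := by
  have h : ContinuousAt (fun ε => bregman ε a b) 0 := by
    unfold bregman
    refine ContinuousAt.mul (by fun_prop) (continuous_klFun.continuousAt.comp ?_)
    exact ContinuousAt.div (by fun_prop) (by fun_prop) (by simpa using ha.ne')
  simpa [ContinuousAt, bregman] using h

end EntropyApprox

section Production

set_option linter.unusedSectionVars false

variable (L : Kernel Γ Γ) [IsFiniteKernel L] (T : ℝ) (g : Bdd Γ) {μ : Measure Γ} {ε : ℝ}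

/-- The regularized entropy density of the Doob transform. -/
def entBke (hε : 0 < ε) (t : ℝ) : Bdd Γ := superpose _ (actsOnUnit_entApprox hε) (bke L T g t)

/-- The regularized entropy production density of the Doob transform. -/
def entProd (hε : 0 < ε) (t : ℝ) : Bdd Γ :=
  gen L (entBke L T g hε t) +
    superpose _ (actsOnUnit_log_add hε (entSlope ε)) (bke L T g t) * -gen L (bke L T g t)

variable {L T g}

lemma continuous_entBke (hg : ∀ x, g x ∈ Icc (0 : ℝ) 1) (hε : 0 < ε) :
    Continuous (entBke L T g hε) :=
  continuous_superpose _ (actsOnUnit_log_add hε _) (fun _ ha => hasDerivAt_entApprox hε ha)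
    (continuous_bke L T g) (bke_mem L T hg)

lemma continuous_entProd (hg : ∀ x, g x ∈ Icc (0 : ℝ) 1) (hε : 0 < ε) :
    Continuous (entProd L T g hε) :=
  ((gen L).continuous.comp (continuous_entBke hg hε)).add (Bdd.continuous_mul
    (continuous_superpose _ (actsOnUnit_inv_add hε) (fun _ ha => hasDerivAt_log_add hε ha _)
      (continuous_bke L T g) (bke_mem L T hg))
    ((gen L).continuous.comp (continuous_bke L T g)).neg)

lemma hasDerivAt_semi_entBke (hg : ∀ x, g x ∈ Icc (0 : ℝ) 1) (hε : 0 < ε) {t : ℝ} (ht : t < T) :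
    HasDerivAt (fun r => semi L r (entBke L T g hε r)) (semi L t (entProd L T g hε t)) t :=
  hasDerivAt_semi_apply (hasDerivAt_superpose _ _ (actsOnUnit_inv_add hε)
    (fun _ ha => hasDerivAt_entApprox hε ha) (fun _ ha => hasDerivAt_log_add hε ha _)
    (hasDerivAt_bke L T g ht) (bke_mem L T hg))

lemma entBke_apply (hg : ∀ x, g x ∈ Icc (0 : ℝ) 1) (hε : 0 < ε) (t : ℝ) (x : Γ) :
    entBke L T g hε t x = entApprox ε (bke L T g t x) := superpose_apply _ (bke_mem L T hg t x)

/-- With E the regularized entropy, G E(h) - E'(h) Gh integrates E(h(y)) - E(h(x)) - E'(h(x))(h(y) -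
h(x)) against L, so the production is a nonnegative Bregman divergence. -/
lemma entProd_apply (hg : ∀ x, g x ∈ Icc (0 : ℝ) 1) (hε : 0 < ε) (t : ℝ) (x : Γ) :
    Integrable (fun y => bregman ε (bke L T g t x) (bke L T g t y)) (L x) ∧
    entProd L T g hε t x = ∫ y, bregman ε (bke L T g t x) (bke L T g t y) ∂(L x) := by
  set c := Real.log (bke L T g t x + ε) + 1 - entSlope ε with hc
  have e : ∀ y, bregman ε (bke L T g t x) (bke L T g t y) =
      dgrad (entBke L T g hε t) (x, y) - c * dgrad (bke L T g t) (x, y) := fun y => by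
    rw [bregman_eq hε (bke_mem L T hg t x) (bke_mem L T hg t y), dgrad, dgrad,
      entBke_apply hg, entBke_apply hg]
  have i1 : Integrable (fun y => dgrad (entBke L T g hε t) (x, y)) (L x) :=
    ((entBke L T g hε t).isBddMeas.dgrad.comp measurable_prodMk_left).integrable _
  have i2 : Integrable (fun y => dgrad (bke L T g t) (x, y)) (L x) :=
    ((bke L T g t).isBddMeas.dgrad.comp measurable_prodMk_left).integrable _
  simp only [e]
  refine ⟨i1.sub (i2.const_mul c), ?_⟩
  rw [integral_sub i1 (i2.const_mul c), integral_const_mul, entProd, Bdd.add_apply, Bdd.mul_apply,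
    Bdd.neg_apply, gen_apply', gen_apply', superpose_apply _ (bke_mem L T hg t x)]
  ring

lemma entProd_nonneg (hg : ∀ x, g x ∈ Icc (0 : ℝ) 1) (hε : 0 < ε) (t : ℝ) (x : Γ) :
    0 ≤ entProd L T g hε t x := by
  rw [(entProd_apply hg hε t x).2]
  exact integral_nonneg fun y => bregman_nonneg hε (bke_mem L T hg t x) (bke_mem L T hg t y)

/-- The Taylor remainder is quadratic, and |b - a|² ≤ a + b on [0, 1]. The resulting bound is linear
in h, so it survives division by h₀; the constant depends on ε. -/
lemma exists_entProd_le (hg : ∀ x, g x ∈ Icc (0 : ℝ) 1) (hε : 0 < ε) :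
    ∃ C, 0 ≤ C ∧ ∀ t x, entProd L T g hε t x ≤
      C * (posOp L (bke L T g t) x + rateBound L * bke L T g t x) := by
  obtain ⟨C, hC0, hC⟩ := exists_taylor_of_hasDerivAt (actsOnUnit_inv_add hε)
    (fun _ ha => hasDerivAt_entApprox hε ha) (fun _ ha => hasDerivAt_log_add hε ha (entSlope ε))
  refine ⟨C, hC0, fun t x => ?_⟩
  obtain ⟨hi, he⟩ := entProd_apply (T := T) (L := L) hg hε t x
  have hx := bke_mem L T hg t x
  have hb : ∀ y, bregman ε (bke L T g t x) (bke L T g t y) ≤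
      C * (bke L T g t y + bke L T g t x) := fun y => by
    have hy := bke_mem L T hg t y
    rw [bregman_eq hε hx hy]
    refine (le_abs_self _).trans ((hC _ hx _ hy).trans (mul_le_mul_of_nonneg_left ?_ hC0))
    rw [sq_abs]
    nlinarith [hx.1, hx.2, hy.1, hy.2]
  have hiu := (bke L T g t).integrable (L x)
  have h1 := integral_mono hi ((hiu.add (integrable_const (bke L T g t x))).const_mul C) hb
  rw [← he, integral_const_mul] at h1
  refine h1.trans (mul_le_mul_of_nonneg_left ?_ hC0)
  have e : ∫ y, (bke L T g t y + bke L T g t x) ∂(L x) =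
      ∫ y, bke L T g t y ∂(L x) + (L x).real univ * bke L T g t x := by
    rw [integral_add hiu (integrable_const _), integral_const, smul_eq_mul]
  simp only [Pi.add_apply]
  rw [e, posOp_apply]
  have := mul_le_mul_of_nonneg_right (real_univ_le_rateBound L x) hx.1
  linarith

lemma ofReal_entProd (hg : ∀ x, g x ∈ Icc (0 : ℝ) 1) (hε : 0 < ε) (t : ℝ) (x : Γ) :
    ENNReal.ofReal (entProd L T g hε t x) =
      ∫⁻ y, ENNReal.ofReal (bregman ε (bke L T g t x) (bke L T g t y)) ∂(L x) := by
  obtain ⟨hi, he⟩ := entProd_apply (T := T) (L := L) hg hε t x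
  rw [he, ofReal_integral_eq_lintegral_ofReal hi (ae_of_all _ fun y =>
    bregman_nonneg hε (bke_mem L T hg t x) (bke_mem L T hg t y))]

namespace IsDoobTransform

variable [IsProbabilityMeasure μ]

lemma abs_semi_entProd_le (H : IsDoobTransform L T g μ) (hε : 0 < ε) :
    ∃ C, ∀ t ∈ Icc 0 T, ∀ x,
      |semi L t (entProd L T g hε t) x * (bke L T g 0 x)⁻¹| ≤ C * jumpBound L T g x := by
  obtain ⟨C, hC0, hC⟩ := exists_entProd_le (L := L) (T := T) H.mem hε
  have hR := rateBound_nonneg L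
  refine ⟨C * (1 + rateBound L), fun t ht x => H.abs_mul_inv_le ?_⟩
  have h1 := abs_semi_le (L := L) ht.1 (u := entProd L T g hε t)
    (v := C • (posOp L (bke L T g t) + rateBound L • bke L T g t))
    (fun x => by
      rw [abs_of_nonneg (entProd_nonneg H.mem hε t x)]
      exact hC t x) x
  simp only [map_smul, map_add, semi_comm_posOp, semi_bke ht, Bdd.smul_apply, Bdd.add_apply] at h1
  refine h1.trans ?_
  rw [mul_assoc]
  refine mul_le_mul_of_nonneg_left ?_ hC0
  have h2 : 0 ≤ posOp L (bke L T g 0) x := posOp_nonneg L (fun x => (bke_mem L T H.mem 0 x).1) x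
  nlinarith [(bke_mem (L := L) T H.mem 0 x).1, mul_nonneg hR h2]

/-- `entApprox ε` is Lipschitz and vanishes at 0, hence bounded by a multiple of h_t, which the
semigroup sends to h₀. -/
lemma abs_semi_entBke_le (H : IsDoobTransform L T g μ) (hε : 0 < ε) :
    ∃ C, ∀ t ∈ Icc 0 T, ∀ x, |semi L t (entBke L T g hε t) x * (bke L T g 0 x)⁻¹| ≤ C := by
  obtain ⟨C, hC0, hC⟩ := exists_lipschitz_of_hasDerivAt (actsOnUnit_log_add hε (entSlope ε))
    (fun _ ha => hasDerivAt_entApprox hε ha)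
  refine ⟨C, fun t ht x => ?_⟩
  have hp := H.pos 0 H.zero_mem x
  have h1 := abs_semi_le (L := L) ht.1 (u := entBke L T g hε t) (v := C • bke L T g t)
    (fun x => by
      have hx := bke_mem L T H.mem t x
      have := hC 0 ⟨le_rfl, zero_le_one⟩ _ hx
      rwa [entApprox_zero, sub_zero, sub_zero, abs_of_nonneg hx.1, ← entBke_apply H.mem hε] at this)
    x
  rw [map_smul, semi_bke ht, Bdd.smul_apply] at h1
  rwa [abs_mul, abs_of_pos (inv_pos.2 hp), ← div_eq_mul_inv, div_le_iff₀ hp]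

lemma neg_entBke_zero_le (H : IsDoobTransform L T g μ) (hε : 0 < ε) (x : Γ) :
    -(entBke L T g hε 0 x * (bke L T g 0 x)⁻¹) ≤ -Real.log (bke L T g 0 x) + entSlope ε := by
  have hp := H.pos 0 H.zero_mem x
  rw [entBke_apply H.mem, ← neg_mul, ← div_eq_mul_inv, div_le_iff₀ hp]
  refine (neg_entApprox_le hε hp).trans_eq ?_
  ring

/-- The regularized entropy balance of the Doob transform. -/
lemma entropy_balance_le (H : IsDoobTransform L T g μ) (hε : 0 < ε) :
    ∫⁻ x, ENNReal.ofReal (-entBke L T g hε T x) ∂(baseLaw L T g μ T) +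
      ∫⁻ t in Ioo 0 T, ∫⁻ x, ENNReal.ofReal (entProd L T g hε t x) ∂(baseLaw L T g μ t) ≤
    ENNReal.ofReal (∫ x, -Real.log (bke L T g 0 x) ∂μ + entSlope ε) := by
  obtain ⟨C, hC⟩ := H.abs_semi_entProd_le hε
  obtain ⟨C', hC'⟩ := H.abs_semi_entBke_le hε
  have hT := H.time_pos.le
  have hw := measurable_inv L T g
  have hw0 : ∀ x, 0 ≤ (bke L T g 0 x)⁻¹ := fun x => inv_nonneg.2 (bke_mem L T H.mem 0 x).1
  have hD := H.integrable_jumpBound.const_mul C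
  have hUi : ∀ t ∈ Icc 0 T,
      Integrable (fun x => semi L t (entBke L T g hε t) x * (bke L T g 0 x)⁻¹) μ := fun t ht =>
    integrable_mul_of_abs_le hw (integrable_const C') (hC' t ht)
  have hVc := continuous_semi_apply (L := L) (continuous_entProd (L := L) (T := T) H.mem hε)
  have hftc := integral_mul_sub_integral_mul hw
    (continuous_semi_apply (L := L) (continuous_entBke (L := L) (T := T) H.mem hε)) hVc
    (fun t ht => hasDerivAt_semi_entBke H.mem hε ht.2) hD hC hUi le_rfl hT le_rfl
  have hVcont := continuousOn_integral_mul hw hVc hD hC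
  have hV0 : ∀ t ∈ Icc 0 T, ∀ x, 0 ≤ semi L t (entProd L T g hε t) x * (bke L T g 0 x)⁻¹ :=
    fun t ht x => mul_nonneg (semi_nonneg L ht.1 (entProd_nonneg H.mem hε t) x) (hw0 x)
  have e1 : ∫⁻ x, ENNReal.ofReal (-entBke L T g hε T x) ∂(baseLaw L T g μ T) =
      ENNReal.ofReal (-∫ x, semi L T (entBke L T g hε T) x * (bke L T g 0 x)⁻¹ ∂μ) := by
    have hn : ∀ x, 0 ≤ (-entBke L T g hε T) x := fun x => by
      rw [Bdd.neg_apply, entBke_apply H.mem]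
      exact neg_nonneg.2 (entApprox_nonpos hε (bke_mem L T H.mem T x))
    have h := lintegral_baseLaw (L := L) (T := T) (g := g) (μ := μ) hT hn
    have hp := semi_nonneg L hT hn
    simp only [map_neg, Bdd.neg_apply, neg_mul] at h hp
    rw [h, ← integral_neg]
    refine (ofReal_integral_eq_lintegral_ofReal (hUi T ⟨hT, le_rfl⟩).neg
      (ae_of_all _ fun x => ?_)).symm
    change 0 ≤ -(semi L T (entBke L T g hε T) x * (bke L T g 0 x)⁻¹)
    rw [← neg_mul]
    exact mul_nonneg (hp x) (hw0 x)
  have e2 : ∫⁻ t in Ioo 0 T, ∫⁻ x, ENNReal.ofReal (entProd L T g hε t x) ∂(baseLaw L T g μ t) =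
      ENNReal.ofReal (∫ t in (0 : ℝ)..T,
        ∫ x, semi L t (entProd L T g hε t) x * (bke L T g 0 x)⁻¹ ∂μ) := by
    rw [intervalIntegral.integral_of_le hT, integral_Ioc_eq_integral_Ioo,
      ofReal_integral_eq_lintegral_ofReal]
    · refine setLIntegral_congr_fun measurableSet_Ioo fun t ht => ?_
      have ht' : t ∈ Icc 0 T := Ioo_subset_Icc_self ht
      change _ = ENNReal.ofReal (∫ x, semi L t (entProd L T g hε t) x * (bke L T g 0 x)⁻¹ ∂μ)
      rw [ofReal_integral_eq_lintegral_ofReal (integrable_mul_of_abs_le hw hD (hC t ht'))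
        (ae_of_all _ (hV0 t ht'))]
      exact lintegral_baseLaw ht'.1 (entProd_nonneg H.mem hε t)
    · exact (hVcont.integrableOn_Icc).mono_set Ioo_subset_Icc_self
    · filter_upwards [ae_restrict_mem measurableSet_Ioo] with t ht
      exact integral_nonneg (hV0 t (Ioo_subset_Icc_self ht))
  have hUT : ∫ x, semi L T (entBke L T g hε T) x * (bke L T g 0 x)⁻¹ ∂μ ≤ 0 := by
    refine integral_nonpos fun x => mul_nonpos_of_nonpos_of_nonneg ?_ (hw0 x)
    have := semi_mono L hT (u := entBke L T g hε T) (v := 0) (fun x => by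
      rw [entBke_apply H.mem]
      exact entApprox_nonpos hε (bke_mem L T H.mem T x)) x
    rwa [map_zero] at this
  -- Terminal entropy and total production telescope, leaving minus the regularized entropy at time
  -- 0, which `neg_entBke_zero_le` compares with -log h₀.
  rw [e1, e2, ← hftc, ← ENNReal.ofReal_add (neg_nonneg.2 hUT)]
  · refine ENNReal.ofReal_le_ofReal ?_
    have h := integral_mono (hUi 0 ⟨le_rfl, hT⟩).neg
      (H.integrable_log.neg.add (integrable_const (entSlope ε))) (fun x => by
        simpa using H.neg_entBke_zero_le hε x)
    simp only [Pi.neg_apply, Pi.add_apply, integral_neg] at h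
    have e3 : ∫ x, (-Real.log (bke L T g 0 x) + entSlope ε) ∂μ =
        ∫ x, -Real.log (bke L T g 0 x) ∂μ + ∫ _, entSlope ε ∂μ :=
      integral_add H.integrable_log.neg (integrable_const _)
    rw [e3] at h
    simp only [integral_const, probReal_univ, one_smul] at h
    linarith
  · rw [hftc]
    exact intervalIntegral.integral_nonneg hT fun t ht => integral_nonneg (hV0 t ht)

/-- With g = e^{-f}, the limit -g log g equals g f, also where f = ∞, since then g = 0 and 0 · ∞ =
0. Fatou concludes. -/
lemma lintegral_terminal_le (H : IsDoobTransform L T g μ) {f : Γ → ℝ≥0∞} (hf : Measurable f)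
    (hgf : ∀ x, g x = expNeg f x) {e : ℕ → ℝ} (he : ∀ n, 0 < e n) (hlim : Tendsto e atTop (𝓝 0)) :
    ∫⁻ x, f x ∂(condLaw L T g μ T) ≤ liminf (fun n =>
      ∫⁻ x, ENNReal.ofReal (-entBke L T g (he n) T x) ∂(baseLaw L T g μ T)) atTop := by
  have h1 : ∀ x, ENNReal.ofReal (bke L T g T x) * f x = liminf (fun n =>
      ENNReal.ofReal (-entBke L T g (he n) T x)) atTop := fun x => by
    simp only [entBke_apply H.mem, bke_terminal]
    have h2 := ENNReal.tendsto_ofReal ((tendsto_entApprox (g x)).comp hlim).neg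
    have h3 := h2.liminf_eq
    refine Eq.trans ?_ h3.symm
    rw [hgf]
    by_cases h : f x = ⊤
    · simp [expNeg_of_eq_top h]
    · rw [expNeg_of_ne_top h, Real.log_exp, mul_neg, neg_neg, ENNReal.ofReal_mul (Real.exp_pos _).le,
        ENNReal.ofReal_toReal h]
  rw [condLaw, lintegral_withDensity_eq_lintegral_mul _ (bke L T g T).measurable.ennreal_ofReal hf]
  simp only [Pi.mul_apply, h1]
  exact lintegral_liminf_le fun n => (entBke L T g (he n) T).measurable.neg.ennreal_ofReal

lemma klDiv_condFlux (H : IsDoobTransform L T g μ) {t : ℝ} (ht : t ∈ Ico 0 T) :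
    klDiv (condFlux L T g μ t) (condLaw L T g μ t ⊗ₘ L) =
      ∫⁻ z, ENNReal.ofReal (klFun (Real.exp (dgrad (fun x => Real.log (bke L T g t x)) z)))
        ∂(condLaw L T g μ t ⊗ₘ L) := by
  have := H.isFiniteMeasure_condFlux ht
  have := H.isProbabilityMeasure_condLaw (Ico_subset_Icc_self ht)
  have hm := (measurable_exp_dgrad (L := L) (T := T) (g := g) t).ennreal_ofReal
  rw [klDiv_eq_lintegral_klFun_of_ac 
    (show condFlux L T g μ t ≪ _ from withDensity_absolutelyContinuous _ _)]
  refine lintegral_congr_ae ?_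
  filter_upwards [Measure.rnDeriv_withDensity (condLaw L T g μ t ⊗ₘ L) hm] with z hz
  rw [condFlux, expFlux, hz, ENNReal.toReal_ofReal (Real.exp_pos _).le]

/-- As ε → 0 the Bregman divergence tends to h(x) `klFun` (h(y)/h(x)), the entropy density relative
to the base law. Fatou is applied once for L(x, ·) and once for the base law. -/
lemma klDiv_condFlux_le (H : IsDoobTransform L T g μ) {e : ℕ → ℝ} (he : ∀ n, 0 < e n)
    (hlim : Tendsto e atTop (𝓝 0)) {t : ℝ} (ht : t ∈ Ico 0 T) :
    klDiv (condFlux L T g μ t) (condLaw L T g μ t ⊗ₘ L) ≤ liminf (fun n =>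
      ∫⁻ x, ENNReal.ofReal (entProd L T g (he n) t x) ∂(baseLaw L T g μ t)) atTop := by
  have hm : Measurable fun z : Γ × Γ => ENNReal.ofReal
      (klFun (Real.exp (dgrad (fun x => Real.log (bke L T g t x)) z))) :=
    (measurable_klFun.comp (measurable_exp_dgrad t)).ennreal_ofReal
  have h1 : ∀ x y, ENNReal.ofReal (bke L T g t x) * ENNReal.ofReal
      (klFun (Real.exp (dgrad (fun x => Real.log (bke L T g t x)) (x, y)))) = liminf (fun n =>
        ENNReal.ofReal (bregman (e n) (bke L T g t x) (bke L T g t y))) atTop := fun x y => by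
    have h2 := ENNReal.tendsto_ofReal
      ((tendsto_bregman (H.pos t ht x) (bke L T g t y)).comp hlim)
    refine Eq.trans ?_ h2.liminf_eq.symm
    rw [H.exp_dgrad_log ht, ENNReal.ofReal_mul (H.pos t ht x).le]
  rw [H.klDiv_condFlux ht, H.lintegral_condLaw_compProd (Ico_subset_Icc_self ht) hm]
  simp only [h1]
  refine (lintegral_mono fun x => lintegral_liminf_le fun n => ?_).trans ?_
  · unfold bregman
    exact (measurable_const.mul (measurable_klFun.comp
      (((bke L T g t).measurable.add_const _).div_const _))).ennreal_ofReal
  · simp only [fun n x => (ofReal_entProd (L := L) (T := T) H.mem (he n) t x).symm]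
    exact lintegral_liminf_le fun n => (entProd L T g (he n) t).measurable.ennreal_ofReal

/-- The Doob transform attains the lower bound on the cost. -/
lemma cost_pair_le (H : IsDoobTransform L T g μ) {f : Γ → ℝ≥0∞} (hf : Measurable f)
    (hgf : ∀ x, g x = expNeg f x) :
    cost L T f H.pair ≤ ENNReal.ofReal (∫ x, -Real.log (bke L T g 0 x) ∂μ) := by
  set e : ℕ → ℝ := fun n => 1 / ((n : ℝ) + 1) with he_def
  have he : ∀ n, 0 < e n := fun n => by positivity
  have hlim : Tendsto e atTop (𝓝 0) := tendsto_one_div_add_atTop_nhds_zero_nat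
  have hT := H.time_pos.le
  set A : ℕ → ℝ≥0∞ := fun n =>
    ∫⁻ x, ENNReal.ofReal (-entBke L T g (he n) T x) ∂(baseLaw L T g μ T) with hA
  set B : ℕ → ℝ → ℝ≥0∞ := fun n t =>
    ∫⁻ x, ENNReal.ofReal (entProd L T g (he n) t x) ∂(baseLaw L T g μ t) with hB
  have h1 : ∫⁻ x, f x ∂(H.pair.p T : Measure Γ) ≤ liminf A atTop := by
    rw [H.pair_p ⟨hT, le_rfl⟩]
    exact H.lintegral_terminal_le hf hgf he hlim
  have hBm : ∀ n, AEMeasurable (B n) (volume.restrict (Ioo 0 T)) := fun n => by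
    obtain ⟨C, hC⟩ := H.abs_semi_entProd_le (he n)
    have hD := H.integrable_jumpBound.const_mul C
    have hc := continuousOn_integral_mul (measurable_inv L T g)
      (continuous_semi_apply (L := L) (continuous_entProd (L := L) (T := T) H.mem (he n))) hD hC
    refine (((hc.mono Ioo_subset_Icc_self).aemeasurable measurableSet_Ioo).ennreal_ofReal).congr ?_
    filter_upwards [ae_restrict_mem measurableSet_Ioo] with t ht
    have ht' := Ioo_subset_Icc_self ht
    rw [ofReal_integral_eq_lintegral_ofReal
      (integrable_mul_of_abs_le (measurable_inv L T g) hD (hC t ht'))]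
    · exact (lintegral_baseLaw ht'.1 (entProd_nonneg H.mem (he n) t)).symm
    · exact ae_of_all _ fun x => mul_nonneg (semi_nonneg L ht'.1 (entProd_nonneg H.mem (he n) t) x)
        (inv_nonneg.2 (bke_mem L T H.mem 0 x).1)
  have h2 : action L T H.pair ≤ liminf (fun n => ∫⁻ t in Ioo 0 T, B n t) atTop := by
    refine le_trans ?_ (lintegral_liminf_le' hBm)
    refine setLIntegral_mono_ae' measurableSet_Ioo (ae_of_all _ fun t ht => ?_)
    have ht' := Ioo_subset_Ico_self ht
    rw [H.pair_q ht', H.pair_p (Ico_subset_Icc_self ht')]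
    exact H.klDiv_condFlux_le he hlim ht'
  have h3 : Tendsto (fun n => ENNReal.ofReal (∫ x, -Real.log (bke L T g 0 x) ∂μ + entSlope (e n)))
      atTop (𝓝 (ENNReal.ofReal (∫ x, -Real.log (bke L T g 0 x) ∂μ))) := by
    have := ENNReal.tendsto_ofReal ((tendsto_entSlope.comp hlim).const_add
      (∫ x, -Real.log (bke L T g 0 x) ∂μ))
    rwa [add_zero] at this
  calc cost L T f H.pair ≤ liminf A atTop + liminf (fun n => ∫⁻ t in Ioo 0 T, B n t) atTop :=
        add_le_add h1 h2
    _ ≤ liminf (fun n => A n + ∫⁻ t in Ioo 0 T, B n t) atTop := le_liminf_add_ennreal _ _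
    _ ≤ liminf (fun n => ENNReal.ofReal (∫ x, -Real.log (bke L T g 0 x) ∂μ + entSlope (e n)))
        atTop := liminf_le_liminf (Eventually.of_forall fun n => H.entropy_balance_le (he n))
    _ = _ := h3.liminf_eq

end IsDoobTransform

end Production

end JumpControl
end

/-! ### Tightness in Young's inequality and the optimal flux. -/

noncomputable section

namespace JumpControl

variable {Γ : Type*} [MeasurableSpace Γ]


open InformationTheory

section MeasurableKlDiv

variable {α β : Type*} [MeasurableSpace α] [MeasurableSpace β]

/-- The relative entropy of two kernels is measurable in the parameter. -/
lemma measurable_klDiv_kernel [MeasurableSpace.CountableOrCountablyGenerated α β]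
    (κ η : Kernel α β) [IsFiniteKernel κ] [IsFiniteKernel η] :
    Measurable fun a => klDiv (κ a) (η a) := by
  classical
  have hs := Kernel.measurableSet_absolutelyContinuous κ η
  have hm : Measurable fun a =>
      ∫⁻ z, ENNReal.ofReal (klFun (Kernel.rnDeriv κ η a z).toReal) ∂(η a) := by
    refine Measurable.lintegral_kernel_prod_right'
      (f := fun z : α × β => ENNReal.ofReal (klFun (Kernel.rnDeriv κ η z.1 z.2).toReal)) ?_
    exact (measurable_klFun.comp (Kernel.measurable_rnDeriv κ η).ennreal_toReal).ennreal_ofReal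
  convert hm.piecewise hs (measurable_const (a := ⊤)) using 1
  ext a
  by_cases ha : κ a ≪ η a
  · rw [piecewise_eq_of_mem _ _ _ (show a ∈ {a | κ a ≪ η a} from ha),
      klDiv_eq_lintegral_klFun_of_ac ha]
    refine lintegral_congr_ae ?_
    filter_upwards [Kernel.rnDeriv_eq_rnDeriv_measure (κ := κ) (η := η) (a := a)] with z hz
    rw [hz]
  · rw [piecewise_eq_of_notMem _ _ _ (show a ∉ {a | κ a ≪ η a} from ha),
      klDiv_of_not_ac ha]

/-- The relative entropy is measurable in the parameter, without a uniform bound on the mass of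
the first kernel. -/
lemma measurable_klDiv_kernel_of_isFiniteMeasure
    [MeasurableSpace.CountableOrCountablyGenerated α β]
    (κ η : Kernel α β) (hκ : ∀ a, IsFiniteMeasure (κ a)) [IsFiniteKernel η] :
    Measurable fun a => klDiv (κ a) (η a) := by
  classical
  have hs : ∀ n : ℕ, MeasurableSet {a | κ a univ ≤ n} := fun n =>
    measurableSet_le (κ.measurable_coe MeasurableSet.univ) measurable_const
  have hfin : ∀ n, IsFiniteKernel (Kernel.piecewise (hs n) κ 0) := fun n =>
    ⟨n, ENNReal.natCast_lt_top n, fun a => by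
      rw [Kernel.piecewise_apply]
      split_ifs with h
      · exact h
      · simp⟩
  refine measurable_of_tendsto_metrizable (fun n => measurable_klDiv_kernel
    (Kernel.piecewise (hs n) κ 0) η) (tendsto_pi_nhds.2 fun a => ?_)
  obtain ⟨N, hN⟩ := ENNReal.exists_nat_gt (measure_ne_top (κ a) univ)
  refine tendsto_const_nhds.congr' ?_
  filter_upwards [eventually_ge_atTop N] with n hn
  rw [Kernel.piecewise_apply, if_pos]
  exact hN.le.trans (by exact_mod_cast hn)

end MeasurableKlDiv

section Uniqueness

set_option linter.unusedSectionVars false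

variable {L : Kernel Γ Γ} [IsFiniteKernel L] {T : ℝ} {g : Bdd Γ} {μ : Measure Γ}
  {P : DensityFlux Γ}

/-- The density of an admissible pair as a Markov kernel. -/
def IsAdmissible.densityKernel (hP : IsAdmissible L T μ P) (hT : 0 ≤ T) : Kernel ℝ Γ where
  toFun t := (P.p (clampTime T t) : Measure Γ)
  measurable' := by
    refine Measure.measurable_of_measurable_coe _ fun A hA => ?_
    have h := ((hP.setwise_continuous A hA).comp_continuous (continuous_clampTime T)
      (clampTime_mem hT)).measurable.ennreal_ofReal
    convert h using 1
    ext t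
    exact (ENNReal.ofReal_toReal (measure_ne_top _ A)).symm

lemma IsAdmissible.measurable_klDiv [MeasurableSpace.CountablyGenerated Γ]
    (hP : IsAdmissible L T μ P) (hT : 0 ≤ T) :
    AEMeasurable (fun t => klDiv (P.q t) ((P.p t : Measure Γ) ⊗ₘ L))
      (volume.restrict (Ioo 0 T)) := by
  have hk : IsMarkovKernel (hP.densityKernel hT) :=
    ⟨fun t => (inferInstance : IsProbabilityMeasure (P.p (clampTime T t) : Measure Γ))⟩
  set η : Kernel ℝ (Γ × Γ) := hP.densityKernel hT ⊗ₖ L.prodMkLeft ℝ with hη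
  have h := measurable_klDiv_kernel_of_isFiniteMeasure P.q η P.finite_q
  refine ⟨_, h, ?_⟩
  filter_upwards [ae_restrict_mem measurableSet_Ioo] with t ht
  have e : η t = (P.p t : Measure Γ) ⊗ₘ L := by
    rw [hη, Kernel.compProd_apply_eq_compProd_sectR]
    change (P.p (clampTime T t) : Measure Γ) ⊗ₘ _ = _
    rw [clampTime_of_mem (Ioo_subset_Icc_self ht)]
    rfl
  rw [e]

/-- If the regularized dual bounds of the relative entropy are tight along a sequence, the flux is
the exponential flux. -/
lemma eq_withDensity_of_liminf_eq_zero {X : Type*} [MeasurableSpace X] {α β : Measure X}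
    [IsFiniteMeasure α] [IsFiniteMeasure β] (h : klDiv α β ≠ ⊤) {ξ : ℕ → X → ℝ}
    (hξ : ∀ n, IsBddMeas (ξ n)) {ζ : X → ℝ} (hlim : ∀ z, Tendsto (fun n => ξ n z) atTop (𝓝 (ζ z)))
    (h0 : liminf (fun n => ENNReal.ofReal ((klDiv α β).toReal - dualPairing α β (ξ n))) atTop = 0) :
    α = β.withDensity fun z => ENNReal.ofReal (Real.exp (ζ z)) := by
  set s : X → ℝ := fun z => (α.rnDeriv β z).toReal with hs
  have hsm : Measurable s := (Measure.measurable_rnDeriv α β).ennreal_toReal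
  have hm : ∀ n, Measurable fun z => Real.exp (ξ n z) * klFun (s z * Real.exp (-ξ n z)) := fun n =>
    (hξ n).1.exp.mul (measurable_klFun.comp (hsm.mul (hξ n).1.neg.exp))
  have hnn : ∀ n z, 0 ≤ Real.exp (ξ n z) * klFun (s z * Real.exp (-ξ n z)) := fun n z =>
    mul_nonneg (Real.exp_pos _).le
      (klFun_nonneg (mul_nonneg ENNReal.toReal_nonneg (Real.exp_pos _).le))
  have e1 : ∀ n, ENNReal.ofReal ((klDiv α β).toReal - dualPairing α β (ξ n)) =
      ∫⁻ z, ENNReal.ofReal (Real.exp (ξ n z) * klFun (s z * Real.exp (-ξ n z))) ∂β := fun n => by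
    obtain ⟨hi, he⟩ := toReal_klDiv_eq_dualPairing_add h (hξ n)
    rw [he, add_sub_cancel_left, ofReal_integral_eq_lintegral_ofReal hi (ae_of_all _ (hnn n))]
  have e2 : ∀ z, liminf (fun n =>
      ENNReal.ofReal (Real.exp (ξ n z) * klFun (s z * Real.exp (-ξ n z)))) atTop =
      ENNReal.ofReal (Real.exp (ζ z) * klFun (s z * Real.exp (-ζ z))) := fun z =>
    Tendsto.liminf_eq (ENNReal.tendsto_ofReal ((Real.continuous_exp.tendsto _).comp (hlim z) |>.mul
      ((continuous_klFun.tendsto _).comp (((Real.continuous_exp.tendsto _).comp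
        (hlim z).neg).const_mul (s z)))))
  -- By Fatou the limiting Young defect has zero integral, so it vanishes almost everywhere and the
  -- density is e^ζ.
  have hle : ∫⁻ z, ENNReal.ofReal (Real.exp (ζ z) * klFun (s z * Real.exp (-ζ z))) ∂β ≤ 0 := by
    simp only [← e2]
    refine (lintegral_liminf_le fun n => (hm n).ennreal_ofReal).trans ?_
    simp only [← e1, h0, le_refl]
  have hζ : Measurable ζ := measurable_of_tendsto_metrizable (fun n => (hξ n).1)
    (tendsto_pi_nhds.2 hlim)
  have hz := (lintegral_eq_zero_iff (hζ.exp.mul (measurable_klFun.comp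
    (hsm.mul hζ.neg.exp))).ennreal_ofReal).1 (le_antisymm hle zero_le)
  have hac : α ≪ β := (klDiv_ne_top_iff.1 h).1
  rw [← Measure.withDensity_rnDeriv_eq α β hac]
  refine withDensity_congr_ae ?_
  filter_upwards [hz, Measure.rnDeriv_ne_top α β] with z hz htop
  have h1 : Real.exp (ζ z) * klFun (s z * Real.exp (-ζ z)) ≤ 0 := ENNReal.ofReal_eq_zero.1 hz
  have h2 : 0 ≤ s z * Real.exp (-ζ z) := mul_nonneg ENNReal.toReal_nonneg (Real.exp_pos _).le
  have h3 : klFun (s z * Real.exp (-ζ z)) = 0 :=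
    le_antisymm (nonpos_of_mul_nonpos_right h1 (Real.exp_pos _)) (klFun_nonneg h2)
  rw [klFun_eq_zero_iff h2, Real.exp_neg, ← div_eq_mul_inv, div_eq_one_iff_eq (Real.exp_pos _).ne']
    at h3
  rw [← h3, ENNReal.ofReal_toReal htop]

/-- The flux of a pair whose cost does not exceed the lower bound is the exponential flux. -/
lemma IsAdmissible.ae_eq_expFlux [IsProbabilityMeasure μ] [MeasurableSpace.CountablyGenerated Γ]
    (hP : IsAdmissible L T μ P) (H : IsDoobTransform L T g μ) {f : Γ → ℝ≥0∞}
    (hgf : ∀ x, g x = expNeg f x)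
    (hcost : cost L T f P ≤ ENNReal.ofReal (∫ x, -Real.log (bke L T g 0 x) ∂μ)) :
    ∀ᵐ t ∂(volume.restrict (Ioo 0 T)),
      P.q t = expFlux L (fun x => Real.log (bke L T g t x)) (P.p t : Measure Γ) := by
  have hT := H.time_pos.le
  set e : ℕ → ℝ := fun n => 1 / ((n : ℝ) + 1) with he_def
  have he : ∀ n, 0 < e n := fun n => by positivity
  have hlim : Tendsto e atTop (𝓝 0) := tendsto_one_div_add_atTop_nhds_zero_nat
  have hKm := hP.measurable_klDiv hT
  have hKt : ∀ᵐ t ∂(volume.restrict (Ioo 0 T)), klDiv (P.q t) ((P.p t : Measure Γ) ⊗ₘ L) < ⊤ :=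
    ae_lt_top' hKm hP.finite_action.ne
  set K : ℝ → ℝ := fun t => (klDiv (P.q t) ((P.p t : Measure Γ) ⊗ₘ L)).toReal with hK
  have hKi : Integrable K (volume.restrict (Ioo 0 T)) :=
    integrable_toReal_of_lintegral_ne_top hKm hP.finite_action.ne
  set D : ℕ → ℝ → ℝ := fun n t =>
    dualPairing (P.q t) ((P.p t : Measure Γ) ⊗ₘ L) (dgrad (logBke L T g (he n) t)) with hD
  have hD1 := fun n => hP.integral_logBke_sub hT H.mem (he n)
  have hDi : ∀ n, Integrable (D n) (volume.restrict (Ioo 0 T)) := fun n =>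
    (intervalIntegrable_iff_integrableOn_Ioo_of_le hT).1 (hD1 n).1
  have hDK : ∀ n, 0 ≤ᵐ[volume.restrict (Ioo 0 T)] fun t => K t - D n t := fun n => by
    filter_upwards [hKt] with t ht
    have := P.finite_q t
    have h1 := ofReal_dualPairing_le_klDiv (α := P.q t) (β := (P.p t : Measure Γ) ⊗ₘ L)
      (logBke L T g (he n) t).isBddMeas.dgrad
    exact sub_nonneg.2 ((ENNReal.ofReal_le_iff_le_toReal ht.ne).1 h1)
  have hlog0 : ∀ x, Real.log (bke L T g 0 x) ≤ 0 := fun x =>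
    Real.log_nonpos (bke_mem L T H.mem 0 x).1 (bke_mem L T H.mem 0 x).2
  -- The total Young gap is the action minus the increment of the test function. The cost bound,
  -- with the terminal regularization below f, leaves only the regularization error at time 0.
  have hI : ∀ n, ∫ t in Ioo 0 T, (K t - D n t) ≤
      ∫ x, logBke L T g (he n) 0 x ∂μ - ∫ x, Real.log (bke L T g 0 x) ∂μ := fun n => by
    rw [integral_sub hKi (hDi n)]
    have e1 : ∫ t in Ioo 0 T, D n t = ∫ x, logBke L T g (he n) T x ∂(P.p T : Measure Γ) -
        ∫ x, logBke L T g (he n) 0 x ∂μ := by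
      rw [(hD1 n).2, intervalIntegral.integral_of_le hT, integral_Ioc_eq_integral_Ioo]
    have hn : ∀ x, 0 ≤ -logBke L T g (he n) T x := fun x => by
      rw [logBke_apply L T H.mem]
      exact neg_nonneg.2 (logApprox_nonpos (he n) (bke_mem L T H.mem T x))
    have e2 : ENNReal.ofReal (-∫ x, logBke L T g (he n) T x ∂(P.p T : Measure Γ)) ≤
        ∫⁻ x, f x ∂(P.p T : Measure Γ) := by
      rw [← integral_neg]
      refine (ofReal_integral_le_lintegral_ofReal _ _).trans (lintegral_mono ?_)
      exact ofReal_neg_logBke_terminal_le hgf H.mem (he n)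
    have e3 : action L T P = ENNReal.ofReal (∫ t in Ioo 0 T, K t) := by
      rw [ofReal_integral_eq_lintegral_ofReal hKi (ae_of_all _ fun t => ENNReal.toReal_nonneg)]
      refine lintegral_congr_ae ?_
      filter_upwards [hKt] with t ht
      exact (ENNReal.ofReal_toReal ht.ne).symm
    have e4 := (add_le_add e2 e3.ge).trans hcost
    have hn' : 0 ≤ -∫ x, logBke L T g (he n) T x ∂(P.p T : Measure Γ) := by
      rw [← integral_neg]
      exact integral_nonneg hn
    rw [← ENNReal.ofReal_add hn' (integral_nonneg fun t => ENNReal.toReal_nonneg),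
      ENNReal.ofReal_le_ofReal_iff (integral_nonneg fun x => neg_nonneg.2 (hlog0 x)),
      integral_neg] at e4
    rw [e1]
    linarith
  have hlim2 : Tendsto (fun n => ∫ x, logBke L T g (he n) 0 x ∂μ - ∫ x, Real.log (bke L T g 0 x) ∂μ)
      atTop (𝓝 0) := by
    have h : Tendsto (fun n => ∫ x, logBke L T g (he n) 0 x ∂μ) atTop
        (𝓝 (∫ x, Real.log (bke L T g 0 x) ∂μ)) := by
      refine tendsto_integral_of_dominated_convergence (fun x => -Real.log (bke L T g 0 x))
        (fun n => (logBke L T g (he n) 0).measurable.aestronglyMeasurable) H.integrable_log.neg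
        (fun n => ae_of_all _ fun x => ?_) (ae_of_all _ fun x => ?_)
      · have hx := bke_mem L T H.mem 0 x
        rw [logBke_apply L T H.mem, Real.norm_eq_abs, abs_of_nonpos (logApprox_nonpos (he n) hx)]
        exact neg_le_neg (log_le_logApprox (he n) (H.pos 0 H.zero_mem x) hx.2)
      · simp only [logBke_apply L T H.mem]
        exact (tendsto_logApprox (H.pos 0 H.zero_mem x)).comp hlim
    simpa using h.sub_const (∫ x, Real.log (bke L T g 0 x) ∂μ)
  -- The lower limit of the gaps vanishes for almost every time by Fatou; no subsequence has to be
  -- extracted.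
  have hF : ∫⁻ t in Ioo 0 T, liminf (fun n => ENNReal.ofReal (K t - D n t)) atTop ≤ 0 := by
    refine (lintegral_liminf_le' fun n =>
      (hKi.sub (hDi n)).aestronglyMeasurable.aemeasurable.ennreal_ofReal).trans ?_
    have h1 : ∀ n, ∫⁻ t in Ioo 0 T, ENNReal.ofReal (K t - D n t) ≤ ENNReal.ofReal
        (∫ x, logBke L T g (he n) 0 x ∂μ - ∫ x, Real.log (bke L T g 0 x) ∂μ) := fun n => by
      refine (ofReal_integral_eq_lintegral_ofReal (hKi.sub (hDi n)) (hDK n)).symm.le.trans ?_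
      exact ENNReal.ofReal_le_ofReal (hI n)
    have h2 := (ENNReal.tendsto_ofReal hlim2).liminf_eq
    rw [ENNReal.ofReal_zero] at h2
    rw [← h2]
    exact liminf_le_liminf (Eventually.of_forall h1)
  have hL : ∀ᵐ t ∂(volume.restrict (Ioo 0 T)),
      liminf (fun n => ENNReal.ofReal (K t - D n t)) atTop = 0 := by
    refine (lintegral_eq_zero_iff' ?_).1 (le_antisymm hF zero_le)
    simp only [liminf_eq_iSup_iInf_of_nat]
    refine AEMeasurable.iSup fun n => AEMeasurable.biInf _ (to_countable _) fun n _ => ?_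
    exact (hKi.sub (hDi n)).aestronglyMeasurable.aemeasurable.ennreal_ofReal
  filter_upwards [hL, hKt, ae_restrict_mem measurableSet_Ioo] with t h0 htop ht
  have := P.finite_q t
  refine eq_withDensity_of_liminf_eq_zero htop.ne
    (fun n => (logBke L T g (he n) t).isBddMeas.dgrad) (fun z => ?_) h0
  have h1 : ∀ x, Tendsto (fun n => logBke L T g (he n) t x) atTop
      (𝓝 (Real.log (bke L T g t x))) := fun x => by
    simp only [logBke_apply L T H.mem]
    exact (tendsto_logApprox (H.pos t ⟨ht.1.le, ht.2⟩ x)).comp hlim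
  exact (h1 z.2).sub (h1 z.1)

end Uniqueness

end JumpControl
end

/-! ### Exponential flux determines the marginals. -/

noncomputable section

namespace JumpControl

variable {Γ : Type*} [MeasurableSpace Γ]


section Residual

variable {ε : ℝ}

/-- The density of the time derivative of a regularized ratio along the exponential flux. -/
def residual (ε a b u v : ℝ) : ℝ :=
  -(v - u) * (a + ε)⁻¹ + u * (((a + ε) ^ 2)⁻¹ * (b - a)) +
    b / a * (v * (b + ε)⁻¹ - u * (a + ε)⁻¹)

/-- The bound M on u/a and v/b makes the three terms at most M(1 + b/a), M(1 + b/a) and 2M b/a,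
uniformly in ε. As b/a is the flux density, the bound is integrable along the pair. -/
lemma abs_residual_le (hε : 0 < ε) {a b u v M : ℝ} (ha : 0 < a) (hb : 0 < b) (hu : |u| ≤ M * a)
    (hv : |v| ≤ M * b) : |residual ε a b u v| ≤ 4 * M * (1 + b / a) := by
  have hM : 0 ≤ M := nonneg_of_mul_nonneg_left ((abs_nonneg u).trans hu) ha
  have ha' : 0 < a + ε := by positivity
  have hb' : 0 < b + ε := by positivity
  have hba : 0 < b / a := by positivity
  have k : ∀ c : ℝ, 0 ≤ c → c * (a + ε)⁻¹ ≤ c / a := fun c hc => by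
    rw [← div_eq_mul_inv]
    exact div_le_div_of_nonneg_left hc ha (by linarith)
  have hu1 : |u * (a + ε)⁻¹| ≤ M := by
    rw [abs_mul, abs_of_pos (inv_pos.2 ha')]
    refine (k _ (abs_nonneg u)).trans ?_
    rwa [div_le_iff₀ ha]
  have hv1 : |v * (b + ε)⁻¹| ≤ M := by
    rw [abs_mul, abs_of_pos (inv_pos.2 hb'), ← div_eq_mul_inv, div_le_iff₀ hb']
    nlinarith
  have h1 : |-(v - u) * (a + ε)⁻¹| ≤ M * (1 + b / a) := by
    rw [abs_mul, abs_neg, abs_of_pos (inv_pos.2 ha')]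
    refine (k _ (abs_nonneg _)).trans ?_
    rw [div_le_iff₀ ha, mul_assoc, add_mul, one_mul, div_mul_cancel₀ _ ha.ne']
    linarith [abs_sub v u]
  have h2 : |u * (((a + ε) ^ 2)⁻¹ * (b - a))| ≤ M * (1 + b / a) := by
    have e : u * (((a + ε) ^ 2)⁻¹ * (b - a)) = u * (a + ε)⁻¹ * ((b - a) * (a + ε)⁻¹) := by
      rw [sq, mul_inv]; ring
    rw [e, abs_mul]
    refine mul_le_mul hu1 ?_ (abs_nonneg _) hM
    rw [abs_mul, abs_of_pos (inv_pos.2 ha')]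
    refine (k _ (abs_nonneg _)).trans ?_
    rw [div_le_iff₀ ha, add_mul, one_mul, div_mul_cancel₀ _ ha.ne']
    have := abs_sub b a
    rw [abs_of_pos ha, abs_of_pos hb] at this
    linarith
  have h3 : |b / a * (v * (b + ε)⁻¹ - u * (a + ε)⁻¹)| ≤ b / a * (2 * M) := by
    rw [abs_mul, abs_of_pos hba]
    refine mul_le_mul_of_nonneg_left ?_ hba.le
    linarith [abs_sub (v * (b + ε)⁻¹) (u * (a + ε)⁻¹)]
  have h4 := abs_add_le (-(v - u) * (a + ε)⁻¹ + u * (((a + ε) ^ 2)⁻¹ * (b - a)))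
    (b / a * (v * (b + ε)⁻¹ - u * (a + ε)⁻¹))
  have h5 := abs_add_le (-(v - u) * (a + ε)⁻¹) (u * (((a + ε) ^ 2)⁻¹ * (b - a)))
  rw [residual]
  nlinarith

/-- At ε = 0 the terms cancel identically: a ratio of two backward solutions is space-time harmonic
for the conditioned generator. -/
lemma tendsto_residual {a b : ℝ} (ha : 0 < a) (hb : 0 < b) (u v : ℝ) :
    Tendsto (fun ε => residual ε a b u v) (𝓝 0) (𝓝 0) := by
  have h : ContinuousAt (fun ε => residual ε a b u v) 0 := by
    have ha' : ContinuousAt (fun ε : ℝ => (a + ε)⁻¹) 0 :=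
      ContinuousAt.inv₀ (by fun_prop) (by simpa using ha.ne')
    have hb' : ContinuousAt (fun ε : ℝ => (b + ε)⁻¹) 0 :=
      ContinuousAt.inv₀ (by fun_prop) (by simpa using hb.ne')
    have ha2 : ContinuousAt (fun ε : ℝ => ((a + ε) ^ 2)⁻¹) 0 :=
      ContinuousAt.inv₀ (by fun_prop) (by simpa using ha.ne')
    unfold residual
    fun_prop
  have e : residual 0 a b u v = 0 := by
    simp only [residual, add_zero]
    field_simp
    ring
  rwa [ContinuousAt, e] at h

lemma measurable_residual {X : Type*} [MeasurableSpace X] {a b u v : X → ℝ} (ha : Measurable a)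
    (hb : Measurable b) (hu : Measurable u) (hv : Measurable v) (ε : ℝ) :
    Measurable fun z => residual ε (a z) (b z) (u z) (v z) := by
  unfold residual
  fun_prop

lemma hasDerivAt_neg_inv_add_sq (hε : 0 < ε) {a : ℝ} (ha : a ∈ Icc (0 : ℝ) 1) :
    HasDerivAt (fun u : ℝ => -((u + ε) ^ 2)⁻¹) (2 * (a + ε) * (((a + ε) ^ 2) ^ 2)⁻¹) a := by
  have hp := add_pos_of_mem hε ha
  have h := ((((hasDerivAt_id a).add_const ε).fun_pow 2).fun_inv (pow_ne_zero 2 hp.ne')).fun_neg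
  refine h.congr_deriv ?_
  simp only [id]
  field_simp
  norm_num
  ring

lemma actsOnUnit_inv_add_cube (hε : 0 < ε) :
    ActsOnUnit fun u => 2 * (u + ε) * (((u + ε) ^ 2) ^ 2)⁻¹ := by
  refine ⟨by fun_prop, ContinuousOn.mul (by fun_prop) ?_⟩
  exact ContinuousOn.inv₀ (by fun_prop) fun a ha =>
    pow_ne_zero 2 (pow_ne_zero 2 (add_pos_of_mem hε ha).ne')

end Residual

section ExpFlux

variable {L : Kernel Γ Γ}

lemma integral_expFlux {ψ : Γ → ℝ} (hψ : Measurable ψ) {p : Measure Γ} [IsFiniteMeasure p]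
    (hfin : IsFiniteMeasure (expFlux L ψ p)) {χ : Γ × Γ → ℝ} (hχ : IsBddMeas χ) :
    Integrable (fun z => Real.exp (dgrad ψ z) * χ z) (p ⊗ₘ L) ∧
    ∫ z, χ z ∂(expFlux L ψ p) = ∫ z, Real.exp (dgrad ψ z) * χ z ∂(p ⊗ₘ L) := by
  have hm : Measurable fun z => ENNReal.ofReal (Real.exp (dgrad ψ z)) :=
    (((hψ.comp measurable_snd).sub (hψ.comp measurable_fst)).exp).ennreal_ofReal
  have ht : ∀ᵐ z ∂(p ⊗ₘ L), ENNReal.ofReal (Real.exp (dgrad ψ z)) < ⊤ :=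
    ae_of_all _ fun _ => ENNReal.ofReal_lt_top
  have hi : Integrable χ (expFlux L ψ p) := hχ.integrable _
  rw [expFlux] at hi ⊢
  rw [integrable_withDensity_iff_integrable_smul' hm ht] at hi
  rw [integral_withDensity_eq_integral_toReal_smul hm ht]
  simp only [ENNReal.toReal_ofReal (Real.exp_pos _).le, smul_eq_mul] at hi ⊢
  exact ⟨hi, trivial⟩

end ExpFlux

section Identification

set_option linter.unusedSectionVars false

variable (L : Kernel Γ Γ) [IsFiniteKernel L] (T : ℝ) (g : Bdd Γ) {μ : Measure Γ}
  {P : DensityFlux Γ} {ε : ℝ}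

/-- The regularized reciprocal of the backward solution. -/
def invBke (hε : 0 < ε) (t : ℝ) : Bdd Γ := superpose _ (actsOnUnit_inv_add hε) (bke L T g t)

/-- The time derivative of `u * invBke`, where `u` is a backward solution. -/
def ratioDeriv (hε : 0 < ε) (u : ℝ → Bdd Γ) (t : ℝ) : Bdd Γ :=
  -gen L (u t) * invBke L T g hε t + u t *
    (superpose _ (actsOnUnit_neg_inv_add_sq hε) (bke L T g t) * -gen L (bke L T g t))

variable {L T g}

lemma invBke_apply (hg : ∀ x, g x ∈ Icc (0 : ℝ) 1) (hε : 0 < ε) (t : ℝ) (x : Γ) :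
    invBke L T g hε t x = (bke L T g t x + ε)⁻¹ := superpose_apply _ (bke_mem L T hg t x)

lemma continuous_invBke (hg : ∀ x, g x ∈ Icc (0 : ℝ) 1) (hε : 0 < ε) :
    Continuous (invBke L T g hε) :=
  continuous_superpose _ (actsOnUnit_neg_inv_add_sq hε) (fun _ ha => hasDerivAt_inv_add hε ha)
    (continuous_bke L T g) (bke_mem L T hg)

lemma continuous_ratioDeriv (hg : ∀ x, g x ∈ Icc (0 : ℝ) 1) (hε : 0 < ε) {u : ℝ → Bdd Γ}
    (hu : Continuous u) : Continuous (ratioDeriv L T g hε u) :=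
  (Bdd.continuous_mul ((gen L).continuous.comp hu).neg (continuous_invBke hg hε)).add
    (Bdd.continuous_mul hu (Bdd.continuous_mul
      (continuous_superpose _ (actsOnUnit_inv_add_cube hε)
        (fun _ ha => hasDerivAt_neg_inv_add_sq hε ha) (continuous_bke L T g) (bke_mem L T hg))
      ((gen L).continuous.comp (continuous_bke L T g)).neg))

lemma hasDerivAt_mul_invBke (hg : ∀ x, g x ∈ Icc (0 : ℝ) 1) (hε : 0 < ε) {u : ℝ → Bdd Γ} {t : ℝ}
    (ht : t < T) (hu : HasDerivAt u (-gen L (u t)) t) :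
    HasDerivAt (fun r => u r * invBke L T g hε r) (ratioDeriv L T g hε u t) t :=
  Bdd.hasDerivAt_mul hu (hasDerivAt_superpose _ _ (actsOnUnit_inv_add_cube hε)
    (fun _ ha => hasDerivAt_inv_add hε ha) (fun _ ha => hasDerivAt_neg_inv_add_sq hε ha)
    (hasDerivAt_bke L T g ht) (bke_mem L T hg))

/-- The derivative of a regularized ratio along a density with exponential flux. -/
lemma integral_ratioDeriv_add (H : IsDoobTransform L T g μ) (hε : 0 < ε) (u : ℝ → Bdd Γ) {t : ℝ}
    (ht : t ∈ Ico 0 T) (p : Measure Γ) [IsProbabilityMeasure p]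
    (hfin : IsFiniteMeasure (expFlux L (fun x => Real.log (bke L T g t x)) p)) :
    ∫ x, ratioDeriv L T g hε u t x ∂p + ∫ z, dgrad (u t * invBke L T g hε t) z
        ∂(expFlux L (fun x => Real.log (bke L T g t x)) p) =
      ∫ z, residual ε (bke L T g t z.1) (bke L T g t z.2) (u t z.1) (u t z.2) ∂(p ⊗ₘ L) := by
  have hlog : Measurable fun x => Real.log (bke L T g t x) :=
    Real.measurable_log.comp (bke L T g t).measurable
  obtain ⟨hi, he⟩ := integral_expFlux hlog hfin (u t * invBke L T g hε t).isBddMeas.dgrad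
  set W : Γ × Γ → ℝ := fun z => -dgrad (u t) z * (invBke L T g hε t) z.1 + u t z.1 *
    (superpose _ (actsOnUnit_neg_inv_add_sq hε) (bke L T g t) z.1 * -dgrad (bke L T g t) z) with hW
  have b1 : IsBddMeas fun z : Γ × Γ => invBke L T g hε t z.1 :=
    (invBke L T g hε t).isBddMeas.comp measurable_fst
  have b2 : IsBddMeas fun z : Γ × Γ => u t z.1 := (u t).isBddMeas.comp measurable_fst
  have b3 : IsBddMeas fun z : Γ × Γ =>
      superpose _ (actsOnUnit_neg_inv_add_sq hε) (bke L T g t) z.1 :=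
    (superpose _ (actsOnUnit_neg_inv_add_sq hε) (bke L T g t)).isBddMeas.comp measurable_fst
  have b4 : ∀ v : Bdd Γ, IsBddMeas fun z => -dgrad v z := fun v => by
    have := (IsBddMeas.const (Γ := Γ × Γ) (-1)).mul v.isBddMeas.dgrad
    simpa using this
  have hWb : IsBddMeas W := ((b4 _).mul b1).add (b2.mul (b3.mul (b4 _)))
  have e1 : ∫ x, ratioDeriv L T g hε u t x ∂p = ∫ z, W z ∂(p ⊗ₘ L) := by
    rw [Measure.integral_compProd (hWb.integrable _)]
    congr 1
    ext x
    have i1 : ∀ v : Bdd Γ, Integrable (fun y => -dgrad v (x, y)) (L x) := fun v =>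
      ((b4 v).comp measurable_prodMk_left).integrable _
    simp only [hW]
    rw [integral_add ((i1 _).mul_const _) (((i1 _).const_mul _).const_mul _),
      integral_mul_const, integral_const_mul, integral_const_mul, integral_neg, integral_neg,
      ← gen_apply', ← gen_apply']
    rfl
  rw [e1, he, ← integral_add (hWb.integrable _) hi]
  congr 1
  ext z
  simp only [hW, residual, dgrad, Bdd.mul_apply, invBke_apply H.mem,
    superpose_apply (actsOnUnit_neg_inv_add_sq hε) (bke_mem L T H.mem t z.1)]
  rw [Real.exp_sub, Real.exp_log (H.pos t ht _), Real.exp_log (H.pos t ht _)]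
  ring

lemma real_compProd_univ_le (p : Measure Γ) [IsProbabilityMeasure p] :
    (p ⊗ₘ L).real univ ≤ rateBound L := by
  have h1 : (p ⊗ₘ L).real univ = ∫ x, rate L x ∂p := by
    have := Measure.integral_compProd (μ := p) (κ := L) (f := fun _ : Γ × Γ => (1 : ℝ))
      (integrable_const 1)
    simpa using this
  rw [h1]
  refine (integral_mono ((rate L).integrable p) (integrable_const (rateBound L))
    fun x => ?_).trans_eq (by simp)
  rw [rate_apply]
  exact real_univ_le_rateBound L x

/-- A density whose flux is the exponential flux has the marginals of the Doob transform. -/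
lemma IsAdmissible.integral_eq_condLaw [IsProbabilityMeasure μ] (hP : IsAdmissible L T μ P)
    (H : IsDoobTransform L T g μ) (hq : ∀ᵐ t ∂(volume.restrict (Ioo 0 T)),
      P.q t = expFlux L (fun x => Real.log (bke L T g t x)) (P.p t : Measure Γ))
    (φ : Bdd Γ) {s : ℝ} (hs : s ∈ Ioo 0 T) :
    ∫ x, φ x ∂(P.p s : Measure Γ) = ∫ x, φ x ∂(condLaw L T g μ s) := by
  have hs0 := hs.1.le
  set e : ℕ → ℝ := fun n => 1 / ((n : ℝ) + 1) with he_def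
  have he : ∀ n, 0 < e n := fun n => by positivity
  have hlim : Tendsto e atTop (𝓝 0) := tendsto_one_div_add_atTop_nhds_zero_nat
  -- The backward solution on [0, s] with value h_s φ at time s: u_s/h_s = φ, while u_0/h_0 is the
  -- integrand that represents the marginal of the Doob transform.
  set u : ℝ → Bdd Γ := bke L s (bke L T g s * φ) with hu
  have huc : Continuous u := continuous_bke L s _
  have hub : ∀ t ∈ Icc 0 s, ∀ x, |u t x| ≤ ‖φ‖ * bke L T g t x := fun t ht x => by
    have h1 := abs_semi_le (L := L) (sub_nonneg.2 ht.2) (u := bke L T g s * φ)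
      (v := ‖φ‖ • bke L T g s) (fun x => by
        rw [Bdd.mul_apply, Bdd.smul_apply, abs_mul, abs_of_nonneg (bke_mem L T H.mem s x).1,
          mul_comm]
        exact mul_le_mul_of_nonneg_right (φ.abs_apply_le x) (bke_mem L T H.mem s x).1) x
    have e1 : semi L (s - t) (bke L T g s) = bke L T g t := by
      rw [bke_of_le L T g hs.2.le, bke_of_le L T g (ht.2.trans hs.2.le), ← mul_apply_eq_comp,
        ← semi_add]
      congr 2; ring
    rw [map_smul, Bdd.smul_apply, e1] at h1
    rwa [hu, bke_of_le L s _ ht.2]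
  set G : ℕ → ℝ → ℝ := fun n r => ∫ x, ratioDeriv L T g (he n) u r x ∂(P.p r : Measure Γ) +
    ∫ z, dgrad (u r * invBke L T g (he n) r) z ∂(P.q r) with hG
  have hFc : ∀ n, Continuous fun r => u r * invBke L T g (he n) r := fun n =>
    Bdd.continuous_mul huc (continuous_invBke H.mem (he n))
  have hF'c : ∀ n, Continuous (ratioDeriv L T g (he n) u) := fun n =>
    continuous_ratioDeriv H.mem (he n) huc
  have hleib : ∀ n, ∫ x, (u s * invBke L T g (he n) s) x ∂(P.p s : Measure Γ) -
      ∫ x, (u 0 * invBke L T g (he n) 0) x ∂μ = ∫ r in Ioo 0 s, G n r := fun n => by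
    have := hP.integral_sub_integral (hFc n) (hF'c n) hs0 hs.2.le fun t ht =>
      hasDerivAt_mul_invBke H.mem (he n) (ht.2.trans hs.2) (hasDerivAt_bke L s _ ht.2)
    rwa [hP.initial, intervalIntegral.integral_of_le hs0, integral_Ioc_eq_integral_Ioo] at this
  have hGi : ∀ n, Integrable (G n) (volume.restrict (Ioo 0 s)) := fun n =>
    (intervalIntegrable_iff_integrableOn_Ioo_of_le hs0).1
      ((hP.intervalIntegrable_integral (hF'c n) le_rfl hs0 hs.2.le).add
        (hP.intervalIntegrable_integral_dgrad (hFc n) le_rfl hs0 hs.2.le))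
  have hq' : ∀ᵐ t ∂(volume.restrict (Ioo 0 s)),
      P.q t = expFlux L (fun x => Real.log (bke L T g t x)) (P.p t : Measure Γ) :=
    ae_restrict_of_ae_restrict_of_subset (Ioo_subset_Ioo_right hs.2.le) hq
  -- Dominated convergence is used twice: in space with the bound 1 + exp(∇ψ_r), then in time with
  -- the rate bound plus the flux mass.
  have hpt : ∀ᵐ r ∂(volume.restrict (Ioo 0 s)),
      (∀ n, ‖G n r‖ ≤ 4 * ‖φ‖ * (rateBound L + P.mass r)) ∧
        Tendsto (fun n => G n r) atTop (𝓝 0) := by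
    filter_upwards [hq', ae_restrict_mem measurableSet_Ioo] with r hr hrs
    have hrT : r ∈ Ico 0 T := ⟨hrs.1.le, hrs.2.trans hs.2⟩
    have hr' : r ∈ Icc 0 s := Ioo_subset_Icc_self hrs
    have hfin := P.finite_q r
    rw [hr] at hfin
    have hlog : Measurable fun x => Real.log (bke L T g r x) :=
      Real.measurable_log.comp (bke L T g r).measurable
    obtain ⟨hi, hmass⟩ := integral_expFlux hlog hfin (IsBddMeas.const (1 : ℝ))
    simp only [mul_one] at hi hmass
    have hmass' : ∫ z, Real.exp (dgrad (fun x => Real.log (bke L T g r x)) z)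
        ∂((P.p r : Measure Γ) ⊗ₘ L) = P.mass r := by
      rw [← hmass, DensityFlux.mass, hr]
      simp
    have hGe : ∀ n, G n r = ∫ z, residual (e n) (bke L T g r z.1) (bke L T g r z.2) (u r z.1)
        (u r z.2) ∂((P.p r : Measure Γ) ⊗ₘ L) := fun n => by
      simp only [hG]
      rw [hr]
      exact integral_ratioDeriv_add H (he n) u hrT _ hfin
    have hbound : ∀ n z, ‖residual (e n) (bke L T g r z.1) (bke L T g r z.2) (u r z.1) (u r z.2)‖ ≤
        4 * ‖φ‖ * (1 + Real.exp (dgrad (fun x => Real.log (bke L T g r x)) z)) := fun n z => by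
      rw [H.exp_dgrad_log hrT]
      exact abs_residual_le (he n) (H.pos r hrT _) (H.pos r hrT _) (hub r hr' _) (hub r hr' _)
    have hbi : Integrable (fun z => 4 * ‖φ‖ *
        (1 + Real.exp (dgrad (fun x => Real.log (bke L T g r x)) z)))
        ((P.p r : Measure Γ) ⊗ₘ L) := ((integrable_const (1 : ℝ)).add hi).const_mul _
    refine ⟨fun n => ?_, ?_⟩
    · rw [hGe]
      refine (norm_integral_le_of_norm_le hbi (ae_of_all _ (hbound n))).trans ?_
      rw [integral_const_mul, integral_add (integrable_const _) hi, hmass', integral_const,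
        smul_eq_mul, mul_one]
      have := real_compProd_univ_le (L := L) (P.p r : Measure Γ)
      gcongr
    · simp only [hGe]
      have h0 : (0 : ℝ) = ∫ _, (0 : ℝ) ∂((P.p r : Measure Γ) ⊗ₘ L) := by simp
      rw [h0]
      refine tendsto_integral_of_dominated_convergence _ (fun n => ?_) hbi
        (fun n => ae_of_all _ (hbound n)) (ae_of_all _ fun z => ?_)
      · exact (measurable_residual ((bke L T g r).measurable.comp measurable_fst)
          ((bke L T g r).measurable.comp measurable_snd) ((u r).measurable.comp measurable_fst)
          ((u r).measurable.comp measurable_snd) (e n)).aestronglyMeasurable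
      · exact (tendsto_residual (H.pos r hrT z.1) (H.pos r hrT z.2) _ _).comp hlim
  have hbi : Integrable (fun r => 4 * ‖φ‖ * (rateBound L + P.mass r)) (volume.restrict (Ioo 0 s)) :=
    ((integrable_const (rateBound L)).add
      (hP.integrableOn_mass.mono_set (Ioo_subset_Ioo_right hs.2.le))).const_mul _
  have hlimG : Tendsto (fun n => ∫ r in Ioo 0 s, G n r) atTop (𝓝 0) := by
    have h := tendsto_integral_of_dominated_convergence _
      (fun n => (hGi n).aestronglyMeasurable) hbi (fun n => hpt.mono fun r hr => hr.1 n)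
      (hpt.mono fun r hr => hr.2)
    rwa [integral_zero] at h
  have hratio : ∀ t ∈ Icc 0 s, ∀ ν : Measure Γ, IsProbabilityMeasure ν →
      Tendsto (fun n => ∫ x, (u t * invBke L T g (he n) t) x ∂ν) atTop
        (𝓝 (∫ x, u t x * (bke L T g t x)⁻¹ ∂ν)) := fun t ht ν hν => by
    have hpos : ∀ x, 0 < bke L T g t x := H.pos t ⟨ht.1, ht.2.trans_lt hs.2⟩
    refine tendsto_integral_of_dominated_convergence (fun _ => ‖φ‖)
      (fun n => (u t * invBke L T g (he n) t).measurable.aestronglyMeasurable)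
      (integrable_const _) (fun n => ae_of_all _ fun x => ?_) (ae_of_all _ fun x => ?_)
    · have hp := hpos x
      have hp' : 0 < bke L T g t x + e n := add_pos hp (he n)
      rw [Bdd.mul_apply, invBke_apply H.mem, Real.norm_eq_abs, abs_mul,
        abs_of_pos (inv_pos.2 hp'), ← div_eq_mul_inv, div_le_iff₀ hp']
      refine (hub t ht x).trans (mul_le_mul_of_nonneg_left ?_ (norm_nonneg _))
      linarith [he n]
    · simp only [Bdd.mul_apply, invBke_apply H.mem]
      refine Tendsto.const_mul _ (Tendsto.inv₀ ?_ (hpos x).ne')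
      simpa using hlim.const_add (bke L T g t x)
  have hdiff := (hratio s ⟨hs0, le_rfl⟩ (P.p s : Measure Γ) inferInstance).sub
    (hratio 0 ⟨le_rfl, hs0⟩ μ inferInstance)
  simp only [hleib] at hdiff
  have hfin := sub_eq_zero.1 (tendsto_nhds_unique hdiff hlimG)
  have hus : ∀ x, u s x * (bke L T g s x)⁻¹ = φ x := fun x => by
    rw [hu, bke_terminal, Bdd.mul_apply]
    have := (H.pos s ⟨hs0, hs.2⟩ x).ne'
    field_simp
  have hu0 : u 0 = semi L s (bke L T g s * φ) := by rw [hu, bke_of_le L s _ hs0, sub_zero]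
  simp only [hus, hu0] at hfin
  rw [hfin, (H.integral_condLaw ⟨hs0, hs.2.le⟩ φ).2]

/-- The Doob transform is the only pair whose cost does not exceed the lower bound. -/
lemma IsAdmissible.eq_pair [IsProbabilityMeasure μ] [MeasurableSpace.CountablyGenerated Γ]
    (hP : IsAdmissible L T μ P) (H : IsDoobTransform L T g μ)
    (hadm : IsAdmissible L T μ H.pair) {f : Γ → ℝ≥0∞} (hgf : ∀ x, g x = expNeg f x)
    (hcost : cost L T f P ≤ ENNReal.ofReal (∫ x, -Real.log (bke L T g 0 x) ∂μ)) :
    (∀ t ∈ Icc 0 T, P.p t = H.pair.p t) ∧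
      ∀ᵐ t ∂(volume.restrict (Ioo 0 T)), P.q t = H.pair.q t := by
  have hq := hP.ae_eq_expFlux H hgf hcost
  have hT := H.time_pos
  have h1 : ∀ t ∈ Ioo 0 T, ∀ A : Set Γ, MeasurableSet A →
      (P.p t : Measure Γ).real A = (H.pair.p t : Measure Γ).real A := fun t ht A hA => by
    have h := hP.integral_eq_condLaw H hq (Bdd.of _ (isBddMeas_indicator hA)) ht
    simp only [Bdd.of_apply] at h
    rw [H.pair_p (Ioo_subset_Icc_self ht), ← integral_indicator_one hA, ← integral_indicator_one hA]
    exact h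
  -- The endpoints are reached by setwise continuity; at T itself h may vanish, so the ratio
  -- argument does not apply there.
  have h2 : ∀ t ∈ Icc 0 T, (P.p t : Measure Γ) = (H.pair.p t : Measure Γ) := fun t ht => by
    ext A hA
    rw [← measureReal_eq_measureReal_iff]
    have hcl : closure (Ioo 0 T) = Icc 0 T := closure_Ioo hT.ne
    have := Set.EqOn.of_subset_closure (fun t ht => h1 t ht A hA) (hP.setwise_continuous A hA)
      (hadm.setwise_continuous A hA) Ioo_subset_Icc_self hcl.ge
    exact this ht
  refine ⟨fun t ht => Subtype.ext (h2 t ht), ?_⟩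
  filter_upwards [hq, ae_restrict_mem measurableSet_Ioo] with t hq ht
  rw [hq, H.pair_q_eq_expFlux (Ioo_subset_Ico_self ht), h2 t (Ioo_subset_Icc_self ht)]

end Identification

end JumpControl
end

/-! ### Assembly of the theorem. -/

theorem proposition3p5 {Γ : Type*} [TopologicalSpace Γ] [PolishSpace Γ] [MeasurableSpace Γ]
    [BorelSpace Γ] (L : Kernel Γ Γ) [IsFiniteKernel L] (T : ℝ) (hT : 0 < T)
    (μ : Measure Γ) [IsProbabilityMeasure μ]
    (f : Γ → ℝ≥0∞) (hf : Measurable f) (hproper : ∃ x, f x ≠ ⊤)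
    (hpos : JumpControl.InstantaneousPositivity L T (JumpControl.expNeg f)) :
    ∃ ψ : ℝ → Γ → ℝ,
      -- (i) existence and uniqueness for the Hamilton-Jacobi equation, and `ψ = log h`
      (JumpControl.IsHJESolution L T f ψ ∧
        (∀ ψ' : ℝ → Γ → ℝ, JumpControl.IsHJESolution L T f ψ' →
          ∀ t ∈ Ico 0 T, ∀ x, ψ' t x = ψ t x) ∧
        ∃ h : ℝ → Γ → ℝ, JumpControl.IsBKESolution L T (JumpControl.expNeg f) h ∧
          ∀ t ∈ Ico 0 T, ∀ x, 0 < h t x ∧ ψ t x = Real.log (h t x)) ∧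
      -- (iv) the value, as an identity in `[0, ∞]`
      ((∀ x, ψ 0 x ≤ 0) ∧
        JumpControl.gammaDet L T f μ = ∫⁻ x, ENNReal.ofReal (-ψ 0 x) ∂μ) ∧
      (Integrable (ψ 0) μ →
        -- (iv) for a finite value
        JumpControl.gammaDet L T f μ = ENNReal.ofReal (-∫ x, ψ 0 x ∂μ) ∧
        ∃ P : JumpControl.DensityFlux Γ,
          -- (ii) existence and uniqueness of the optimal pair
          (JumpControl.IsOptimal L T f μ P ∧
            ∀ P' : JumpControl.DensityFlux Γ, JumpControl.IsOptimal L T f μ P' →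
              (∀ t ∈ Icc 0 T, P'.p t = P.p t) ∧
              ∀ᵐ t ∂(volume.restrict (Ioo 0 T)), P'.q t = P.q t) ∧
          -- (iii) the optimal pair solves the controlled continuity equation
          ((∀ᵐ t ∂(volume.restrict (Ioo 0 T)),
              P.q t = JumpControl.expFlux L (ψ t) (P.p t : Measure Γ)) ∧
            JumpControl.SolvesControlledEquation L T ψ P.p)) := by
  obtain ⟨x₀, hx₀⟩ := hproper
  set g : JumpControl.Bdd Γ :=
    JumpControl.Bdd.of (JumpControl.expNeg f) (JumpControl.isBddMeas_expNeg hf) with hg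
  have hgf : ∀ x, g x = JumpControl.expNeg f x := fun x => rfl
  have hmem : ∀ x, g x ∈ Icc (0 : ℝ) 1 := fun x =>
    ⟨JumpControl.expNeg_nonneg f x, JumpControl.expNeg_le_one f x⟩
  have hbke := JumpControl.isBKESolution_bke L T (fun x => (hmem x).1) fun x => (hmem x).2
  have hne : ∃ x, JumpControl.expNeg f x ≠ 0 := ⟨x₀, by
    rw [JumpControl.expNeg_of_ne_top hx₀]
    exact (Real.exp_pos _).ne'⟩
  have hh : ∀ t ∈ Ico 0 T, ∀ x, 0 < JumpControl.bke L T g t x := hpos hne _ hbke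
  have h0 : (0 : ℝ) ∈ Ico 0 T := ⟨le_rfl, hT⟩
  have hψ := JumpControl.isHJESolution_log_bke L T hT hgf hh
  have hlog0 : ∀ x, Real.log (JumpControl.bke L T g 0 x) ≤ 0 := fun x =>
    Real.log_nonpos (JumpControl.bke_mem L T hmem 0 x).1 (JumpControl.bke_mem L T hmem 0 x).2
  have hlow : ∀ P, JumpControl.IsAdmissible L T μ P →
      ∫⁻ x, ENNReal.ofReal (-Real.log (JumpControl.bke L T g 0 x)) ∂μ ≤
        JumpControl.cost L T f P := fun P hP =>
    hP.lintegral_neg_log_bke_le hT.le hgf hmem (hh 0 h0)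
  have hge : ∫⁻ x, ENNReal.ofReal (-Real.log (JumpControl.bke L T g 0 x)) ∂μ ≤
      JumpControl.gammaDet L T f μ := le_iInf₂ hlow
  have hI : Integrable (fun x => Real.log (JumpControl.bke L T g 0 x)) μ →
      JumpControl.IsDoobTransform L T g μ := fun h => ⟨hT, hmem, hh, h⟩
  have hof : Integrable (fun x => Real.log (JumpControl.bke L T g 0 x)) μ →
      ∫⁻ x, ENNReal.ofReal (-Real.log (JumpControl.bke L T g 0 x)) ∂μ =
        ENNReal.ofReal (∫ x, -Real.log (JumpControl.bke L T g 0 x) ∂μ) := fun h =>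
    (ofReal_integral_eq_lintegral_ofReal h.neg (ae_of_all _ fun x => neg_nonneg.2 (hlog0 x))).symm
  have hadm : ∀ H : JumpControl.IsDoobTransform L T g μ,
      JumpControl.IsAdmissible L T μ H.pair := fun H =>
    H.isAdmissible_pair ((le_add_self.trans (H.cost_pair_le hf hgf)).trans_lt
      ENNReal.ofReal_lt_top)
  have hle : ∀ H : JumpControl.IsDoobTransform L T g μ, JumpControl.gammaDet L T f μ ≤
      JumpControl.cost L T f H.pair := fun H => iInf₂_le H.pair (hadm H)
  have hval : JumpControl.gammaDet L T f μ =
      ∫⁻ x, ENNReal.ofReal (-Real.log (JumpControl.bke L T g 0 x)) ∂μ := by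
    refine le_antisymm ?_ hge
    -- If the lower bound is infinite there is nothing to construct. Otherwise log h₀ ≤ 0 is
    -- integrable and the Doob transform attains it.
    by_cases hfin : ∫⁻ x, ENNReal.ofReal (-Real.log (JumpControl.bke L T g 0 x)) ∂μ = ⊤
    · rw [hfin]
      exact le_top
    · have hi : Integrable (fun x => Real.log (JumpControl.bke L T g 0 x)) μ := by
        have hm : Measurable fun x => -Real.log (JumpControl.bke L T g 0 x) :=
          (Real.measurable_log.comp (JumpControl.bke L T g 0).measurable).neg
        have := (lintegral_ofReal_ne_top_iff_integrable hm.aestronglyMeasurable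
          (ae_of_all _ fun x => neg_nonneg.2 (hlog0 x))).1 hfin
        simpa using this.neg
      rw [hof hi]
      exact (hle (hI hi)).trans ((hI hi).cost_pair_le hf hgf)
  refine ⟨fun t x => Real.log (JumpControl.bke L T g t x),
    ⟨hψ, fun ψ' hψ' t ht x => hψ'.unique hψ ht x, _, hbke, fun t ht x => ⟨hh t ht x, rfl⟩⟩,
    ⟨hlog0, hval⟩, fun hi => ?_⟩
  have H := hI hi
  have hval' := hval.trans (hof hi)
  have hopt : JumpControl.cost L T f H.pair = JumpControl.gammaDet L T f μ :=
    le_antisymm ((H.cost_pair_le hf hgf).trans hval'.ge) (hle H)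
  refine ⟨by rw [hval', integral_neg], H.pair, ⟨⟨hadm H, hopt⟩, fun P' hP' =>
    hP'.1.eq_pair H (hadm H) hgf (hP'.2.trans hval').le⟩, ?_, H.solvesControlledEquation⟩
  filter_upwards [ae_restrict_mem measurableSet_Ioo] with t ht
  exact H.pair_q_eq_expFlux (Ioo_subset_Ico_self ht)
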